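/- **Setting.** An instance of the random order covering integer program (RO-CIP) consists of costs $c\in\mathbb R^m$ with $c_j>0$ and a matrix $A\in\mathbb R^{n\times m}$ with nonnegative entries in which every row has a positive entry; the problem is to minimize $\langle c,z\rangle$ subject to $Az\ge 1$, $z\in\mathbb Z_+^m$. The numbers $m$ and $c$ are known in advance; the rows $a_i$ of $A$ are chosen adversarially and revealed one at a time in uniformly random order; the number $n$ of rows is not known to the algorithm. The solution $z$ may only be increased, and must after every round be feasible for the rows revealed so far. Let $\mathrm{OPT}$ be the optimal value of the integer program and $\mathrm{LP}$ that of its relaxation to $z\in\mathbb R_{\ge0}^m$. Algorithms run on a randomized real RAM: arithmetic, memory access, comparison, floor, exponential and the toss of a coin $\mathrm{Ber}(p)$ cost one step each. **Algorithm LearnOrCoverCIP.** Assume $a_{ij}\in[0,1]$ and let $\beta$ be a given number with $\mathrm{LP}\le\beta\le 2\,\mathrm{LP}$. Put $\gamma=1/(e-1)$ and $m'=|\{j:c_j\le\beta\}|$. Start with $z=0$ and $x_j=\frac{\beta}{c_jm'}$ if $c_j\le\beta$, $x_j=0$ otherwise. When row $i$ arrives, let $\Delta=\max(0,1-\langle a_i,z\rangle)$.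 If $\Delta\le\gamma$, do nothing. If $\Delta>\gamma$, let $\kappa=\Delta\cdot\min_k c_k/a_{ik}$ (over $k$ with $a_{ik}>0$), let $k^*$ be the first minimizer, and let $y=\kappa x/\beta$, for the vector $x$ held at the start of the round; then 1. add $\lfloor y_j\rfloor+\mathrm{Ber}(y_j-\lfloor y_j\rfloor)$ to $z_j$, independently for all $j$; 2. if $\langle a_i,x\rangle<\Delta$, multiply each $x_j$ by $\exp(\kappa a_{ij}/c_j)$ and then divide $x$ by $\langle c,x\rangle/\beta$; 3. add $\lceil\Delta/a_{ik^*}\rceil$ to $z_{k^*}$. **Theorem.** There are an absolute constant $C$ and a polynomial $p$ such that the following hold. (a) For all instances with $a_{ij}\in[0,1]$ and all $\beta$ with $\mathrm{LP}\le\beta\le2\,\mathrm{LP}$: for every arrival order and every outcome of the coins, $z$ only increases, and after each round $3z$ is feasible for all rows revealed so far (so the final $3z$ is feasible). LearnOrCoverCIP is carried out by a single program (the same for all instances) in at most $p(m+n)$ steps in total. If $mn\ge2$, then the final solution satisfies $\mathbb E\langle c,z\rangle\le C\,\beta\log(mn)$, and therefore $\mathbb E\langle c,3z\rangle\le C\log(mn)\cdot\mathrm{OPT}$;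 the expectation is over the random order and the coins. (b) Consequently RO-CIP has an $O(\log(mn))$-competitive polynomial-time randomized online algorithm that is not given $\beta$: there is a program which, on every instance, takes at most $p(m+n)$ steps in total for every arrival order and every outcome of its coins, holds a solution $z\in\mathbb Z_+^m$ that only increases and that after each round satisfies all the rows revealed so far, and for $mn\ge 2$ its final solution has $\mathbb E\langle c,z\rangle\le C\log(mn)\cdot\mathrm{OPT}$. -/

import Mathlib

open scoped ENNReal

noncomputable section

namespace CoveringIP

/-! ## Covering programs and their optimal values -/

/-- The inner product `⟨c, x⟩`. -/
def dot {m : ℕ} (c x : Fin m → ℝ) : ℝ := ∑ j, c j * x j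

/-- An integer vector `z ∈ ℤ₊ᵐ`, read as a real vector. -/
def toReal {m : ℕ} (z : Fin m → ℕ) : Fin m → ℝ := fun j => (z j : ℝ)

/-- Optimal value of the LP relaxation `min ⟨c, x⟩` subject to `A x ≥ 1`, `x ≥ 0`. -/
def lpOpt {m n : ℕ} (A : Fin n → Fin m → ℝ) (c : Fin m → ℝ) : ℝ :=
  sInf {v | ∃ x : Fin m → ℝ, (∀ j, 0 ≤ x j) ∧ (∀ i, 1 ≤ dot (A i) x) ∧ v = dot c x}

/-- Optimal value of the covering integer program `min ⟨c, z⟩` subject to `A z ≥ 1`, `z ∈ ℤ₊ᵐ`. -/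
def ipOpt {m n : ℕ} (A : Fin n → Fin m → ℝ) (c : Fin m → ℝ) : ℝ :=
  sInf {v | ∃ z : Fin m → ℕ, (∀ i, 1 ≤ dot (A i) (toReal z)) ∧ v = dot c (toReal z)}

/-! ## Probability -/

/-- `p` clipped to `[0, 1]`. -/
def clip (p : ℝ) : ℝ := max 0 (min p 1)

theorem clip_add (p : ℝ) :
    ENNReal.ofReal (clip p) + ENNReal.ofReal (1 - clip p) = 1 := by
  have h0 : 0 ≤ clip p := le_max_left _ _
  have h1 : clip p ≤ 1 := max_le zero_le_one (min_le_right _ _)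
  rw [← ENNReal.ofReal_add h0 (by linarith)]
  simp

/-- The coin `Ber(p)`. -/
def coin (p : ℝ) : PMF Bool :=
  PMF.ofFintype (fun b => cond b (ENNReal.ofReal (clip p)) (ENNReal.ofReal (1 - clip p)))
    (by simpa using clip_add p)

/-- Independent coins, the `j`-th one being `Ber(p j)`. -/
def coins {m : ℕ} (p : Fin m → ℝ) : PMF (Fin m → Bool) :=
  PMF.ofFintype (fun b => ∏ j, coin (p j) (b j)) (by
    rw [← Fintype.prod_sum (fun j b => coin (p j) b)]
    refine Finset.prod_eq_one fun j _ => ?_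
    have h := (coin (p j)).tsum_coe
    rwa [tsum_fintype] at h)

/-- The expectation of a nonnegative function. -/
def expect {S : Type*} (p : PMF S) (f : S → ℝ) : ℝ≥0∞ := ∑' s, p s * ENNReal.ofReal (f s)

/-- The law of the sequence of states of an online randomized procedure on the requests
`r 0, …, r (n-1)`: entry `0` is the initial state, and entry `t + 1` is the state after request `t`
was served. In each round the procedure sees only its own state and the current request. -/
def trajectory {S R : Type*} (serve : R → S → PMF S) :
    (n : ℕ) → S → (Fin n → R) → PMF (Fin (n + 1) → S)
  | 0, s, _ => PMF.pure fun _ => s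
  | n + 1, s, r => (serve (r 0) s).bind fun s' =>
      (trajectory serve n s' (Fin.tail r)).map fun h => Fin.cons s h

/-- The law of an outcome that depends on the arrival order, when the order is uniformly random. -/
def randomOrder {S : Type*} (n : ℕ) (p : Equiv.Perm (Fin n) → PMF S) : PMF S :=
  (PMF.uniformOfFintype (Equiv.Perm (Fin n))).bind p

/-- A history `z` of solutions (`z 0` initial, `z (t+1)` after the `t`-th row `r t` was served) is an
online solution if it only ever increases and if after every round `k` times the current solution
satisfies all the rows revealed so far. -/
def IsOnlineSolution {m n : ℕ} (k : ℕ) (r : Fin n → Fin m → ℝ) (z : Fin (n + 1) → Fin m → ℕ) :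
    Prop :=
  Monotone z ∧ ∀ t s : Fin n, s ≤ t → 1 ≤ dot (r s) (toReal fun j => k * z t.succ j)

/-! ## The algorithm LearnOrCoverCIP -/

/-- The threshold `γ = 1 / (e - 1)`. -/
def threshold : ℝ := (Real.exp 1 - 1)⁻¹

/-- The state of the algorithm: the fractional vector `x` and the integer solution `z`. -/
structure LocState (m : ℕ) where
  x : Fin m → ℝ
  z : Fin m → ℕ

/-- The extent `Δ = max (0, 1 - ⟨a, z⟩)` to which the row `a` is uncovered by `z`. -/
def deficit {m : ℕ} (a : Fin m → ℝ) (z : Fin m → ℕ) : ℝ := max 0 (1 - dot a (toReal z))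

/-- `min_k c_k / a_k`, where columns with `a_k = 0` have ratio `+∞` and so are left out. -/
def minRatio {m : ℕ} (c a : Fin m → ℝ) : ℝ := ⨅ k : {k : Fin m // 0 < a k}, c k / a k

/-- `j` is the (first) minimizer of `c_k / a_k`. -/
def IsArgmin {m : ℕ} (c a : Fin m → ℝ) (j : Fin m) : Prop :=
  0 < a j ∧ (∀ k, 0 < a k → c j / a j ≤ c k / a k) ∧ ∀ k < j, 0 < a k → c j / a j < c k / a k

/-- `x⁰_j = β / (c_j m') · 𝟙{c_j ≤ β}` with `m' = |{j : c_j ≤ β}|`, and `z⁰ = 0`. -/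
def locInit {m : ℕ} (β : ℝ) (c : Fin m → ℝ) : LocState m where
  x := fun j => if c j ≤ β then β / (c j * (Finset.univ.filter fun k => c k ≤ β).card) else 0
  z := 0

/-- Multiplicative update of `x` with rate `κ`, followed by normalization to cost `β`. -/
def learn {m : ℕ} (β : ℝ) (c a : Fin m → ℝ) (κ : ℝ) (x : Fin m → ℝ) : Fin m → ℝ :=
  let w : Fin m → ℝ := fun j => x j * Real.exp (κ * (a j / c j))
  fun j => w j / (dot c w / β)

open Classical in
/-- One round of the algorithm, on the arrival of the row `a`. -/
def locRound {m : ℕ} (β : ℝ) (c a : Fin m → ℝ) (s : LocState m) : PMF (LocState m) :=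
  let Δ := deficit a s.z
  let κ := Δ * minRatio c a
  let y : Fin m → ℝ := fun j => κ * s.x j / β
  if threshold < Δ then
    (coins fun j => Int.fract (y j)).map fun b =>
      { x := if dot a s.x < Δ then learn β c a κ s.x else s.x
        z := fun j => s.z j + (⌊y j⌋₊ + (b j).toNat) + if IsArgmin c a j then ⌈Δ / a j⌉₊ else 0 }
  else PMF.pure s

/-- The law of the history `z⁰, z¹, …, zⁿ` of integer solutions held by LearnOrCoverCIP with the
parameter `β` when the rows arrive as `r 0, …, r (n-1)`. -/
def learnOrCover {m n : ℕ} (β : ℝ) (c : Fin m → ℝ) (r : Fin n → Fin m → ℝ) :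
    PMF (Fin (n + 1) → Fin m → ℕ) :=
  (trajectory (locRound β c) n (locInit β c) r).map fun h t => (h t).z

/-! ## A randomized real random access machine with a step count

The memory consists of arrays of natural numbers and arrays of reals, indexed by natural numbers.
Programs are built from assignments, coin tosses, comparisons and `for` loops. Each arithmetic
operation, memory access, assignment, floor, exponential, comparison, coin toss and loop iteration
is charged at unit cost. -/

/-- The memory of the machine, and a clock that programs cannot read. -/
structure Config where
  int : ℕ → ℕ → ℕ
  real : ℕ → ℕ → ℝ
  clock : ℕ

/-- Integer expressions; `get a i` is the entry of the integer array `a` at index `i`, and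
`sub` is truncated at `0`. -/
inductive IExpr where
  | lit (k : ℕ)
  | get (a : ℕ) (i : IExpr)
  | add (e f : IExpr)
  | sub (e f : IExpr)
  | mul (e f : IExpr)

/-- Real expressions; `get a i` is the entry of the real array `a` at index `i`. -/
inductive RExpr where
  | ofInt (e : IExpr)
  | get (a : ℕ) (i : IExpr)
  | add (e f : RExpr)
  | sub (e f : RExpr)
  | mul (e f : RExpr)
  | div (e f : RExpr)
  | exp (e : RExpr)

/-- Commands. -/
inductive Cmd where
  /-- Do nothing. -/
  | skip
  /-- Store `e` in the integer array `a` at index `i`. -/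
  | setInt (a : ℕ) (i : IExpr) (e : IExpr)
  /-- Store `e` in the real array `a` at index `i`. -/
  | setReal (a : ℕ) (i : IExpr) (e : RExpr)
  /-- Store `⌊e⌋` (or `0` if `e < 0`) in the integer array `a` at index `i`. -/
  | setFloor (a : ℕ) (i : IExpr) (e : RExpr)
  /-- Store the outcome of a fresh coin `Ber(p)` in the integer array `a` at index `i`. -/
  | toss (a : ℕ) (i : IExpr) (p : RExpr)
  /-- First `f`, then `g`. -/
  | seq (f g : Cmd)
  /-- If `d < e` then `f` else `g`. -/
  | ifLt (d e : RExpr) (f g : Cmd)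
  /-- For `k = 0, …, e - 1`: store `k` in the integer array `a` at index `0`, then do `f`. The bound
  `e` is evaluated once, at the start. -/
  | loop (a : ℕ) (e : IExpr) (f : Cmd)

def IExpr.eval (s : Config) : IExpr → ℕ
  | .lit k => k
  | .get a i => s.int a (i.eval s)
  | .add e f => e.eval s + f.eval s
  | .sub e f => e.eval s - f.eval s
  | .mul e f => e.eval s * f.eval s

/-- The number of operations in an expression. -/
def IExpr.size : IExpr → ℕ
  | .lit _ => 1
  | .get _ i => i.size + 1
  | .add e f => e.size + f.size + 1
  | .sub e f => e.size + f.size + 1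
  | .mul e f => e.size + f.size + 1

def RExpr.eval (s : Config) : RExpr → ℝ
  | .ofInt e => (e.eval s : ℝ)
  | .get a i => s.real a (i.eval s)
  | .add e f => e.eval s + f.eval s
  | .sub e f => e.eval s - f.eval s
  | .mul e f => e.eval s * f.eval s
  | .div e f => e.eval s / f.eval s
  | .exp e => Real.exp (e.eval s)

/-- The number of operations in an expression. -/
def RExpr.size : RExpr → ℕ
  | .ofInt e => e.size + 1
  | .get _ i => i.size + 1
  | .add e f => e.size + f.size + 1
  | .sub e f => e.size + f.size + 1
  | .mul e f => e.size + f.size + 1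
  | .div e f => e.size + f.size + 1
  | .exp e => e.size + 1

def Config.tick (s : Config) (k : ℕ) : Config := { s with clock := s.clock + k }

def Config.putInt (s : Config) (a i v : ℕ) : Config :=
  { s with int := Function.update s.int a (Function.update (s.int a) i v) }

def Config.putReal (s : Config) (a i : ℕ) (v : ℝ) : Config :=
  { s with real := Function.update s.real a (Function.update (s.real a) i v) }

/-- Run `body 0`, …, `body (k-1)` one after the other. -/
def iterate (body : ℕ → Config → PMF Config) : ℕ → Config → PMF Config
  | 0, s => PMF.pure s
  | k + 1, s => (iterate body k s).bind (body k)

/-- The law of the configuration after a command has been executed. -/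
def Cmd.run : Cmd → Config → PMF Config
  | .skip, s => PMF.pure (s.tick 1)
  | .setInt a i e, s =>
      PMF.pure ((s.putInt a (i.eval s) (e.eval s)).tick (i.size + e.size + 1))
  | .setReal a i e, s =>
      PMF.pure ((s.putReal a (i.eval s) (e.eval s)).tick (i.size + e.size + 1))
  | .setFloor a i e, s =>
      PMF.pure ((s.putInt a (i.eval s) ⌊e.eval s⌋₊).tick (i.size + e.size + 1))
  | .toss a i p, s => (coin (p.eval s)).map fun b =>
      (s.putInt a (i.eval s) b.toNat).tick (i.size + p.size + 1)
  | .seq f g, s => (f.run s).bind g.run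
  | .ifLt d e f g, s =>
      if d.eval s < e.eval s then f.run (s.tick (d.size + e.size + 1))
      else g.run (s.tick (d.size + e.size + 1))
  | .loop a e f, s =>
      iterate (fun k s => f.run ((s.putInt a 0 k).tick 1)) (e.eval s) (s.tick (e.size + 1))

/-- An online algorithm: `setup` is executed before the first row arrives, and `serve` on the
arrival of each row. -/
structure OnlineProgram where
  setup : Cmd
  serve : Cmd

/-- A vector as an array, padded with zeros. -/
def toArray {m : ℕ} (v : Fin m → ℝ) : ℕ → ℝ := fun j => if h : j < m then v ⟨j, h⟩ else 0

/-- Initial memory: integer array `0` holds `m` at index `0`, real array `0` holds the costs `c`, real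
array `1` holds the parameter `β` at index `0`, and everything else is zero. -/
def Config.start {m : ℕ} (c : Fin m → ℝ) (β : ℝ) : Config where
  int := Function.update 0 0 (Function.update 0 0 m)
  real := Function.update (Function.update 0 0 (toArray c)) 1 (Function.update 0 0 β)
  clock := 0

/-- The arriving row is placed in real array `2`. -/
def Config.load {m : ℕ} (a : Fin m → ℝ) (s : Config) : Config :=
  { s with real := Function.update s.real 2 (toArray a) }

/-- The current solution `z` is held in integer array `1`. -/
def Config.solution (m : ℕ) (s : Config) : Fin m → ℕ := fun j => s.int 1 j

/-- The law of the history of configurations of an online algorithm (after the setup, and after each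
row), when it is given `m`, `c` and the parameter `β`, and the rows arrive as `r 0, …, r (n-1)`. -/
def OnlineProgram.run {m n : ℕ} (P : OnlineProgram) (c : Fin m → ℝ) (β : ℝ)
    (r : Fin n → Fin m → ℝ) : PMF (Fin (n + 1) → Config) :=
  (P.setup.run (Config.start c β)).bind fun s =>
    trajectory (fun a s => P.serve.run (Config.load a s)) n s r

/-- The law of the history of solutions held by an online algorithm. -/
def OnlineProgram.solutions {m n : ℕ} (P : OnlineProgram) (c : Fin m → ℝ) (β : ℝ)
    (r : Fin n → Fin m → ℝ) : PMF (Fin (n + 1) → Fin m → ℕ) :=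
  (P.run c β r).map fun h t => (h t).solution m

/-- With every outcome of the coins, the total number of steps is at most `B`. -/
def OnlineProgram.RunsWithin {m n : ℕ} (P : OnlineProgram) (c : Fin m → ℝ) (β : ℝ)
    (r : Fin n → Fin m → ℝ) (B : ℕ) : Prop :=
  ∀ h ∈ (P.run c β r).support, (h (Fin.last n)).clock ≤ B

/-- The expected cost of `k` times the final solution, when the rows of `A` arrive in uniformly random
order and `law r` is the law of the history of solutions for the arrival sequence `r`. -/
def expectedCost {m n : ℕ} (k : ℕ) (A : Fin n → Fin m → ℝ) (c : Fin m → ℝ)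
    (law : (Fin n → Fin m → ℝ) → PMF (Fin (n + 1) → Fin m → ℕ)) : ℝ≥0∞ :=
  expect (randomOrder n fun σ => law fun t => A (σ t))
    fun z => dot c (toReal fun j => k * z (Fin.last n) j)

end CoveringIP

end

/-!
The cost of `z` is controlled by a potential: the cost itself, plus a multiple of the logarithm of
the total weight of the uncovered rows, where a row weighs the price of covering it greedily, plus
the relative entropy between an optimal LP solution `u` and the fractional vector `x`. When a row
`a` arrives, rounding `κ x / β` covers each uncovered row with a probability that is proportional
to its coverage by `x`, so the weight of the uncovered rows shrinks by a factor given by their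
mean coverage. If `⟨a, x⟩` is small instead, then the multiplicative update moves `x` towards `u`,
because `⟨a, u⟩ ≥ 1`, and the relative entropy drops. The arriving row is a uniformly random one
of the remaining rows, so its own coverage agrees with the mean coverage in expectation, and the
two effects together pay for the cost of the round.

Without knowledge of `β` the value is guessed. The guess is replaced by one at least twice as
large when the greedy price of the arriving row exceeds it, and it is doubled when the total drop
of the relative entropy, whose exponential is the certificate `G`, exceeds the initial `log m`.
Hence a guess is never more than twice the optimal value, and the costs of the phases form a
geometric sum. Rows are truncated at `1` beforehand, which does not change the integer solutions.
-/

noncomputable section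

namespace CoveringIP

/-! ### Expectations of discrete laws -/

section mean

variable {S T : Type*}

/-- The expectation, under a discrete law, of a function with values in `[0, ∞]`. -/
def mean (p : PMF S) (f : S → ℝ≥0∞) : ℝ≥0∞ := ∑' s, p s * f s

theorem mean_bind (p : PMF S) (k : S → PMF T) (f : T → ℝ≥0∞) :
    mean (p.bind k) f = mean p fun s => mean (k s) f := by
  simp only [mean, PMF.bind_apply, ← ENNReal.tsum_mul_right, ← ENNReal.tsum_mul_left]
  rw [ENNReal.tsum_comm]
  simp only [mul_assoc]

theorem mean_pure (s : S) (f : S → ℝ≥0∞) : mean (PMF.pure s) f = f s := by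
  rw [mean, tsum_eq_single s fun t ht => by simp [PMF.pure_apply, ht]]
  simp

theorem mean_map (p : PMF S) (g : S → T) (f : T → ℝ≥0∞) :
    mean (p.map g) f = mean p fun s => f (g s) := by
  rw [PMF.map, mean_bind]
  simp [mean_pure]

theorem mean_fintype [Fintype S] (p : PMF S) (f : S → ℝ≥0∞) : mean p f = ∑ s, p s * f s :=
  tsum_fintype _

theorem mean_const_mul (p : PMF S) (r : ℝ≥0∞) (f : S → ℝ≥0∞) :
    mean p (fun s => r * f s) = r * mean p f := by
  simp only [mean, ← ENNReal.tsum_mul_left, mul_left_comm r]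

theorem mean_finset_sum {ι : Type*} (I : Finset ι) (p : PMF S) (f : ι → S → ℝ≥0∞) :
    mean p (fun s => ∑ i ∈ I, f i s) = ∑ i ∈ I, mean p (f i) := by
  simp only [mean, Finset.mul_sum]
  exact Summable.tsum_finsetSum fun _ _ => ENNReal.summable

theorem mean_le_mean_of_support {p : PMF S} {f g : S → ℝ≥0∞} (h : ∀ s ∈ p.support, f s ≤ g s) :
    mean p f ≤ mean p g := by
  refine ENNReal.tsum_le_tsum fun s => ?_
  by_cases hs : p s = 0
  · simp [hs]
  · gcongr
    exact h s ((p.mem_support_iff s).2 hs)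

theorem bind_congr_of_support {p : PMF S} {k l : S → PMF T} (h : ∀ s ∈ p.support, k s = l s) :
    p.bind k = p.bind l := by
  ext t
  simp only [PMF.bind_apply]
  refine tsum_congr fun s => ?_
  by_cases hs : p s = 0
  · simp [hs]
  · rw [h s ((p.mem_support_iff s).2 hs)]

end mean

/-! ### Trajectories and random arrival order -/

section trajectory

variable {S T R : Type*}

theorem mean_trajectory_succ (serve : R → S → PMF S) (n : ℕ) (s : S) (r : Fin (n + 1) → R)
    (f : S → ℝ≥0∞) :
    mean (trajectory serve (n + 1) s r) (fun h => f (h (Fin.last (n + 1)))) =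
      mean (serve (r 0) s) fun s' =>
        mean (trajectory serve n s' (Fin.tail r)) fun h => f (h (Fin.last n)) := by
  simp only [trajectory, mean_bind, mean_map, ← Fin.succ_last, Fin.cons_succ]

theorem step_of_mem_support_trajectory (serve : R → S → PMF S) :
    ∀ (n : ℕ) (s : S) (r : Fin n → R), ∀ h ∈ (trajectory serve n s r).support,
      h 0 = s ∧ ∀ t : Fin n, h t.succ ∈ (serve (r t) (h t.castSucc)).support
  | 0, s, r, h, hh => by
      simp only [trajectory, PMF.support_pure, Set.mem_singleton_iff] at hh
      subst hh
      exact ⟨rfl, fun t => t.elim0⟩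
  | n + 1, s, r, h, hh => by
      simp only [trajectory, PMF.mem_support_bind_iff, PMF.mem_support_map_iff] at hh
      obtain ⟨s', hs', h', hh', rfl⟩ := hh
      obtain ⟨h_start, h_step⟩ := step_of_mem_support_trajectory serve n s' _ h' hh'
      refine ⟨rfl, Fin.cases ?_ fun t => ?_⟩
      · simpa [h_start] using hs'
      · simpa [Fin.tail, ← Fin.succ_castSucc] using h_step t

theorem invariant_of_mem_support_trajectory {serve : R → S → PMF S} {I : S → Prop} {n : ℕ} {s : S}
    {r : Fin n → R} (hs : I s) (hI : ∀ t s, I s → ∀ s' ∈ (serve (r t) s).support, I s')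
    {h : Fin (n + 1) → S} (hh : h ∈ (trajectory serve n s r).support) (t : Fin (n + 1)) :
    I (h t) := by
  obtain ⟨h_start, h_step⟩ := step_of_mem_support_trajectory serve n s r h hh
  induction t using Fin.induction with
  | zero => rwa [h_start]
  | succ t ih => exact hI t _ ih _ (h_step t)

theorem trajectory_comp {R' : Type*} (serve : R' → S → PMF S) (f : R → R') :
    ∀ (n : ℕ) (s : S) (r : Fin n → R),
      trajectory (fun a => serve (f a)) n s r = trajectory serve n s fun t => f (r t)
  | 0, s, r => rfl
  | n + 1, s, r => by
      simp only [trajectory]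
      congr 1
      ext1 s'
      rw [trajectory_comp serve f n s' (Fin.tail r)]
      rfl

theorem map_trajectory {serve : R → S → PMF S} {serve' : R → T → PMF T} {abs : S → T}
    {I : S → Prop} :
    ∀ {n : ℕ} {s : S} {r : Fin n → R}, I s →
      (∀ t s, I s → (serve (r t) s).map abs = serve' (r t) (abs s)) →
      (∀ t s, I s → ∀ s' ∈ (serve (r t) s).support, I s') →
      (trajectory serve n s r).map (fun h t => abs (h t)) = trajectory serve' n (abs s) r
  | 0, s, r, _, _, _ => by simp [trajectory, PMF.pure_map]
  | n + 1, s, r, hs, h_map, hI => by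
      simp only [trajectory]
      rw [← h_map 0 s hs, PMF.bind_map, PMF.map_bind]
      refine bind_congr_of_support fun s' hs' => ?_
      rw [Function.comp_apply, ← map_trajectory (r := Fin.tail r)
        (hI 0 s hs s' hs') (fun t => h_map t.succ) (fun t => hI t.succ), PMF.map_comp, PMF.map_comp]
      congr 1
      ext h t
      refine Fin.cases ?_ (fun t => ?_) t <;> simp

/-- The requests that remain when request `i` has been served. They are listed in the order in which
`Equiv.Perm.decomposeFin` enumerates them. -/
def dropRow {k : ℕ} (i : Fin (k + 1)) (A : Fin (k + 1) → R) : Fin k → R :=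
  fun j => A (Equiv.swap 0 i j.succ)

theorem add_sum_dropRow {k : ℕ} {M : Type*} [AddCommMonoid M] (i : Fin (k + 1))
    (A : Fin (k + 1) → R) (f : R → M) : f (A i) + ∑ j, f (dropRow i A j) = ∑ j, f (A j) := by
  rw [← Equiv.sum_comp (Equiv.swap 0 i) fun j => f (A j), Fin.sum_univ_succ]
  simp [dropRow]

theorem sum_perm_succ {k : ℕ} {M : Type*} [AddCommMonoid M] (F : Equiv.Perm (Fin (k + 1)) → M) :
    ∑ σ, F σ = ∑ i, ∑ τ, F (Equiv.Perm.decomposeFin.symm (i, τ)) := by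
  rw [← Equiv.sum_comp Equiv.Perm.decomposeFin.symm, Fintype.sum_prod_type]

theorem mean_trajectory_decomposeFin (serve : R → S → PMF S) {n : ℕ} (A : Fin (n + 1) → R) (s : S)
    (f : S → ℝ≥0∞) (i : Fin (n + 1)) (τ : Equiv.Perm (Fin n)) :
    mean (trajectory serve (n + 1) s fun t => A (Equiv.Perm.decomposeFin.symm (i, τ) t))
        (fun h => f (h (Fin.last (n + 1)))) =
      mean (serve (A i) s) fun s' => mean (trajectory serve n s' fun t => dropRow i A (τ t))
        fun h => f (h (Fin.last n)) := by
  rw [mean_trajectory_succ]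
  simp [Fin.tail_def, dropRow, Equiv.Perm.decomposeFin_symm_apply_succ]

/-- A potential `Φ`, depending on the remaining requests and the state, that dominates the payoff
`f` when no request is left, and does not increase in expectation when the next request is drawn
uniformly from the remaining ones. All this is only asked for where the invariant `Inv` holds. -/
structure IsRandomOrderPotential (serve : R → S → PMF S) (Inv : (k : ℕ) → (Fin k → R) → S → Prop)
    (Φ : (k : ℕ) → (Fin k → R) → S → ℝ≥0∞) (f : S → ℝ≥0∞) : Prop where
  le_final : ∀ A s, Inv 0 A s → f s ≤ Φ 0 A s
  inv_serve : ∀ k A s, Inv (k + 1) A s → ∀ i, ∀ s' ∈ (serve (A i) s).support, Inv k (dropRow i A) s'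
  sum_mean_le : ∀ k A s, Inv (k + 1) A s →
    ∑ i, mean (serve (A i) s) (Φ k (dropRow i A)) ≤ (k + 1 : ℕ) * Φ (k + 1) A s

namespace IsRandomOrderPotential

variable {serve : R → S → PMF S} {Inv : (k : ℕ) → (Fin k → R) → S → Prop}
  {Φ : (k : ℕ) → (Fin k → R) → S → ℝ≥0∞} {f : S → ℝ≥0∞}

theorem sum_perm_mean_le (hΦ : IsRandomOrderPotential serve Inv Φ f) :
    ∀ (n : ℕ) (A : Fin n → R) (s : S), Inv n A s →
      ∑ σ : Equiv.Perm (Fin n), mean (trajectory serve n s fun t => A (σ t))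
        (fun h => f (h (Fin.last n))) ≤ n.factorial * Φ n A s
  | 0, A, s, hs => by simpa [trajectory, mean_pure] using hΦ.le_final A s hs
  | n + 1, A, s, hs => by
      simp only [sum_perm_succ, mean_trajectory_decomposeFin]
      calc _ ≤ ∑ i, (n.factorial : ℝ≥0∞) * mean (serve (A i) s) (Φ n (dropRow i A)) := by
            refine Finset.sum_le_sum fun i _ => ?_
            rw [← mean_finset_sum, ← mean_const_mul]
            exact mean_le_mean_of_support fun s' hs' =>
              sum_perm_mean_le hΦ n _ s' (hΦ.inv_serve n A s hs i s' hs')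
        _ = n.factorial * ∑ i, mean (serve (A i) s) (Φ n (dropRow i A)) := by rw [Finset.mul_sum]
        _ ≤ n.factorial * ((n + 1 : ℕ) * Φ (n + 1) A s) := by gcongr; exact hΦ.sum_mean_le n A s hs
        _ = (n + 1).factorial * Φ (n + 1) A s := by rw [Nat.factorial_succ]; push_cast; ring

theorem mean_randomOrder_le (hΦ : IsRandomOrderPotential serve Inv Φ f) {n : ℕ} {A : Fin n → R}
    {s : S} (hs : Inv n A s) {g : (Fin (n + 1) → S) → T} {F : T → ℝ≥0∞}
    (hF : ∀ h, F (g h) = f (h (Fin.last n))) :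
    mean (randomOrder n fun σ => (trajectory serve n s fun t => A (σ t)).map g) F ≤ Φ n A s := by
  rw [randomOrder, mean_bind, mean_fintype]
  simp only [PMF.uniformOfFintype_apply, mean_map, hF, ← Finset.mul_sum]
  rw [mul_comm, ← div_eq_mul_inv]
  refine ENNReal.div_le_of_le_mul ?_
  rw [mul_comm]
  simpa [Fintype.card_perm] using hΦ.sum_perm_mean_le n A s hs

end IsRandomOrderPotential

end trajectory

/-! ### Independent coins and randomized rounding -/

section coinMean

variable {ι : Type*} [Fintype ι] {p : ι → ℝ}

/-- The probability that independent coins `Ber(p j)` show `b`, as a real number. -/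
def coinWeight (p : ι → ℝ) (b : ι → Bool) : ℝ := ∏ j, bif b j then p j else 1 - p j

theorem coinWeight_nonneg (hp : ∀ j, p j ∈ Set.Icc 0 1) (b : ι → Bool) : 0 ≤ coinWeight p b := by
  refine Finset.prod_nonneg fun j _ => ?_
  cases b j
  · simpa using (hp j).2
  · simpa using (hp j).1

theorem coins_apply {m : ℕ} {p : Fin m → ℝ} (hp : ∀ j, p j ∈ Set.Icc 0 1) (b : Fin m → Bool) :
    coins p b = ENNReal.ofReal (coinWeight p b) := by
  have h_clip : ∀ j, clip (p j) = p j := fun j => by simp [clip, (hp j).1, (hp j).2]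
  rw [coins, PMF.ofFintype_apply, coinWeight, ENNReal.ofReal_prod_of_nonneg]
  · refine Finset.prod_congr rfl fun j _ => ?_
    cases b j <;> simp [coin, h_clip]
  · intro j _
    cases b j
    · simpa using (hp j).2
    · simpa using (hp j).1

variable [DecidableEq ι]

/-- The real expectation of a function of independent coins `Ber(p j)`. -/
def coinMean (p : ι → ℝ) (f : (ι → Bool) → ℝ) : ℝ := ∑ b, coinWeight p b * f b

theorem coinMean_mono (hp : ∀ j, p j ∈ Set.Icc 0 1) {f g : (ι → Bool) → ℝ} (h : ∀ b, f b ≤ g b) :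
    coinMean p f ≤ coinMean p g :=
  Finset.sum_le_sum fun b _ => mul_le_mul_of_nonneg_left (h b) (coinWeight_nonneg hp b)

theorem coinMean_nonneg (hp : ∀ j, p j ∈ Set.Icc 0 1) {f : (ι → Bool) → ℝ} (hf : ∀ b, 0 ≤ f b) :
    0 ≤ coinMean p f :=
  Finset.sum_nonneg fun b _ => mul_nonneg (coinWeight_nonneg hp b) (hf b)

theorem coinMean_prod (f : ι → Bool → ℝ) :
    coinMean p (fun b => ∏ j, f j (b j)) = ∏ j, (p j * f j true + (1 - p j) * f j false) := by
  simp only [coinMean, coinWeight, ← Finset.prod_mul_distrib]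
  rw [← Fintype.prod_sum (fun j b => (bif b then p j else 1 - p j) * f j b)]
  simp

theorem coinMean_const (r : ℝ) : coinMean p (fun _ => r) = r := by
  have h_one := coinMean_prod (p := p) (fun _ _ => 1)
  simp only [coinMean, Finset.prod_const_one, mul_one] at h_one
  rw [coinMean, ← Finset.sum_mul, h_one]
  simp

theorem coinMean_add (f g : (ι → Bool) → ℝ) :
    coinMean p (fun b => f b + g b) = coinMean p f + coinMean p g := by
  simp [coinMean, mul_add, Finset.sum_add_distrib]

theorem coinMean_const_mul (r : ℝ) (f : (ι → Bool) → ℝ) :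
    coinMean p (fun b => r * f b) = r * coinMean p f := by
  simp only [coinMean, Finset.mul_sum, mul_left_comm r]

theorem coinMean_finset_sum {κ : Type*} (s : Finset κ) (f : κ → (ι → Bool) → ℝ) :
    coinMean p (fun b => ∑ i ∈ s, f i b) = ∑ i ∈ s, coinMean p (f i) := by
  simp only [coinMean, Finset.mul_sum]
  exact Finset.sum_comm

theorem coinMean_toNat (j : ι) : coinMean p (fun b => ((b j).toNat : ℝ)) = p j := by
  have h_prod : ∀ b : ι → Bool, ((b j).toNat : ℝ) = ∏ i, if i = j then ((b i).toNat : ℝ) else 1 :=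
    fun b => by simp
  simp only [h_prod]
  rw [coinMean_prod fun i b => if i = j then (b.toNat : ℝ) else 1, Finset.prod_eq_single j]
  · simp
  · intro i _ hi
    simp [hi]
  · simp

theorem mean_coins {m : ℕ} {p : Fin m → ℝ} (hp : ∀ j, p j ∈ Set.Icc 0 1) {f : (Fin m → Bool) → ℝ}
    (hf : ∀ b, 0 ≤ f b) :
    mean (coins p) (fun b => ENNReal.ofReal (f b)) = ENNReal.ofReal (coinMean p f) := by
  rw [mean_fintype, coinMean, ENNReal.ofReal_sum_of_nonneg
    fun b _ => mul_nonneg (coinWeight_nonneg hp b) (hf b)]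
  refine Finset.sum_congr rfl fun b _ => ?_
  rw [coins_apply hp, ENNReal.ofReal_mul (coinWeight_nonneg hp b)]

end coinMean

section rounding

theorem natFloor_add_fract {y : ℝ} (hy : 0 ≤ y) : (⌊y⌋₊ : ℝ) + Int.fract y = y := by
  rw [natCast_floor_eq_intCast_floor hy]
  exact Int.floor_add_fract y

theorem fract_mul_exp_neg_add_le {a f : ℝ} (ha : a ∈ Set.Icc 0 1) (hf : 0 ≤ f) :
    f * Real.exp (-a) + (1 - f) ≤ Real.exp (-(a * f / 2)) := by
  have h_half : Real.exp (-a) ≤ 1 - a / 2 := by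
    rw [Real.exp_neg, inv_le_iff_one_le_mul₀ (Real.exp_pos a)]
    nlinarith [Real.add_one_le_exp a, ha.1, ha.2]
  nlinarith [Real.add_one_le_exp (-(a * f / 2))]

theorem mean_exp_neg_round_le {a y : ℝ} (ha : a ∈ Set.Icc 0 1) (hy : 0 ≤ y) :
    Int.fract y * Real.exp (-(a * (⌊y⌋₊ + 1))) + (1 - Int.fract y) * Real.exp (-(a * ⌊y⌋₊)) ≤
      Real.exp (-(a * y / 2)) := by
  have h_floor : 0 ≤ a * (⌊y⌋₊ : ℝ) := mul_nonneg ha.1 (Nat.cast_nonneg _)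
  have h_split : a * y = a * ⌊y⌋₊ + a * Int.fract y := by rw [← mul_add, natFloor_add_fract hy]
  calc _ = Real.exp (-(a * ⌊y⌋₊)) * (Int.fract y * Real.exp (-a) + (1 - Int.fract y)) := by
        rw [show -(a * ((⌊y⌋₊ : ℝ) + 1)) = -(a * ⌊y⌋₊) + -a by ring, Real.exp_add]
        ring
    _ ≤ Real.exp (-(a * ⌊y⌋₊ / 2)) * Real.exp (-(a * Int.fract y / 2)) := by
        gcongr
        · exact add_nonneg (mul_nonneg (Int.fract_nonneg y) (Real.exp_pos _).le)
            (sub_nonneg.2 (Int.fract_lt_one y).le)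
        · linarith
        · exact fract_mul_exp_neg_add_le ha (Int.fract_nonneg y)
    _ = Real.exp (-(a * y / 2)) := by
        rw [← Real.exp_add, h_split]
        ring_nf

/-- The randomized rounding of `y`, with the coins `b`. -/
def rounding {ι : Type*} (y : ι → ℝ) (b : ι → Bool) : ι → ℕ := fun j => ⌊y j⌋₊ + (b j).toNat

variable {m : ℕ} {a y : Fin m → ℝ}

theorem coinMean_dot_rounding (a : Fin m → ℝ) (hy : ∀ j, 0 ≤ y j) :
    coinMean (fun j => Int.fract (y j)) (fun b => dot a (toReal (rounding y b))) = dot a y := by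
  simp only [dot, toReal, rounding, coinMean_finset_sum, coinMean_const_mul]
  refine Finset.sum_congr rfl fun j _ => ?_
  push_cast
  rw [coinMean_add, coinMean_const, coinMean_toNat, natFloor_add_fract (hy j)]

theorem coinMean_exp_neg_dot_rounding_le (ha : ∀ j, a j ∈ Set.Icc 0 1) (hy : ∀ j, 0 ≤ y j) :
    coinMean (fun j => Int.fract (y j)) (fun b => Real.exp (-dot a (toReal (rounding y b)))) ≤
      Real.exp (-(dot a y / 2)) := by
  have h_prod : ∀ b, Real.exp (-dot a (toReal (rounding y b))) =
      ∏ j, Real.exp (-(a j * (⌊y j⌋₊ + ((b j).toNat : ℝ)))) := fun b => by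
    rw [← Real.exp_sum, Finset.sum_neg_distrib]
    simp [dot, toReal, rounding]
  simp only [h_prod]
  rw [coinMean_prod fun j t => Real.exp (-(a j * (⌊y j⌋₊ + (t.toNat : ℝ)))), dot, Finset.sum_div,
    ← Finset.sum_neg_distrib, Real.exp_sum]
  refine Finset.prod_le_prod (fun j _ => ?_) fun j _ => ?_
  · have := Int.fract_nonneg (y j)
    have := (Int.fract_lt_one (y j)).le
    have : 0 ≤ 1 - Int.fract (y j) := by linarith
    positivity
  · simpa using mean_exp_neg_round_le (ha j) (hy j)

theorem exp_neg_half_le {t : ℝ} (ht : 0 ≤ t) : Real.exp (-(t / 2)) ≤ 1 - min 1 t / 3 := by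
  have h_exp := Real.add_one_le_exp (t / 2)
  rw [Real.exp_neg, inv_le_iff_one_le_mul₀ (Real.exp_pos _)]
  rcases le_total 1 t with h | h
  · rw [min_eq_left h]
    linarith
  · rw [min_eq_right h]
    nlinarith

theorem le_coinMean_min_dot_rounding (ha : ∀ j, a j ∈ Set.Icc 0 1) (hy : ∀ j, 0 ≤ y j) :
    min 1 (dot a y) / 3 ≤
      coinMean (fun j => Int.fract (y j)) (fun b => min 1 (dot a (toReal (rounding y b)))) := by
  have h_dot : 0 ≤ dot a y := Finset.sum_nonneg fun j _ => mul_nonneg (ha j).1 (hy j)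
  have h_min : ∀ b, 1 + -1 * Real.exp (-dot a (toReal (rounding y b))) ≤
      min 1 (dot a (toReal (rounding y b))) := fun b => by
    have := Real.add_one_le_exp (-dot a (toReal (rounding y b)))
    have := Real.exp_pos (-dot a (toReal (rounding y b)))
    refine le_min ?_ ?_ <;> linarith
  have h_mean := coinMean_mono (fun j => unitInterval.fract_mem (y j)) h_min
  rw [coinMean_add, coinMean_const, coinMean_const_mul] at h_mean
  linarith [coinMean_exp_neg_dot_rounding_le ha hy, exp_neg_half_le h_dot]

end rounding

/-! ### Rows, cheapest columns and deficits -/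

section rows

variable {m : ℕ}

theorem dot_nonneg {a x : Fin m → ℝ} (ha : ∀ j, 0 ≤ a j) (hx : ∀ j, 0 ≤ x j) : 0 ≤ dot a x :=
  dotProduct_nonneg_of_nonneg ha hx

theorem dot_add (a x y : Fin m → ℝ) : dot a (x + y) = dot a x + dot a y := dotProduct_add a x y

theorem dot_smul (a : Fin m → ℝ) (r : ℝ) (x : Fin m → ℝ) : dot a (r • x) = r * dot a x :=
  dotProduct_smul r a x

theorem toReal_add (z w : Fin m → ℕ) : toReal (z + w) = toReal z + toReal w :=
  funext fun j => Nat.cast_add (z j) (w j)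

theorem dot_toReal_nonneg {a : Fin m → ℝ} (ha : ∀ j, 0 ≤ a j) (z : Fin m → ℕ) :
    0 ≤ dot a (toReal z) :=
  dot_nonneg ha fun _ => Nat.cast_nonneg _

theorem dot_toReal_mono {a : Fin m → ℝ} (ha : ∀ j, 0 ≤ a j) {z z' : Fin m → ℕ} (h : z ≤ z') :
    dot a (toReal z) ≤ dot a (toReal z') :=
  Finset.sum_le_sum fun j _ => mul_le_mul_of_nonneg_left (Nat.cast_le.2 (h j)) (ha j)

/-- A row of a covering program that can be satisfied and has all its coefficients in `[0, 1]`. -/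
def IsRow (a : Fin m → ℝ) : Prop := (∀ j, a j ∈ Set.Icc 0 1) ∧ ∃ j, 0 < a j

variable {c a : Fin m → ℝ}

theorem IsRow.nonneg (ha : IsRow a) (j : Fin m) : 0 ≤ a j := (ha.1 j).1

theorem minRatio_le {k : Fin m} (hk : 0 < a k) : minRatio c a ≤ c k / a k :=
  ciInf_le (Set.finite_range fun k : {k : Fin m // 0 < a k} => c k / a k).bddBelow ⟨k, hk⟩

theorem minRatio_eq {k : Fin m} (hk : IsArgmin c a k) : minRatio c a = c k / a k :=
  haveI : Nonempty {k : Fin m // 0 < a k} := ⟨⟨k, hk.1⟩⟩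
  le_antisymm (minRatio_le hk.1) (le_ciInf fun l => hk.2.1 l l.2)

theorem exists_isArgmin (c : Fin m → ℝ) (ha : ∃ j, 0 < a j) : ∃ k, IsArgmin c a k := by
  classical
  obtain ⟨j, hj⟩ := ha
  obtain ⟨l, hl, hl_min⟩ := Finset.exists_min_image {k | 0 < a k} (fun k => c k / a k)
    ⟨j, by simpa using hj⟩
  have h_nonempty : ({k | 0 < a k ∧ c k / a k = c l / a l} : Finset (Fin m)).Nonempty :=
    ⟨l, by simpa using hl⟩
  have h_mem := Finset.min'_mem _ h_nonempty
  have h_first := Finset.min'_le {k | 0 < a k ∧ c k / a k = c l / a l}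
  simp only [Finset.mem_filter, Finset.mem_univ, true_and] at h_mem hl_min h_first
  refine ⟨_, h_mem.1, fun k hk => ?_, fun k hk_lt hk => ?_⟩
  · rw [h_mem.2]
    exact hl_min k hk
  · rw [h_mem.2]
    exact (hl_min k hk).lt_of_ne fun h => (h_first k ⟨hk, h.symm⟩).not_gt hk_lt

theorem IsArgmin.unique {k l : Fin m} (hk : IsArgmin c a k) (hl : IsArgmin c a l) : k = l := by
  rcases lt_trichotomy k l with h | h | h
  · exact absurd (hk.2.1 l hl.1) (hl.2.2 k h hk.1).not_ge
  · exact h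
  · exact absurd (hl.2.1 k hk.1) (hk.2.2 l h hl.1).not_ge

theorem IsArgmin.iff_eq {j k : Fin m} (hk : IsArgmin c a k) : IsArgmin c a j ↔ j = k :=
  ⟨fun hj => hj.unique hk, fun h => h ▸ hk⟩

theorem minRatio_pos (hc : ∀ j, 0 < c j) (ha : ∃ j, 0 < a j) : 0 < minRatio c a := by
  obtain ⟨k, hk⟩ := exists_isArgmin c ha
  rw [minRatio_eq hk]
  exact div_pos (hc k) hk.1

theorem minRatio_mul_le (hc : ∀ j, 0 ≤ c j) (ha : ∀ j, 0 ≤ a j) (j : Fin m) :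
    minRatio c a * a j ≤ c j := by
  rcases (ha j).eq_or_lt with h | h
  · simpa [← h] using hc j
  · exact (le_div_iff₀ h).1 (minRatio_le h)

theorem minRatio_mul_dot_le (hc : ∀ j, 0 ≤ c j) (ha : ∀ j, 0 ≤ a j) {x : Fin m → ℝ}
    (hx : ∀ j, 0 ≤ x j) : minRatio c a * dot a x ≤ dot c x := by
  rw [dot, dot, Finset.mul_sum]
  refine Finset.sum_le_sum fun j _ => ?_
  rw [← mul_assoc]
  exact mul_le_mul_of_nonneg_right (minRatio_mul_le hc ha j) (hx j)

theorem minRatio_le_dot (hc : ∀ j, 0 < c j) (ha0 : ∀ j, 0 ≤ a j) (ha : ∃ j, 0 < a j)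
    {x : Fin m → ℝ} (hx : ∀ j, 0 ≤ x j) (h : 1 ≤ dot a x) : minRatio c a ≤ dot c x :=
  (le_mul_of_one_le_right (minRatio_pos hc ha).le h).trans
    (minRatio_mul_dot_le (fun j => (hc j).le) ha0 hx)

theorem half_lt_threshold : 1 / 2 < threshold := by
  have := Real.exp_one_gt_d9
  rw [threshold, lt_inv_comm₀ (by norm_num) (by linarith)]
  linarith [Real.exp_one_lt_d9]

theorem threshold_lt_two_thirds : threshold < 2 / 3 := by
  have := Real.exp_one_gt_d9
  rw [threshold, inv_lt_comm₀ (by linarith) (by norm_num)]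
  linarith

theorem threshold_pos : 0 < threshold := one_half_pos.trans half_lt_threshold

theorem deficit_nonneg (a : Fin m → ℝ) (z : Fin m → ℕ) : 0 ≤ deficit a z := le_max_left _ _

theorem deficit_le_one (ha : ∀ j, 0 ≤ a j) (z : Fin m → ℕ) : deficit a z ≤ 1 :=
  max_le zero_le_one (sub_le_self _ (dot_toReal_nonneg ha z))

theorem deficit_anti (ha : ∀ j, 0 ≤ a j) {z z' : Fin m → ℕ} (h : z ≤ z') :
    deficit a z' ≤ deficit a z :=
  max_le_max le_rfl (sub_le_sub_left (dot_toReal_mono ha h) _)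

theorem one_le_three_mul_dot {a : Fin m → ℝ} {z : Fin m → ℕ} (h : deficit a z ≤ threshold) :
    1 ≤ 3 * dot a (toReal z) := by
  have h_deficit : 1 - dot a (toReal z) ≤ deficit a z := le_max_right _ _
  linarith [threshold_lt_two_thirds]

/-- The cost `κ` of covering the deficit of the row `a` fractionally by its cheapest column. -/
def greedyCost (c a : Fin m → ℝ) (z : Fin m → ℕ) : ℝ := deficit a z * minRatio c a

theorem greedyCost_nonneg (hc : ∀ j, 0 < c j) (ha : ∃ j, 0 < a j) (z : Fin m → ℕ) :
    0 ≤ greedyCost c a z := mul_nonneg (deficit_nonneg a z) (minRatio_pos hc ha).le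

theorem greedyCost_le_minRatio (hc : ∀ j, 0 < c j) (ha0 : ∀ j, 0 ≤ a j) (ha : ∃ j, 0 < a j)
    (z : Fin m → ℕ) : greedyCost c a z ≤ minRatio c a :=
  mul_le_of_le_one_left (minRatio_pos hc ha).le (deficit_le_one ha0 z)

theorem greedyCost_mul_le (hc : ∀ j, 0 < c j) (ha0 : ∀ j, 0 ≤ a j) (ha : ∃ j, 0 < a j)
    (z : Fin m → ℕ) (j : Fin m) : greedyCost c a z * a j ≤ c j :=
  (mul_le_mul_of_nonneg_right (greedyCost_le_minRatio hc ha0 ha z) (ha0 j)).trans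
    (minRatio_mul_le (fun j => (hc j).le) ha0 j)

end rows

section buy

variable {m : ℕ} {c a : Fin m → ℝ}

open Classical in
/-- The integer solution `z` after a round on the row `a` in which the vector `y` is rounded with
the coins `b` and the greedy column is bought. -/
def buy (c a y : Fin m → ℝ) (z : Fin m → ℕ) (b : Fin m → Bool) : Fin m → ℕ :=
  fun j => z j + (⌊y j⌋₊ + (b j).toNat) + if IsArgmin c a j then ⌈deficit a z / a j⌉₊ else 0

theorem add_rounding_le_buy (y : Fin m → ℝ) (z : Fin m → ℕ) (b : Fin m → Bool) :
    z + rounding y b ≤ buy c a y z b := fun _ => Nat.le_add_right _ _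

theorem le_buy (y : Fin m → ℝ) (z : Fin m → ℕ) (b : Fin m → Bool) : z ≤ buy c a y z b :=
  le_self_add.trans (add_rounding_le_buy y z b)

theorem buy_eq {k : Fin m} (hk : IsArgmin c a k) (y : Fin m → ℝ) (z : Fin m → ℕ)
    (b : Fin m → Bool) :
    buy c a y z b = z + rounding y b + Pi.single k ⌈deficit a z / a k⌉₊ := by
  ext j
  by_cases hj : j = k
  · subst hj
    simp [buy, rounding, hk]
  · simp [buy, rounding, hk.iff_eq, hj]

theorem dot_buy (w : Fin m → ℝ) {k : Fin m} (hk : IsArgmin c a k) (y : Fin m → ℝ)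
    (z : Fin m → ℕ) (b : Fin m → Bool) :
    dot w (toReal (buy c a y z b)) =
      dot w (toReal z) + dot w (toReal (rounding y b)) + w k * ⌈deficit a z / a k⌉₊ := by
  have h_single : dot w (toReal (Pi.single k ⌈deficit a z / a k⌉₊)) =
      w k * ⌈deficit a z / a k⌉₊ := by
    simp [dot, toReal, Pi.single_apply]
  rw [buy_eq hk, toReal_add, toReal_add, dot_add, dot_add, h_single]

theorem one_le_dot_buy (ha0 : ∀ j, 0 ≤ a j) (ha : ∃ j, 0 < a j) (y : Fin m → ℝ) (z : Fin m → ℕ)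
    (b : Fin m → Bool) : 1 ≤ dot a (toReal (buy c a y z b)) := by
  obtain ⟨k, hk⟩ := exists_isArgmin c ha
  have h_greedy : deficit a z ≤ a k * ⌈deficit a z / a k⌉₊ := by
    rw [← div_le_iff₀' hk.1]
    exact Nat.le_ceil _
  have h_deficit : 1 - dot a (toReal z) ≤ deficit a z := le_max_right _ _
  rw [dot_buy a hk]
  linarith [dot_toReal_nonneg ha0 (rounding y b)]

theorem dot_buy_le (hc : ∀ j, 0 ≤ c j) (ha : IsRow a) {z : Fin m → ℕ}
    (h_active : threshold < deficit a z) (y : Fin m → ℝ) (b : Fin m → Bool) :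
    dot c (toReal (buy c a y z b)) ≤
      dot c (toReal z) + dot c (toReal (rounding y b)) + 3 * greedyCost c a z := by
  obtain ⟨k, hk⟩ := exists_isArgmin c ha.2
  have h_half : 1 / 2 < deficit a z := half_lt_threshold.trans h_active
  have h_div : deficit a z ≤ deficit a z / a k := le_div_self (by linarith) hk.1 (ha.1 k).2
  have h_ceil : (⌈deficit a z / a k⌉₊ : ℝ) < deficit a z / a k + 1 :=
    Nat.ceil_lt_add_one (by linarith)
  have h_greedy : c k * ⌈deficit a z / a k⌉₊ ≤ c k * (3 * (deficit a z / a k)) :=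
    mul_le_mul_of_nonneg_left (by linarith) (hc k)
  rw [dot_buy c hk, greedyCost, minRatio_eq hk]
  linarith [show c k * (3 * (deficit a z / a k)) = 3 * (deficit a z * (c k / a k)) by ring]

end buy

/-! ### The uncovered weight -/

section weight

variable {m k : ℕ}

open Classical in
/-- The cost of covering the row `a` greedily, if this row is uncovered and the cost of a full
greedy cover lies between `s` and `β`. -/
def rowWeight (s β : ℝ) (c a : Fin m → ℝ) (z : Fin m → ℕ) : ℝ :=
  if threshold < deficit a z ∧ minRatio c a ≤ β ∧ s ≤ minRatio c a then greedyCost c a z else 0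

/-- The total weight of the uncovered rows. -/
def uncovered (s β : ℝ) (c : Fin m → ℝ) (A : Fin k → Fin m → ℝ) (z : Fin m → ℕ) : ℝ :=
  ∑ i, rowWeight s β c (A i) z

variable {c a : Fin m → ℝ} {s β : ℝ}

theorem rowWeight_nonneg (hc : ∀ j, 0 < c j) (ha : ∃ j, 0 < a j) (z : Fin m → ℕ) :
    0 ≤ rowWeight s β c a z := by
  unfold rowWeight
  split_ifs
  exacts [greedyCost_nonneg hc ha z, le_rfl]

theorem rowWeight_eq_greedyCost_or (hc : ∀ j, 0 < c j) (ha0 : ∀ j, 0 ≤ a j) (ha : ∃ j, 0 < a j)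
    {z : Fin m → ℕ} (h_active : threshold < deficit a z) (hr : minRatio c a ≤ β) :
    rowWeight s β c a z = greedyCost c a z ∨ rowWeight s β c a z = 0 ∧ greedyCost c a z ≤ s := by
  by_cases hs : s ≤ minRatio c a
  · exact Or.inl (if_pos ⟨h_active, hr, hs⟩)
  · exact Or.inr ⟨if_neg fun h => hs h.2.2,
      (greedyCost_le_minRatio hc ha0 ha z).trans (not_le.1 hs).le⟩

theorem rowWeight_le_minRatio (hc : ∀ j, 0 < c j) (ha0 : ∀ j, 0 ≤ a j) (ha : ∃ j, 0 < a j)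
    (z : Fin m → ℕ) : rowWeight s β c a z ≤ minRatio c a := by
  unfold rowWeight
  split_ifs
  exacts [greedyCost_le_minRatio hc ha0 ha z, (minRatio_pos hc ha).le]

theorem rowWeight_le (hβ : 0 ≤ β) (hc : ∀ j, 0 < c j) (ha : IsRow a) (z : Fin m → ℕ) :
    rowWeight s β c a z ≤ β := by
  unfold rowWeight
  split_ifs with h
  exacts [(greedyCost_le_minRatio hc ha.nonneg ha.2 z).trans h.2.1, hβ]

theorem rowWeight_eq_zero_or_le (hc : ∀ j, 0 < c j) (ha : ∃ j, 0 < a j) (z : Fin m → ℕ) :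
    rowWeight s β c a z = 0 ∨ s ≤ 2 * rowWeight s β c a z := by
  unfold rowWeight greedyCost
  split_ifs with h
  · exact Or.inr (by nlinarith [half_lt_threshold, minRatio_pos hc ha, h.1, h.2.2])
  · exact Or.inl rfl

theorem deficit_le_sub_of_threshold_lt (ha : ∀ j, 0 ≤ a j) {z z' w : Fin m → ℕ} (h : z + w ≤ z')
    (h_active : threshold < deficit a z') :
    deficit a z' ≤ deficit a z - deficit a z * min 1 (dot a (toReal w)) := by
  have h_dot : dot a (toReal z) + dot a (toReal w) ≤ dot a (toReal z') := by
    rw [← dot_add, ← toReal_add]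
    exact dot_toReal_mono ha h
  have h_deficit' : deficit a z' = 1 - dot a (toReal z') :=
    (max_choice _ _).resolve_left fun h_zero =>
      (threshold_pos.trans h_active).ne' h_zero
  have h_deficit : 1 - dot a (toReal z) ≤ deficit a z := le_max_right _ _
  have h_min : deficit a z * min 1 (dot a (toReal w)) ≤ dot a (toReal w) :=
    (mul_le_of_le_one_left (le_min zero_le_one (dot_toReal_nonneg ha w))
      (deficit_le_one ha z)).trans (min_le_right _ _)
  linarith

theorem rowWeight_le_sub (hc : ∀ j, 0 < c j) (ha0 : ∀ j, 0 ≤ a j) (ha : ∃ j, 0 < a j)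
    {z z' w : Fin m → ℕ} (h : z + w ≤ z') :
    rowWeight s β c a z' ≤
      rowWeight s β c a z - rowWeight s β c a z * min 1 (dot a (toReal w)) := by
  by_cases h' : threshold < deficit a z' ∧ minRatio c a ≤ β ∧ s ≤ minRatio c a
  · have h_active : threshold < deficit a z :=
      h'.1.trans_le (deficit_anti ha0 (le_self_add.trans h))
    rw [rowWeight, rowWeight, if_pos h', if_pos ⟨h_active, h'.2⟩, greedyCost, greedyCost,
      mul_right_comm, ← sub_mul]
    exact mul_le_mul_of_nonneg_right (deficit_le_sub_of_threshold_lt ha0 h h'.1)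
      (minRatio_pos hc ha).le
  · rw [rowWeight, if_neg h', sub_nonneg]
    exact mul_le_of_le_one_right (rowWeight_nonneg hc ha z) (min_le_left _ _)

variable {A : Fin k → Fin m → ℝ}

theorem uncovered_nonneg (hc : ∀ j, 0 < c j) (hA : ∀ i, ∃ j, 0 < A i j) (z : Fin m → ℕ) :
    0 ≤ uncovered s β c A z := Finset.sum_nonneg fun i _ => rowWeight_nonneg hc (hA i) z

theorem rowWeight_le_uncovered (hc : ∀ j, 0 < c j) (hA : ∀ i, ∃ j, 0 < A i j) (z : Fin m → ℕ)
    (i : Fin k) : rowWeight s β c (A i) z ≤ uncovered s β c A z :=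
  Finset.single_le_sum (f := fun i => rowWeight s β c (A i) z)
    (fun i _ => rowWeight_nonneg hc (hA i) z) (Finset.mem_univ i)

theorem uncovered_eq_zero_or_le (hc : ∀ j, 0 < c j) (hA : ∀ i, ∃ j, 0 < A i j) (z : Fin m → ℕ) :
    uncovered s β c A z = 0 ∨ s ≤ 2 * uncovered s β c A z := by
  by_cases h : ∀ i, rowWeight s β c (A i) z = 0
  · exact Or.inl (Finset.sum_eq_zero fun i _ => h i)
  · obtain ⟨i, hi⟩ := not_forall.1 h
    have h_row := (rowWeight_eq_zero_or_le hc (hA i) z).resolve_left hi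
    exact Or.inr (by linarith [rowWeight_le_uncovered (s := s) (β := β) hc hA z i])

theorem uncovered_dropRow_le (hc : ∀ j, 0 < c j) {A : Fin (k + 1) → Fin m → ℝ} (i : Fin (k + 1))
    (hA : ∃ j, 0 < A i j) (z : Fin m → ℕ) :
    uncovered s β c (dropRow i A) z ≤ uncovered s β c A z := by
  have h_split := add_sum_dropRow i A fun a => rowWeight s β c a z
  have h_row := rowWeight_nonneg (s := s) (β := β) hc hA z
  unfold uncovered
  linarith

theorem uncovered_le (hβ : 0 ≤ β) (hc : ∀ j, 0 < c j) (hA : ∀ i, IsRow (A i)) (z : Fin m → ℕ) :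
    uncovered s β c A z ≤ k * β := by
  simpa [uncovered] using Finset.sum_le_card_nsmul Finset.univ
    (fun i => rowWeight s β c (A i) z) β fun i _ => rowWeight_le hβ hc (hA i) z

theorem uncovered_dropRow_buy_le (hc : ∀ j, 0 < c j) {A : Fin (k + 1) → Fin m → ℝ}
    (hA : ∀ i, IsRow (A i)) (i : Fin (k + 1)) (y : Fin m → ℝ) (z : Fin m → ℕ) (b : Fin m → Bool) :
    uncovered s β c (dropRow i A) (buy c (A i) y z b) ≤ uncovered s β c A z -
      ∑ l, rowWeight s β c (A l) z * min 1 (dot (A l) (toReal (rounding y b))) := by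
  refine (uncovered_dropRow_le hc i (hA i).2 _).trans ?_
  rw [uncovered, uncovered, ← Finset.sum_sub_distrib]
  exact Finset.sum_le_sum fun l _ =>
    rowWeight_le_sub hc (hA l).nonneg (hA l).2 (add_rounding_le_buy y z b)

end weight

section logPotential

variable {s ρ ρ' : ℝ}

open Classical in
/-- The logarithm of `ρ` in units of `s`, shifted such that a drop from `ρ ≥ s / 2` to `0` costs at
least `1`. -/
def logPotential (s ρ : ℝ) : ℝ := if ρ = 0 then 0 else 1 + Real.log (2 * ρ / s)

theorem logPotential_nonneg (hs : 0 < s) (hρ : ρ = 0 ∨ s ≤ 2 * ρ) : 0 ≤ logPotential s ρ := by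
  unfold logPotential
  split_ifs with h
  · exact le_rfl
  · linarith [Real.log_nonneg ((one_le_div hs).2 (hρ.resolve_left h))]

theorem logPotential_le_sub_of_pos (hs : 0 < s) (hρ' : 0 ≤ ρ') (hρ : 0 < ρ) (h : s ≤ 2 * ρ) :
    logPotential s ρ' ≤ logPotential s ρ - (ρ - ρ') / ρ := by
  rw [sub_div, div_self hρ.ne', logPotential, logPotential, if_neg hρ.ne']
  rcases hρ'.eq_or_lt with rfl | hρ'_pos
  · rw [if_pos rfl, zero_div]
    linarith [Real.log_nonneg ((one_le_div hs).2 h)]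
  · have h_log := Real.log_le_sub_one_of_pos (div_pos hρ'_pos hρ)
    rw [Real.log_div hρ'_pos.ne' hρ.ne'] at h_log
    rw [if_neg hρ'_pos.ne', Real.log_div (by positivity) hs.ne',
      Real.log_div (by positivity) hs.ne', Real.log_mul two_ne_zero hρ'_pos.ne',
      Real.log_mul two_ne_zero hρ.ne']
    linarith

theorem logPotential_le_sub (hs : 0 < s) (hρ' : 0 ≤ ρ') (h_le : ρ' ≤ ρ)
    (hρ : ρ = 0 ∨ s ≤ 2 * ρ) : logPotential s ρ' ≤ logPotential s ρ - (ρ - ρ') / ρ := by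
  rcases hρ with rfl | hρ
  · simp [le_antisymm h_le hρ']
  · exact logPotential_le_sub_of_pos hs hρ' (by linarith) hρ

theorem logPotential_mono (hs : 0 < s) (hρ' : 0 ≤ ρ') (h_le : ρ' ≤ ρ)
    (hρ : ρ = 0 ∨ s ≤ 2 * ρ) : logPotential s ρ' ≤ logPotential s ρ :=
  (logPotential_le_sub hs hρ' h_le hρ).trans
    (sub_le_self _ (div_nonneg (sub_nonneg.2 h_le) (hρ'.trans h_le)))

end logPotential

/-! ### The multiplicative update -/

section learn

variable {m : ℕ}

/-- The factor by which the multiplicative update is normalized. -/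
def learnNorm (β : ℝ) (c a : Fin m → ℝ) (κ : ℝ) (x : Fin m → ℝ) : ℝ :=
  dot c (fun j => x j * Real.exp (κ * (a j / c j))) / β

theorem exp_le_one_add_mul {u : ℝ} (hu : u ∈ Set.Icc 0 1) :
    Real.exp u ≤ 1 + (Real.exp 1 - 1) * u := by
  have h := convexOn_exp.2 (Set.mem_univ 0) (Set.mem_univ 1) (sub_nonneg.2 hu.2) hu.1 (by ring)
  simp only [smul_eq_mul, mul_zero, mul_one, zero_add, Real.exp_zero] at h
  linarith

variable {c a x : Fin m → ℝ} {β κ : ℝ}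

theorem one_le_learnNorm (hβ : 0 < β) (hc : ∀ j, 0 ≤ c j) (ha : ∀ j, 0 ≤ a j)
    (hx : ∀ j, 0 ≤ x j) (hcx : dot c x = β) (hκ : 0 ≤ κ) : 1 ≤ learnNorm β c a κ x := by
  rw [learnNorm, one_le_div hβ]
  nth_rw 1 [← hcx]
  refine Finset.sum_le_sum fun j _ => mul_le_mul_of_nonneg_left ?_ (hc j)
  exact le_mul_of_one_le_right (hx j)
    (Real.one_le_exp (mul_nonneg hκ (div_nonneg (ha j) (hc j))))

theorem dot_mul_exp_le (hc : ∀ j, 0 < c j) (ha : ∀ j, 0 ≤ a j) (hx : ∀ j, 0 ≤ x j) (hκ : 0 ≤ κ)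
    (hκa : ∀ j, κ * a j ≤ c j) :
    dot c (fun j => x j * Real.exp (κ * (a j / c j))) ≤
      dot c x + (Real.exp 1 - 1) * κ * dot a x := by
  rw [dot, dot, dot, Finset.mul_sum, ← Finset.sum_add_distrib]
  refine Finset.sum_le_sum fun j _ => ?_
  have h_exp : Real.exp (κ * (a j / c j)) ≤ 1 + (Real.exp 1 - 1) * (κ * (a j / c j)) := by
    refine exp_le_one_add_mul ⟨mul_nonneg hκ (div_nonneg (ha j) (hc j).le), ?_⟩
    rw [← mul_div_assoc]
    exact (div_le_one (hc j)).2 (hκa j)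
  have h_ratio : c j * (κ * (a j / c j)) = κ * a j := by
    rw [mul_left_comm, mul_div_cancel₀ _ (hc j).ne']
  calc _ ≤ c j * (x j * (1 + (Real.exp 1 - 1) * (κ * (a j / c j)))) :=
        mul_le_mul_of_nonneg_left (mul_le_mul_of_nonneg_left h_exp (hx j)) (hc j).le
    _ = c j * x j + (Real.exp 1 - 1) * x j * (c j * (κ * (a j / c j))) := by ring
    _ = _ := by rw [h_ratio]; ring

theorem mul_log_learnNorm_le (hβ : 0 < β) (hc : ∀ j, 0 < c j) (ha : ∀ j, 0 ≤ a j)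
    (hx : ∀ j, 0 ≤ x j) (hcx : dot c x = β) (hκ : 0 ≤ κ) (hκa : ∀ j, κ * a j ≤ c j) :
    β * Real.log (learnNorm β c a κ x) ≤ (Real.exp 1 - 1) * κ * dot a x := by
  have h_pos : 0 < learnNorm β c a κ x :=
    zero_lt_one.trans_le (one_le_learnNorm hβ (fun j => (hc j).le) ha hx hcx hκ)
  calc _ ≤ β * (learnNorm β c a κ x - 1) :=
        mul_le_mul_of_nonneg_left (Real.log_le_sub_one_of_pos h_pos) hβ.le
    _ = dot c (fun j => x j * Real.exp (κ * (a j / c j))) - dot c x := by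
        rw [mul_sub, learnNorm, mul_div_cancel₀ _ hβ.ne', mul_one, hcx]
    _ ≤ _ := sub_le_iff_le_add'.2 (dot_mul_exp_le hc ha hx hκ hκa)

theorem learn_apply (j : Fin m) :
    learn β c a κ x j = x j * Real.exp (κ * (a j / c j)) / learnNorm β c a κ x := rfl

theorem dot_learn (hβ : β ≠ 0) (h_norm : learnNorm β c a κ x ≠ 0) :
    dot c (learn β c a κ x) = β := by
  have h_dot : dot c (learn β c a κ x) =
      dot c (fun j => x j * Real.exp (κ * (a j / c j))) / learnNorm β c a κ x := by
    simp only [dot, learn_apply, Finset.sum_div, mul_div_assoc]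
  rw [h_dot, div_eq_iff h_norm, learnNorm, mul_div_cancel₀ _ hβ]

/-- The fractional vector after a round on the row `a`, when `z` was held before this round. -/
def learnStep (β : ℝ) (c a : Fin m → ℝ) (z : Fin m → ℕ) (x : Fin m → ℝ) : Fin m → ℝ :=
  if dot a x < deficit a z then learn β c a (greedyCost c a z) x else x

/-- An upper bound for the change of the relative entropy of the optimal solution with respect to
`x`, scaled by `β`, in a round on the row `a`. -/
def learnChange (β : ℝ) (c a : Fin m → ℝ) (z : Fin m → ℕ) (x : Fin m → ℝ) : ℝ :=
  if dot a x < deficit a z then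
    β * Real.log (learnNorm β c a (greedyCost c a z) x) - greedyCost c a z
  else 0

variable {z : Fin m → ℕ}

theorem learnChange_le (hβ : 0 < β) (hc : ∀ j, 0 < c j) (ha0 : ∀ j, 0 ≤ a j) (ha : ∃ j, 0 < a j)
    (hx : ∀ j, 0 ≤ x j) (hcx : dot c x = β) (h_active : threshold < deficit a z) :
    learnChange β c a z x ≤ greedyCost c a z * (2 * min 1 (dot a x) - 1) := by
  have h_cost := greedyCost_nonneg hc ha z
  have h_deficit := deficit_le_one ha0 z
  unfold learnChange
  split_ifs with h
  · have h_log := mul_log_learnNorm_le hβ hc ha0 hx hcx h_cost (greedyCost_mul_le hc ha0 ha z)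
    have h_exp : (Real.exp 1 - 1) * greedyCost c a z * dot a x ≤
        2 * greedyCost c a z * dot a x := by
      have h_dot := dot_nonneg ha0 hx
      gcongr
      linarith [Real.exp_one_lt_d9]
    rw [min_eq_right (h.le.trans h_deficit)]
    linarith
  · refine mul_nonneg h_cost ?_
    have h_min : deficit a z ≤ min 1 (dot a x) := le_min h_deficit (not_lt.1 h)
    linarith [half_lt_threshold]

theorem neg_greedyCost_le_learnChange (hβ : 0 < β) (hc : ∀ j, 0 < c j) (ha0 : ∀ j, 0 ≤ a j)
    (ha : ∃ j, 0 < a j) (hx : ∀ j, 0 ≤ x j) (hcx : dot c x = β) :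
    -greedyCost c a z ≤ learnChange β c a z x := by
  have h_cost := greedyCost_nonneg hc ha z
  unfold learnChange
  split_ifs
  · linarith [mul_nonneg hβ.le (Real.log_nonneg
      (one_le_learnNorm hβ (fun j => (hc j).le) ha0 hx hcx h_cost))]
  · exact neg_nonpos.2 h_cost

end learn

/-! ### The expected progress of a round -/

section cover

variable {m k : ℕ} {c x y : Fin m → ℝ} {s β : ℝ}

/-- The vector `y = κ x / β` that is rounded on the arrival of the row `a`. -/
def increment (β : ℝ) (c a x : Fin m → ℝ) (z : Fin m → ℕ) : Fin m → ℝ :=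
  fun j => greedyCost c a z * x j / β

theorem increment_nonneg {a : Fin m → ℝ} (hβ : 0 ≤ β) (hc : ∀ j, 0 < c j) (ha : ∃ j, 0 < a j)
    (hx : ∀ j, 0 ≤ x j) (z : Fin m → ℕ) (j : Fin m) : 0 ≤ increment β c a x z j :=
  div_nonneg (mul_nonneg (greedyCost_nonneg hc ha z) (hx j)) hβ

theorem dot_increment (w a : Fin m → ℝ) (z : Fin m → ℕ) :
    dot w (increment β c a x z) = greedyCost c a z / β * dot w x := by
  rw [← dot_smul]
  congr 1
  ext j
  simp only [increment, Pi.smul_apply, smul_eq_mul]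
  ring

theorem mul_min_one_le {t d : ℝ} (ht : t ∈ Set.Icc 0 1) : t * min 1 d ≤ min 1 (t * d) := by
  rw [mul_min_of_nonneg _ _ ht.1, mul_one]
  exact min_le_min_right _ ht.2

theorem coinMean_dot_buy_le {a : Fin m → ℝ} (hc : ∀ j, 0 ≤ c j) (ha : IsRow a)
    {z : Fin m → ℕ} (h_active : threshold < deficit a z) (hy : ∀ j, 0 ≤ y j) :
    coinMean (fun j => Int.fract (y j)) (fun b => dot c (toReal (buy c a y z b))) ≤
      dot c (toReal z) + dot c y + 3 * greedyCost c a z := by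
  refine (coinMean_mono (fun j => unitInterval.fract_mem (y j))
    fun b => dot_buy_le hc ha h_active y b).trans_eq ?_
  rw [coinMean_add, coinMean_add, coinMean_const, coinMean_const, coinMean_dot_rounding c hy]

variable {A : Fin (k + 1) → Fin m → ℝ}

theorem coinMean_logPotential_le (hs : 0 < s) (hc : ∀ j, 0 < c j) (hA : ∀ i, IsRow (A i))
    (hy : ∀ j, 0 ≤ y j) (z : Fin m → ℕ) (i : Fin (k + 1)) :
    coinMean (fun j => Int.fract (y j)) (fun b =>
        logPotential s (uncovered s β c (dropRow i A) (buy c (A i) y z b))) ≤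
      logPotential s (uncovered s β c A z) -
        (∑ l, rowWeight s β c (A l) z * (min 1 (dot (A l) y) / 3)) / uncovered s β c A z := by
  have hp := fun j => unitInterval.fract_mem (y j)
  set ρ := uncovered s β c A z
  set w := fun l => rowWeight s β c (A l) z
  have hA_pos : ∀ l, ∃ j, 0 < A l j := fun l => (hA l).2
  have hw : ∀ l, 0 ≤ w l := fun l => rowWeight_nonneg hc (hA_pos l) z
  have hρ : 0 ≤ ρ := uncovered_nonneg hc hA_pos z
  have h_bound : ∀ b, logPotential s (uncovered s β c (dropRow i A) (buy c (A i) y z b)) ≤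
      logPotential s ρ + -ρ⁻¹ * ∑ l, w l * min 1 (dot (A l) (toReal (rounding y b))) := by
    intro b
    have h_drop := uncovered_dropRow_buy_le (s := s) (β := β) hc hA i y z b
    have h_sum : 0 ≤ ∑ l, w l * min 1 (dot (A l) (toReal (rounding y b))) :=
      Finset.sum_nonneg fun l _ => mul_nonneg (hw l)
        (le_min zero_le_one (dot_toReal_nonneg (hA l).nonneg _))
    refine (logPotential_le_sub hs (uncovered_nonneg hc (fun l => hA_pos _) _)
      (h_drop.trans (sub_le_self _ h_sum)) (uncovered_eq_zero_or_le hc hA_pos z)).trans ?_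
    rw [neg_mul, ← sub_eq_add_neg, ← div_eq_inv_mul]
    exact sub_le_sub_left (div_le_div_of_nonneg_right (le_sub_comm.1 h_drop) hρ) _
  refine (coinMean_mono hp h_bound).trans ?_
  rw [coinMean_add, coinMean_const, coinMean_const_mul, coinMean_finset_sum, neg_mul,
    ← sub_eq_add_neg, ← div_eq_inv_mul]
  refine sub_le_sub_left (div_le_div_of_nonneg_right (Finset.sum_le_sum fun l _ => ?_) hρ) _
  rw [coinMean_const_mul]
  exact mul_le_mul_of_nonneg_left (le_coinMean_min_dot_rounding (hA l).1 hy) (hw l)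

/-- The part of the potential that does not depend on `x`: the cost, the uncovered weight on a
logarithmic scale, and `s` for each of the rows to come, whose greedy cost may be too small to count
as uncovered weight. -/
def coverPotential (s β : ℝ) (c : Fin m → ℝ) (A : Fin k → Fin m → ℝ) (z : Fin m → ℕ) : ℝ :=
  dot c (toReal z) + 24 * β * logPotential s (uncovered s β c A z) + 8 * s * k

/-- The weighted mean of the coverages `min 1 ⟨a, x⟩` of the uncovered rows `a` by `x`. -/
def meanCoverage (s β : ℝ) (c : Fin m → ℝ) (A : Fin k → Fin m → ℝ) (z : Fin m → ℕ)
    (x : Fin m → ℝ) : ℝ :=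
  (∑ l, rowWeight s β c (A l) z * min 1 (dot (A l) x)) / uncovered s β c A z

/-- The deviation of the coverage of the row `i` from the mean, scaled by the weight of this row. -/
def weightExcess (s β : ℝ) (c : Fin m → ℝ) (A : Fin k → Fin m → ℝ) (z : Fin m → ℕ)
    (x : Fin m → ℝ) (i : Fin k) : ℝ :=
  rowWeight s β c (A i) z * (min 1 (dot (A i) x) - meanCoverage s β c A z x)

theorem meanCoverage_nonneg {A : Fin k → Fin m → ℝ} (hc : ∀ j, 0 < c j) (hA : ∀ i, IsRow (A i))
    (hx : ∀ j, 0 ≤ x j) (z : Fin m → ℕ) : 0 ≤ meanCoverage s β c A z x :=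
  div_nonneg (Finset.sum_nonneg fun l _ => mul_nonneg (rowWeight_nonneg hc (hA l).2 z)
    (le_min zero_le_one (dot_nonneg (hA l).nonneg hx))) (uncovered_nonneg hc (fun l => (hA l).2) z)

theorem min_sub_meanCoverage_le_one {A : Fin k → Fin m → ℝ} (hc : ∀ j, 0 < c j)
    (hA : ∀ i, IsRow (A i)) (hx : ∀ j, 0 ≤ x j) (z : Fin m → ℕ) (d : ℝ) :
    min 1 d - meanCoverage s β c A z x ≤ 1 :=
  (sub_le_self _ (meanCoverage_nonneg hc hA hx z)).trans (min_le_left _ _)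

theorem weightExcess_le {A : Fin k → Fin m → ℝ} (hc : ∀ j, 0 < c j) (hA : ∀ i, IsRow (A i))
    (hx : ∀ j, 0 ≤ x j) (z : Fin m → ℕ) (i : Fin k) :
    weightExcess s β c A z x i ≤ rowWeight s β c (A i) z :=
  mul_le_of_le_one_right (rowWeight_nonneg hc (hA i).2 z)
    (min_sub_meanCoverage_le_one hc hA hx z _)

theorem sum_weightExcess {A : Fin k → Fin m → ℝ} (hc : ∀ j, 0 < c j)
    (hA : ∀ i, ∃ j, 0 < A i j) (z : Fin m → ℕ) (x : Fin m → ℝ) :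
    ∑ i, weightExcess s β c A z x i = 0 := by
  simp only [weightExcess, meanCoverage, mul_sub, Finset.sum_sub_distrib]
  rw [← Finset.sum_mul, ← uncovered, sub_eq_zero, mul_div_cancel_of_imp']
  intro h_zero
  have h_weight := (Finset.sum_eq_zero_iff_of_nonneg
    fun i _ => rowWeight_nonneg hc (hA i) z).1 h_zero
  exact Finset.sum_eq_zero fun i hi => by rw [h_weight i hi, zero_mul]

theorem mul_coinMean_logPotential_le (hs : 0 < s) (hβ : 0 < β) (hc : ∀ j, 0 < c j)
    (hA : ∀ i, IsRow (A i)) (hx : ∀ j, 0 ≤ x j) (z : Fin m → ℕ) {i : Fin (k + 1)}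
    (hr : minRatio c (A i) ≤ β) :
    β * coinMean (fun j => Int.fract (increment β c (A i) x z j)) (fun b =>
        logPotential s (uncovered s β c (dropRow i A)
          (buy c (A i) (increment β c (A i) x z) z b))) ≤
      β * logPotential s (uncovered s β c A z) -
        greedyCost c (A i) z * meanCoverage s β c A z x / 3 := by
  set κ := greedyCost c (A i) z
  have hκ : 0 ≤ κ := greedyCost_nonneg hc (hA i).2 z
  have hκ_ratio : κ ≤ minRatio c (A i) := greedyCost_le_minRatio hc (hA i).nonneg (hA i).2 z
  have h_scale : κ / β / 3 * meanCoverage s β c A z x ≤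
      (∑ l, rowWeight s β c (A l) z * (min 1 (dot (A l) (increment β c (A i) x z)) / 3)) /
        uncovered s β c A z := by
    rw [meanCoverage, ← mul_div_assoc, Finset.mul_sum]
    refine div_le_div_of_nonneg_right (Finset.sum_le_sum fun l _ => ?_)
      (uncovered_nonneg hc (fun l => (hA l).2) z)
    have h_min := mul_min_one_le (d := dot (A l) x)
      (⟨div_nonneg hκ hβ.le, (div_le_one hβ).2 (hκ_ratio.trans hr)⟩ : κ / β ∈ Set.Icc 0 1)
    rw [mul_left_comm, dot_increment, div_mul_eq_mul_div]
    exact mul_le_mul_of_nonneg_left (div_le_div_of_nonneg_right h_min zero_le_three)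
      (rowWeight_nonneg hc (hA l).2 z)
  have hy := increment_nonneg hβ.le hc (hA i).2 hx z
  refine (mul_le_mul_of_nonneg_left ((coinMean_logPotential_le hs hc hA hy z i).trans
    (sub_le_sub_left h_scale _)) hβ.le).trans_eq ?_
  rw [mul_sub]
  congr 1
  field_simp

theorem dot_le_coverPotential {A : Fin k → Fin m → ℝ} (hs : 0 < s) (hβ : 0 ≤ β)
    (hc : ∀ j, 0 < c j) (hA : ∀ i, ∃ j, 0 < A i j) (z : Fin m → ℕ) :
    dot c (toReal z) ≤ coverPotential s β c A z := by
  have h_log := logPotential_nonneg hs (uncovered_eq_zero_or_le (s := s) (β := β) hc hA z)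
  rw [coverPotential, add_assoc]
  exact le_add_of_nonneg_right (by positivity)

theorem coverPotential_dropRow_le (hs : 0 < s) (hβ : 0 ≤ β) (hc : ∀ j, 0 < c j)
    (hA : ∀ i, ∃ j, 0 < A i j) (z : Fin m → ℕ) (i : Fin (k + 1)) :
    coverPotential s β c (dropRow i A) z ≤ coverPotential s β c A z := by
  have h_log : logPotential s (uncovered s β c (dropRow i A) z) ≤
      logPotential s (uncovered s β c A z) :=
    logPotential_mono hs (uncovered_nonneg hc (fun l => hA _) z)
      (uncovered_dropRow_le hc i (hA i) z) (uncovered_eq_zero_or_le hc hA z)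
  unfold coverPotential
  gcongr
  omega

/-- The slack `4 κ (2 min 1 ⟨a, x⟩ - 1)` is left to pay for learning. For a row of weight `κ`, its
part `8 κ min 1 ⟨a, x⟩` is compensated on average by the decrease of the uncovered weight; the other
rows have `κ ≤ s`. -/
theorem coinMean_coverPotential_le (hs : 0 < s) (hβ : 0 < β) (hc : ∀ j, 0 < c j)
    (hA : ∀ i, IsRow (A i)) (hx : ∀ j, 0 ≤ x j) (hcx : dot c x = β) {z : Fin m → ℕ}
    {i : Fin (k + 1)} (h_active : threshold < deficit (A i) z) (hr : minRatio c (A i) ≤ β) :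
    coinMean (fun j => Int.fract (increment β c (A i) x z j)) (fun b =>
        coverPotential s β c (dropRow i A) (buy c (A i) (increment β c (A i) x z) z b)) +
      4 * (greedyCost c (A i) z * (2 * min 1 (dot (A i) x) - 1)) ≤
    coverPotential s β c A z + 8 * weightExcess s β c A z x i := by
  have h_cost := coinMean_dot_buy_le (fun j => (hc j).le) (hA i) h_active
    (increment_nonneg hβ.le hc (hA i).2 hx z)
  rw [dot_increment, hcx, div_mul_cancel₀ _ hβ.ne'] at h_cost
  have h_log := mul_coinMean_logPotential_le hs hβ hc hA hx z hr
  have h_excess : greedyCost c (A i) z * (min 1 (dot (A i) x) - meanCoverage s β c A z x) ≤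
      weightExcess s β c A z x i + s := by
    rcases rowWeight_eq_greedyCost_or (s := s) hc (hA i).nonneg (hA i).2 h_active hr with
      h_heavy | ⟨h_light, h_small⟩
    · rw [weightExcess, h_heavy]
      exact le_add_of_nonneg_right hs.le
    · rw [weightExcess, h_light, zero_mul, zero_add]
      exact (mul_le_of_le_one_right (greedyCost_nonneg hc (hA i).2 z)
        (min_sub_meanCoverage_le_one hc hA hx z _)).trans h_small
  simp only [coverPotential, coinMean_add, coinMean_const, coinMean_const_mul]
  push_cast
  linarith

end cover

/-! ### The learning potential -/

section crossEntropy

variable {m : ℕ} {c u x a : Fin m → ℝ} {β κ : ℝ}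

/-- Minus the cross entropy of `x` relative to `u`, both measured in cost. -/
def negCrossEntropy (c u : Fin m → ℝ) (β : ℝ) (x : Fin m → ℝ) : ℝ :=
  ∑ j, c j * u j * Real.log (c j * x j / β)

/-- A fractional vector of cost `β`, from which the multiplicative update can approach `u`. -/
structure IsCompatible (β : ℝ) (c u x : Fin m → ℝ) : Prop where
  nonneg : ∀ j, 0 ≤ x j
  dot_eq : dot c x = β
  pos_of_pos : ∀ j, 0 < u j → 0 < x j

theorem negCrossEntropy_nonpos (hβ : 0 < β) (hc : ∀ j, 0 ≤ c j) (hu : ∀ j, 0 ≤ u j)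
    (hx : ∀ j, 0 ≤ x j) (hcx : dot c x = β) : negCrossEntropy c u β x ≤ 0 := by
  refine Finset.sum_nonpos fun j _ => ?_
  have h_le : c j * x j ≤ β := by
    rw [← hcx]
    exact Finset.single_le_sum (f := fun j => c j * x j)
      (fun j _ => mul_nonneg (hc j) (hx j)) (Finset.mem_univ j)
  exact mul_nonpos_of_nonneg_of_nonpos (mul_nonneg (hc j) (hu j))
    (Real.log_nonpos (div_nonneg (mul_nonneg (hc j) (hx j)) hβ.le) ((div_le_one hβ).2 h_le))

theorem negCrossEntropy_of_mul_eq (hβ : β ≠ 0) (hu : ∀ j, 0 ≤ u j) {k : ℝ}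
    (hx : ∀ j, 0 < u j → c j * x j = β / k) :
    negCrossEntropy c u β x = -(dot c u * Real.log k) := by
  rw [negCrossEntropy, dot, Finset.sum_mul, ← Finset.sum_neg_distrib]
  refine Finset.sum_congr rfl fun j _ => ?_
  rcases (hu j).eq_or_lt with h_zero | h_pos
  · simp [← h_zero]
  · rw [hx j h_pos, div_div_cancel_left' hβ, Real.log_inv, mul_neg]

theorem negCrossEntropy_learn (hβ : 0 < β) (hc : ∀ j, 0 < c j) (hu : ∀ j, 0 ≤ u j)
    (hux : ∀ j, 0 < u j → 0 < x j) (h_norm : 0 < learnNorm β c a κ x) :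
    negCrossEntropy c u β (learn β c a κ x) =
      negCrossEntropy c u β x + κ * dot a u - dot c u * Real.log (learnNorm β c a κ x) := by
  rw [negCrossEntropy, negCrossEntropy, dot, dot, Finset.mul_sum, Finset.sum_mul,
    ← Finset.sum_add_distrib, ← Finset.sum_sub_distrib]
  refine Finset.sum_congr rfl fun j _ => ?_
  rcases (hu j).eq_or_lt with h_zero | h_pos
  · simp [← h_zero]
  · have hxj := hux j h_pos
    have hcj := hc j
    have h_factor : c j * learn β c a κ x j / β =
        (c j * x j / β) * Real.exp (κ * (a j / c j)) / learnNorm β c a κ x := by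
      rw [learn_apply]
      ring
    rw [h_factor, Real.log_div (by positivity) h_norm.ne',
      Real.log_mul (by positivity) (Real.exp_pos _).ne', Real.log_exp]
    field_simp

theorem IsCompatible.learnStep (hβ : 0 < β) (hc : ∀ j, 0 < c j) (ha0 : ∀ j, 0 ≤ a j)
    (ha : ∃ j, 0 < a j) (z : Fin m → ℕ) (hx : IsCompatible β c u x) :
    IsCompatible β c u (learnStep β c a z x) := by
  have hκ := greedyCost_nonneg hc ha z
  unfold CoveringIP.learnStep
  split_ifs
  · have h_norm := zero_lt_one.trans_le
      (one_le_learnNorm hβ (fun j => (hc j).le) ha0 hx.nonneg hx.dot_eq hκ)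
    refine ⟨fun j => ?_, dot_learn hβ.ne' h_norm.ne', fun j hj => ?_⟩
    · exact div_nonneg (mul_nonneg (hx.nonneg j) (Real.exp_pos _).le) h_norm.le
    · exact div_pos (mul_pos (hx.pos_of_pos j hj) (Real.exp_pos _)) h_norm
  · exact hx

theorem IsCompatible.negCrossEntropy_sub_learnChange_le (hβ : 0 < β) (hc : ∀ j, 0 < c j)
    (hu : ∀ j, 0 ≤ u j) (hcu : dot c u ≤ β) (ha0 : ∀ j, 0 ≤ a j) (ha : ∃ j, 0 < a j)
    (hau : 1 ≤ dot a u) (z : Fin m → ℕ) (hx : IsCompatible β c u x) :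
    negCrossEntropy c u β x - learnChange β c a z x ≤
      negCrossEntropy c u β (CoveringIP.learnStep β c a z x) := by
  have hκ := greedyCost_nonneg hc ha z
  unfold CoveringIP.learnStep learnChange
  split_ifs
  · have h_norm := one_le_learnNorm hβ (fun j => (hc j).le) ha0 hx.nonneg hx.dot_eq hκ
    rw [negCrossEntropy_learn hβ hc hu hx.pos_of_pos (zero_lt_one.trans_le h_norm)]
    linarith [mul_le_mul_of_nonneg_right hcu (Real.log_nonneg h_norm),
      le_mul_of_one_le_right hκ hau]
  · rw [sub_zero]

end crossEntropy

theorem sum_le_mul_ofReal {k : ℕ} {M : Fin k → ℝ≥0∞} {φ : ℝ} {e : Fin k → ℝ}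
    (h_nonneg : ∀ i, 0 ≤ φ + e i) (hM : ∀ i, M i ≤ ENNReal.ofReal (φ + e i))
    (he : ∑ i, e i = 0) : ∑ i, M i ≤ k * ENNReal.ofReal φ := by
  calc ∑ i, M i ≤ ∑ i, ENNReal.ofReal (φ + e i) := Finset.sum_le_sum fun i _ => hM i
    _ = ENNReal.ofReal (∑ i, (φ + e i)) :=
        (ENNReal.ofReal_sum_of_nonneg fun i _ => h_nonneg i).symm
    _ = ENNReal.ofReal (k * φ) := by simp [Finset.sum_add_distrib, he]
    _ = k * ENNReal.ofReal φ := by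
        rw [ENNReal.ofReal_mul (Nat.cast_nonneg _), ENNReal.ofReal_natCast]

/-! ### Optimal values -/

section opt

variable {m n : ℕ} {A : Fin n → Fin m → ℝ} {c : Fin m → ℝ}

theorem dot_sub (a x y : Fin m → ℝ) : dot a (x - y) = dot a x - dot a y := dotProduct_sub a x y

theorem continuous_dot (a : Fin m → ℝ) : Continuous (dot a) := by
  unfold dot
  fun_prop

theorem mul_le_dot {a x : Fin m → ℝ} (ha : ∀ j, 0 ≤ a j) (hx : ∀ j, 0 ≤ x j) (j : Fin m) :
    a j * x j ≤ dot a x :=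
  Finset.single_le_sum (f := fun j => a j * x j) (fun j _ => mul_nonneg (ha j) (hx j))
    (Finset.mem_univ j)

theorem exists_integer_feasible (hA0 : ∀ i j, 0 ≤ A i j) (hA : ∀ i, ∃ j, 0 < A i j) :
    ∃ z : Fin m → ℕ, ∀ i, 1 ≤ dot (A i) (toReal z) := by
  choose f hf using hA
  refine ⟨fun _ => ⌈∑ i, (A i (f i))⁻¹⌉₊, fun i => ?_⟩
  have h_inv : (A i (f i))⁻¹ ≤ (⌈∑ i, (A i (f i))⁻¹⌉₊ : ℝ) :=
    (Finset.single_le_sum (f := fun i => (A i (f i))⁻¹) (fun i _ => (inv_pos.2 (hf i)).le)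
      (Finset.mem_univ i)).trans (Nat.le_ceil _)
  refine le_trans ?_ (mul_le_dot (hA0 i) (fun _ => Nat.cast_nonneg _) (f i))
  rw [← mul_inv_cancel₀ (hf i).ne']
  exact mul_le_mul_of_nonneg_left h_inv (hf i).le

theorem lpOpt_nonneg (hc : ∀ j, 0 ≤ c j) : 0 ≤ lpOpt A c := by
  refine Real.sInf_nonneg ?_
  rintro v ⟨x, hx, -, rfl⟩
  exact dot_nonneg hc hx

theorem lpOpt_le (hc : ∀ j, 0 ≤ c j) {x : Fin m → ℝ} (hx : ∀ j, 0 ≤ x j)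
    (h : ∀ i, 1 ≤ dot (A i) x) : lpOpt A c ≤ dot c x := by
  refine csInf_le ⟨0, ?_⟩ ⟨x, hx, h, rfl⟩
  rintro v ⟨x, hx, -, rfl⟩
  exact dot_nonneg hc hx

theorem lpOpt_le_ipOpt (hc : ∀ j, 0 ≤ c j) (hA0 : ∀ i j, 0 ≤ A i j)
    (hA : ∀ i, ∃ j, 0 < A i j) : lpOpt A c ≤ ipOpt A c := by
  obtain ⟨z, hz⟩ := exists_integer_feasible hA0 hA
  refine le_csInf ⟨_, z, hz, rfl⟩ ?_
  rintro v ⟨z, hz, rfl⟩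
  exact lpOpt_le hc (fun j => Nat.cast_nonneg _) hz

theorem isCompact_feasible (hc : ∀ j, 0 < c j) (A : Fin n → Fin m → ℝ) (v : ℝ) :
    IsCompact {x : Fin m → ℝ | (∀ j, 0 ≤ x j) ∧ (∀ i, 1 ≤ dot (A i) x) ∧ dot c x ≤ v} := by
  refine (isCompact_Icc (a := (0 : Fin m → ℝ)) (b := fun j => v / c j)).of_isClosed_subset ?_ ?_
  · simp only [Set.ofPred_and, Set.ofPred_forall]
    exact (isClosed_iInter fun j => isClosed_le continuous_const (continuous_apply j)).inter
      ((isClosed_iInter fun i => isClosed_le continuous_const (continuous_dot _)).inter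
        (isClosed_le (continuous_dot _) continuous_const))
  · rintro x ⟨hx, -, hcx⟩
    refine ⟨hx, fun j => (le_div_iff₀' (hc j)).2 ?_⟩
    exact (mul_le_dot (fun j => (hc j).le) hx j).trans hcx

theorem exists_lpOpt_eq (hc : ∀ j, 0 < c j) (hA0 : ∀ i j, 0 ≤ A i j) (hA : ∀ i, ∃ j, 0 < A i j) :
    ∃ x : Fin m → ℝ, (∀ j, 0 ≤ x j) ∧ (∀ i, 1 ≤ dot (A i) x) ∧ dot c x = lpOpt A c := by
  obtain ⟨z, hz⟩ := exists_integer_feasible hA0 hA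
  obtain ⟨x, ⟨hx, hAx, hxz⟩, h_min⟩ := (isCompact_feasible hc A (dot c (toReal z))).exists_isMinOn
    ⟨toReal z, fun j => Nat.cast_nonneg _, hz, le_rfl⟩ (continuous_dot c).continuousOn
  refine ⟨x, hx, hAx, le_antisymm (le_csInf ⟨_, x, hx, hAx, rfl⟩ ?_)
    (lpOpt_le (fun j => (hc j).le) hx hAx)⟩
  rintro v ⟨y, hy, hAy, rfl⟩
  rcases le_total (dot c y) (dot c (toReal z)) with hyz | hzy
  · exact h_min ⟨hy, hAy, hyz⟩
  · exact hxz.trans hzy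

theorem dot_le_mul_lpOpt (hc : ∀ j, 0 ≤ c j) {u v : Fin m → ℝ} (hAu : ∀ i, 1 ≤ dot (A i) u)
    (hu : dot c u = lpOpt A c) (hvu : ∀ j, v j ≤ u j) {t : ℝ} (ht : t < 1)
    (hAv : ∀ i, dot (A i) v ≤ t) : dot c v ≤ t * lpOpt A c := by
  have ht' := sub_pos.2 ht
  have h_le : lpOpt A c ≤ dot c ((1 - t)⁻¹ • (u - v)) := by
    refine lpOpt_le hc (fun j => mul_nonneg (inv_pos.2 ht').le (sub_nonneg.2 (hvu j))) fun i => ?_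
    rw [dot_smul, dot_sub, inv_mul_eq_div, one_le_div ht']
    linarith [hAu i, hAv i]
  rw [dot_smul, dot_sub, inv_mul_eq_div, le_div_iff₀ ht', hu] at h_le
  linarith

/-- Removing a small amount of the column `j` from an optimal solution saves `c j` per unit, but
leaves a solution that is feasible after scaling, which costs at most `lpOpt A c` per unit. -/
theorem cost_le_lpOpt_of_pos (hc : ∀ j, 0 ≤ c j) (hA : ∀ i j, A i j ≤ 1) {u : Fin m → ℝ}
    (hu0 : ∀ j, 0 ≤ u j) (hAu : ∀ i, 1 ≤ dot (A i) u) (hu : dot c u = lpOpt A c) {j : Fin m}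
    (hj : 0 < u j) : c j ≤ lpOpt A c := by
  obtain ⟨t, ht, ht_le⟩ : ∃ t, 0 < t ∧ t ≤ min (u j) (1 / 2) :=
    ⟨_, lt_min hj one_half_pos, le_rfl⟩
  have h_dot : ∀ a : Fin m → ℝ, dot a (Pi.single j t) = a j * t := fun a => dotProduct_single a t j
  have h_single : ∀ k, (Pi.single j t : Fin m → ℝ) k ≤ u k :=
    update_le_iff.2 ⟨ht_le.trans (min_le_left _ _), fun k _ => hu0 k⟩
  have h_saved := dot_le_mul_lpOpt hc hAu hu h_single
    (by linarith [min_le_right (u j) (1 / 2)] : t < 1) fun i => by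
      rw [h_dot]
      exact mul_le_of_le_one_left ht.le (hA i j)
  rw [h_dot, mul_comm] at h_saved
  exact le_of_mul_le_mul_left h_saved ht

theorem exists_lp_solution (hc : ∀ j, 0 < c j) (hA : ∀ i, IsRow (A i)) :
    ∃ u : Fin m → ℝ, (∀ j, 0 ≤ u j) ∧ (∀ i, 1 ≤ dot (A i) u) ∧ dot c u = lpOpt A c ∧
      ∀ j, 0 < u j → c j ≤ lpOpt A c := by
  obtain ⟨u, hu0, hAu, hu⟩ := exists_lpOpt_eq hc (fun i => (hA i).nonneg) fun i => (hA i).2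
  exact ⟨u, hu0, hAu, hu, fun j => cost_le_lpOpt_of_pos (fun j => (hc j).le)
    (fun i j => ((hA i).1 j).2) hu0 hAu hu⟩

end opt

/-! ### LearnOrCoverCIP -/

section online

variable {m n : ℕ}

theorem dot_toReal_mul (k : ℕ) (a : Fin m → ℝ) (z : Fin m → ℕ) :
    dot a (toReal fun j => k * z j) = k * dot a (toReal z) := by
  rw [← dot_smul]
  congr 1
  ext j
  simp [toReal]

theorem isOnlineSolution_of_step {k : ℕ} {r : Fin n → Fin m → ℝ} (hr : ∀ t j, 0 ≤ r t j)
    {z : Fin (n + 1) → Fin m → ℕ} (h_mono : ∀ t : Fin n, z t.castSucc ≤ z t.succ)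
    (h_cover : ∀ t, 1 ≤ k * dot (r t) (toReal (z t.succ))) : IsOnlineSolution k r z := by
  have hz : Monotone z := Fin.monotone_iff_le_succ.2 h_mono
  refine ⟨hz, fun t s hst => ?_⟩
  rw [dot_toReal_mul]
  exact (h_cover s).trans (mul_le_mul_of_nonneg_left
    (dot_toReal_mono (hr s) (hz (Fin.succ_le_succ_iff.2 hst))) (Nat.cast_nonneg _))

theorem expectedCost_mul (k : ℕ) (A : Fin n → Fin m → ℝ) (c : Fin m → ℝ)
    (law : (Fin n → Fin m → ℝ) → PMF (Fin (n + 1) → Fin m → ℕ)) :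
    expectedCost k A c law = k * expectedCost 1 A c law := by
  simp only [expectedCost, expect, dot_toReal_mul, one_mul]
  rw [← ENNReal.tsum_mul_left]
  refine tsum_congr fun z => ?_
  rw [ENNReal.ofReal_mul (Nat.cast_nonneg _), ENNReal.ofReal_natCast]
  ring

end online

section locRound

variable {m : ℕ} {β : ℝ} {c a u : Fin m → ℝ} {s s' : LocState m}

theorem locRound_of_lt (h : threshold < deficit a s.z) :
    locRound β c a s =
      (coins fun j => Int.fract (increment β c a s.x s.z j)).map fun b =>
        { x := learnStep β c a s.z s.x
          z := buy c a (increment β c a s.x s.z) s.z b } := by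
  simp only [locRound, h, if_true]
  rfl

theorem locRound_of_le (h : deficit a s.z ≤ threshold) : locRound β c a s = PMF.pure s := by
  simp only [locRound, h.not_gt, if_false]

theorem le_and_one_le_of_mem_support_locRound (ha0 : ∀ j, 0 ≤ a j) (ha : ∃ j, 0 < a j)
    (h : s' ∈ (locRound β c a s).support) : s.z ≤ s'.z ∧ 1 ≤ 3 * dot a (toReal s'.z) := by
  rcases le_or_gt (deficit a s.z) threshold with h_le | h_active
  · rw [locRound_of_le h_le, PMF.mem_support_pure_iff] at h
    subst h
    exact ⟨le_rfl, one_le_three_mul_dot h_le⟩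
  · rw [locRound_of_lt h_active, PMF.mem_support_map_iff] at h
    obtain ⟨b, -, rfl⟩ := h
    refine ⟨le_buy _ _ b, ?_⟩
    linarith [one_le_dot_buy (c := c) ha0 ha (increment β c a s.x s.z) s.z b]

theorem IsCompatible.of_mem_support_locRound (hβ : 0 < β) (hc : ∀ j, 0 < c j)
    (ha0 : ∀ j, 0 ≤ a j) (ha : ∃ j, 0 < a j) (hs : IsCompatible β c u s.x)
    (hs' : s' ∈ (locRound β c a s).support) : IsCompatible β c u s'.x := by
  rcases le_or_gt (deficit a s.z) threshold with h_le | h_active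
  · rw [locRound_of_le h_le, PMF.mem_support_pure_iff] at hs'
    rwa [hs']
  · rw [locRound_of_lt h_active, PMF.mem_support_map_iff] at hs'
    obtain ⟨b, -, rfl⟩ := hs'
    exact hs.learnStep hβ hc ha0 ha s.z

end locRound

theorem isOnlineSolution_of_mem_support_learnOrCover {m n : ℕ} {β : ℝ} {c : Fin m → ℝ}
    {r : Fin n → Fin m → ℝ} (hr0 : ∀ t j, 0 ≤ r t j) (hr : ∀ t, ∃ j, 0 < r t j)
    {z : Fin (n + 1) → Fin m → ℕ} (hz : z ∈ (learnOrCover β c r).support) :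
    IsOnlineSolution 3 r z := by
  rw [learnOrCover, PMF.mem_support_map_iff] at hz
  obtain ⟨h, hh, rfl⟩ := hz
  have h_step := fun t => le_and_one_le_of_mem_support_locRound (hr0 t) (hr t)
    ((step_of_mem_support_trajectory _ _ _ _ _ hh).2 t)
  exact isOnlineSolution_of_step hr0 (fun t => (h_step t).1)
    fun t => by exact_mod_cast (h_step t).2

section locPotential

variable {m k : ℕ} {s₀ β : ℝ} {c u : Fin m → ℝ} {s : LocState m}

/-- The potential of LearnOrCoverCIP, when the rows of `A` are still to come. -/
def locPotential (s₀ β : ℝ) (c u : Fin m → ℝ) (A : Fin k → Fin m → ℝ) (s : LocState m) : ℝ :=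
  coverPotential s₀ β c A s.z - 4 * negCrossEntropy c u β s.x

theorem dot_le_locPotential {A : Fin k → Fin m → ℝ} (hs₀ : 0 < s₀) (hβ : 0 < β)
    (hc : ∀ j, 0 < c j) (hu : ∀ j, 0 ≤ u j) (hA : ∀ i, ∃ j, 0 < A i j)
    (hs : IsCompatible β c u s.x) : dot c (toReal s.z) ≤ locPotential s₀ β c u A s := by
  have h_cover := dot_le_coverPotential hs₀ hβ.le hc hA s.z
  have h_entropy := negCrossEntropy_nonpos hβ (fun j => (hc j).le) hu hs.nonneg hs.dot_eq
  unfold locPotential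
  linarith

theorem locPotential_nonneg {A : Fin k → Fin m → ℝ} (hs₀ : 0 < s₀) (hβ : 0 < β)
    (hc : ∀ j, 0 < c j) (hu : ∀ j, 0 ≤ u j) (hA : ∀ i, ∃ j, 0 < A i j)
    (hs : IsCompatible β c u s.x) : 0 ≤ locPotential s₀ β c u A s :=
  (dot_toReal_nonneg (fun j => (hc j).le) s.z).trans (dot_le_locPotential hs₀ hβ hc hu hA hs)

variable {A : Fin (k + 1) → Fin m → ℝ}

theorem mean_locRound_le (hs₀ : 0 < s₀) (hβ : 0 < β) (hc : ∀ j, 0 < c j) (hu : ∀ j, 0 ≤ u j)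
    (hcu : dot c u ≤ β) (hA : ∀ i, IsRow (A i)) (hs : IsCompatible β c u s.x) (i : Fin (k + 1))
    (hAu : 1 ≤ dot (A i) u) :
    ∃ φ, 0 ≤ φ ∧ φ ≤ locPotential s₀ β c u A s + 8 * weightExcess s₀ β c A s.z s.x i ∧
      mean (locRound β c (A i) s)
        (fun s' => ENNReal.ofReal (locPotential s₀ β c u (dropRow i A) s')) = ENNReal.ofReal φ := by
  have h_drop : ∀ l, ∃ j, 0 < dropRow i A l j := fun l => (hA _).2
  rcases le_or_gt (deficit (A i) s.z) threshold with h_le | h_active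
  · rw [locRound_of_le h_le, mean_pure]
    refine ⟨_, locPotential_nonneg hs₀ hβ hc hu h_drop hs, ?_, rfl⟩
    have h_cover := coverPotential_dropRow_le hs₀ hβ.le hc (fun i => (hA i).2) s.z i
    rw [weightExcess, rowWeight, if_neg fun h => h.1.not_ge h_le, locPotential, locPotential]
    linarith
  · have hr := (minRatio_le_dot hc (hA i).nonneg (hA i).2 hu hAu).trans hcu
    have h_cover := coinMean_coverPotential_le hs₀ hβ hc hA hs.nonneg hs.dot_eq h_active hr
    have h_learn := learnChange_le hβ hc (hA i).nonneg (hA i).2 hs.nonneg hs.dot_eq h_active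
    have h_entropy :=
      hs.negCrossEntropy_sub_learnChange_le hβ hc hu hcu (hA i).nonneg (hA i).2 hAu s.z
    have h_nonneg := fun b => locPotential_nonneg
      (s := ⟨learnStep β c (A i) s.z s.x, buy c (A i) (increment β c (A i) s.x s.z) s.z b⟩)
      hs₀ hβ hc hu h_drop (hs.learnStep hβ hc (hA i).nonneg (hA i).2 s.z)
    have hp := fun j => unitInterval.fract_mem (increment β c (A i) s.x s.z j)
    rw [locRound_of_lt h_active, mean_map, mean_coins hp h_nonneg]
    refine ⟨_, coinMean_nonneg hp h_nonneg, ?_, rfl⟩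
    simp only [locPotential, sub_eq_add_neg, coinMean_add, coinMean_const]
    linarith

/-- The data that are fixed in the analysis of LearnOrCoverCIP: the remaining rows are covered by
the fractional solution `u`. -/
structure IsLocInvariant (β : ℝ) (c u : Fin m → ℝ) (A : Fin k → Fin m → ℝ) (s : LocState m) :
    Prop where
  isRow : ∀ i, IsRow (A i)
  one_le_dot : ∀ i, 1 ≤ dot (A i) u
  isCompatible : IsCompatible β c u s.x

theorem isRandomOrderPotential_locPotential (hs₀ : 0 < s₀) (hβ : 0 < β) (hc : ∀ j, 0 < c j)
    (hu : ∀ j, 0 ≤ u j) (hcu : dot c u ≤ β) :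
    IsRandomOrderPotential (locRound β c) (fun _ A s => IsLocInvariant β c u A s)
      (fun _ A s => ENNReal.ofReal (locPotential s₀ β c u A s))
      fun s => ENNReal.ofReal (dot c (toReal s.z)) where
  le_final A s hs := ENNReal.ofReal_le_ofReal
    (dot_le_locPotential hs₀ hβ hc hu (fun i => (hs.isRow i).2) hs.isCompatible)
  inv_serve k A s hs i s' hs' := ⟨fun _ => hs.isRow _, fun _ => hs.one_le_dot _,
    hs.isCompatible.of_mem_support_locRound hβ hc (hs.isRow i).nonneg (hs.isRow i).2 hs'⟩
  sum_mean_le k A s hs := by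
    choose φ hφ_nonneg hφ_le hφ using fun i =>
      mean_locRound_le hs₀ hβ hc hu hcu hs.isRow hs.isCompatible i (hs.one_le_dot i)
    refine sum_le_mul_ofReal (e := fun i => 8 * weightExcess s₀ β c A s.z s.x i)
      (fun i => (hφ_nonneg i).trans (hφ_le i))
      (fun i => (hφ i).trans_le (ENNReal.ofReal_le_ofReal (hφ_le i))) ?_
    rw [← Finset.mul_sum, sum_weightExcess hc (fun i => (hs.isRow i).2), mul_zero]

end locPotential

section initial

variable {m k n : ℕ} {β : ℝ} {c u : Fin m → ℝ}

theorem logPotential_uncovered_le {A : Fin k → Fin m → ℝ} (hβ : 0 < β) (hc : ∀ j, 0 < c j)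
    (hA : ∀ i, IsRow (A i)) (hn : 0 < n) (hk : k ≤ n) (z : Fin m → ℕ) :
    logPotential (β / n) (uncovered (β / n) β c A z) ≤ 2 + 2 * Real.log n := by
  have hn' : (1 : ℝ) ≤ n := Nat.one_le_cast.2 hn
  have hs : 0 < β / n := by positivity
  have h_uncovered : uncovered (β / n) β c A z ≤ n * β :=
    (uncovered_le hβ.le hc hA z).trans (mul_le_mul_of_nonneg_right (Nat.cast_le.2 hk) hβ.le)
  have h_scale : β / n ≤ 2 * (n * β) := by
    calc β / n ≤ β := div_le_self hβ.le hn'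
      _ ≤ n * β := le_mul_of_one_le_left hβ.le hn'
      _ ≤ 2 * (n * β) := le_mul_of_one_le_left (by positivity) one_le_two
  refine (logPotential_mono hs (uncovered_nonneg hc (fun i => (hA i).2) z) h_uncovered
    (Or.inr h_scale)).trans ?_
  have h_quot : 2 * (n * β) / (β / n) = 2 * ((n : ℝ) * n) := by field_simp
  rw [logPotential, if_neg (by positivity), h_quot, Real.log_mul two_ne_zero (by positivity),
    Real.log_mul (by positivity) (by positivity)]
  linarith [Real.log_two_lt_d9]

theorem coverPotential_le {A : Fin k → Fin m → ℝ} (hβ : 0 < β) (hc : ∀ j, 0 < c j)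
    (hA : ∀ i, IsRow (A i)) (hn : 0 < n) (hk : k ≤ n) (z : Fin m → ℕ) :
    coverPotential (β / n) β c A z ≤ dot c (toReal z) + (56 + 48 * Real.log n) * β := by
  have h_log := mul_le_mul_of_nonneg_left (logPotential_uncovered_le hβ hc hA hn hk z)
    (by positivity : 0 ≤ 24 * β)
  have h_rows : 8 * (β / n) * k ≤ 8 * β := by
    rw [mul_assoc, div_mul_eq_mul_div]
    gcongr
    exact div_le_of_le_mul₀ (Nat.cast_nonneg _) hβ.le (by gcongr)
  unfold coverPotential
  linarith

/-- The set of the `m'` columns that may be used by a solution of cost `β`. -/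
def affordable (β : ℝ) (c : Fin m → ℝ) : Finset (Fin m) := Finset.univ.filter fun j => c j ≤ β

theorem mem_affordable {j : Fin m} : j ∈ affordable β c ↔ c j ≤ β := by simp [affordable]

theorem mul_locInit (hc : ∀ j, 0 < c j) {j : Fin m} (hj : j ∈ affordable β c) :
    c j * (locInit β c).x j = β / (affordable β c).card := by
  have hcj := hc j
  simp only [locInit, if_pos (mem_affordable.1 hj), affordable]
  field_simp

theorem locInit_of_notMem {j : Fin m} (hj : j ∉ affordable β c) : (locInit β c).x j = 0 :=
  if_neg (mt mem_affordable.2 hj)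

theorem isCompatible_locInit (hβ : 0 < β) (hc : ∀ j, 0 < c j)
    (hu_supp : ∀ j, 0 < u j → c j ≤ β) (h_nonempty : (affordable β c).Nonempty) :
    IsCompatible β c u (locInit β c).x := by
  have h_card : (0 : ℝ) < (affordable β c).card := Nat.cast_pos.2 h_nonempty.card_pos
  have h_pos : ∀ j ∈ affordable β c, 0 < (locInit β c).x j := fun j hj =>
    pos_of_mul_pos_right ((mul_locInit hc hj).symm ▸ div_pos hβ h_card) (hc j).le
  refine ⟨fun j => ?_, ?_, fun j hj => h_pos j (mem_affordable.2 (hu_supp j hj))⟩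
  · by_cases hj : j ∈ affordable β c
    · exact (h_pos j hj).le
    · exact (locInit_of_notMem hj).ge
  · rw [dot, ← Finset.sum_subset (Finset.subset_univ (affordable β c))
        fun j _ hj => by rw [locInit_of_notMem hj, mul_zero],
      Finset.sum_congr rfl fun j hj => mul_locInit hc hj, Finset.sum_const, nsmul_eq_mul,
      mul_div_cancel₀ _ h_card.ne']

theorem neg_mul_log_le_negCrossEntropy_locInit (hβ : 0 < β) (hc : ∀ j, 0 < c j)
    (hu : ∀ j, 0 ≤ u j) (hu_supp : ∀ j, 0 < u j → c j ≤ β)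
    (h_nonempty : (affordable β c).Nonempty) (hcu : dot c u ≤ β) :
    -(β * Real.log m) ≤ negCrossEntropy c u β (locInit β c).x := by
  have h_card : (affordable β c).card ≤ m := by
    simpa using Finset.card_le_univ (affordable β c)
  rw [negCrossEntropy_of_mul_eq hβ.ne' hu fun j hj =>
    mul_locInit hc (mem_affordable.2 (hu_supp j hj))]
  exact neg_le_neg (mul_le_mul hcu
    (Real.log_le_log (Nat.cast_pos.2 h_nonempty.card_pos) (Nat.cast_le.2 h_card))
    (Real.log_natCast_nonneg _) hβ.le)

end initial

section log

variable {m n : ℕ}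

theorem log_natCast_mul_natCast (h : 2 ≤ m * n) :
    Real.log (m * n) = Real.log m + Real.log n := by
  have h_ne : m * n ≠ 0 := by omega
  exact Real.log_mul (Nat.cast_ne_zero.2 (left_ne_zero_of_mul h_ne))
    (Nat.cast_ne_zero.2 (right_ne_zero_of_mul h_ne))

theorem two_le_three_mul_log (h : 2 ≤ m * n) : 2 ≤ 3 * Real.log (m * n) := by
  have h_log : Real.log 2 ≤ Real.log (m * n) := Real.log_le_log two_pos (by exact_mod_cast h)
  linarith [Real.log_two_gt_d9]

end log

theorem expectedCost_learnOrCover_le {m n : ℕ} {A : Fin n → Fin m → ℝ} {c : Fin m → ℝ} {β : ℝ}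
    (hc : ∀ j, 0 < c j) (hA : ∀ i, IsRow (A i)) (hβ : lpOpt A c ≤ β) (hmn : 2 ≤ m * n) :
    expectedCost 1 A c (learnOrCover β c) ≤ ENNReal.ofReal (136 * β * Real.log (m * n)) := by
  obtain ⟨u, hu, hAu, hu_opt, hu_supp⟩ := exists_lp_solution hc hA
  have hcu : dot c u ≤ β := hu_opt.trans_le hβ
  have hu_supp' := fun j hj => (hu_supp j hj).trans hβ
  have hn : 0 < n := pos_of_mul_pos_right (by omega : 0 < m * n) (Nat.zero_le m)
  obtain ⟨j, hj⟩ : ∃ j, 0 < u j := by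
    by_contra! h_neg
    have h_zero : u = 0 := funext fun j => le_antisymm (h_neg j) (hu j)
    have h_row := hAu ⟨0, hn⟩
    norm_num [h_zero, dot] at h_row
  have hβ_pos : 0 < β := (hc j).trans_le (hu_supp' j hj)
  have h_nonempty : (affordable β c).Nonempty := ⟨j, mem_affordable.2 (hu_supp' j hj)⟩
  have h_potential := isRandomOrderPotential_locPotential (s₀ := β / n) (by positivity)
    hβ_pos hc hu hcu
  refine (h_potential.mean_randomOrder_le
    ⟨hA, hAu, isCompatible_locInit hβ_pos hc hu_supp' h_nonempty⟩ fun h => by simp).trans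
      (ENNReal.ofReal_le_ofReal ?_)
  have h_cover := coverPotential_le hβ_pos hc hA hn le_rfl (locInit β c).z
  have h_cost : dot c (toReal (locInit β c).z) = 0 := by simp [dot, toReal, locInit]
  have h_entropy :=
    neg_mul_log_le_negCrossEntropy_locInit hβ_pos hc hu hu_supp' h_nonempty hcu
  have h_log := mul_le_mul_of_nonneg_left (two_le_three_mul_log hmn) hβ_pos.le
  have h_log_m := mul_nonneg hβ_pos.le (Real.log_natCast_nonneg m)
  have h_log_n := mul_nonneg hβ_pos.le (Real.log_natCast_nonneg n)
  rw [log_natCast_mul_natCast hmn] at h_log ⊢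
  rw [locPotential]
  linarith

/-! ### Guessing the optimal value -/

section guess

variable {m : ℕ}

/-- The state of LearnOrCoverCIP together with a guess `β` of the optimal value and with a
certificate `G`: if `G` exceeds `m`, then `β` is smaller than the optimal value. -/
structure AdaptState (m : ℕ) where
  x : Fin m → ℝ
  z : Fin m → ℕ
  β : ℝ
  G : ℝ

/-- The part of the state that is used by LearnOrCoverCIP with the guess as the given value. -/
def AdaptState.toLoc (s : AdaptState m) : LocState m := ⟨s.x, s.z⟩

/-- The start of a new phase with the guess `β`, in which the integer solution is kept. All columns
get the same share of `β`, whether they are affordable or not. -/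
def AdaptState.restart (c : Fin m → ℝ) (β : ℝ) (s : AdaptState m) : AdaptState m where
  x := fun j => β / (c j * m)
  z := s.z
  β := β
  G := 1

/-- The multiplicative update, recorded in the certificate. -/
def AdaptState.learn (c a : Fin m → ℝ) (s : AdaptState m) : AdaptState m :=
  { s with
    x := learnStep s.β c a s.z s.x
    G := if dot a s.x < deficit a s.z then
        s.G * (Real.exp (greedyCost c a s.z / s.β) / learnNorm s.β c a (greedyCost c a s.z) s.x)
      else s.G }

/-- A round of LearnOrCoverCIP with the guess as the given value, after which the certificate is
updated and `post` is applied if the row was not covered. -/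
def roundThen (post : AdaptState m → AdaptState m) (c a : Fin m → ℝ) (s : AdaptState m) :
    PMF (AdaptState m) :=
  if threshold < deficit a s.z then
    (coins fun j => Int.fract (increment s.β c a s.x s.z j)).map fun b =>
      { post (s.learn c a) with z := buy c a (increment s.β c a s.x s.z) s.z b }
  else PMF.pure s

/-- A guess below the cost of a full greedy cover of the arriving row is replaced. -/
def AdaptState.raise (c a : Fin m → ℝ) (s : AdaptState m) : AdaptState m :=
  if s.β < minRatio c a then s.restart c (2 * minRatio c a) else s

/-- A guess that is refuted by the certificate is doubled. -/
def AdaptState.refute (c : Fin m → ℝ) (s : AdaptState m) : AdaptState m :=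
  if (m : ℝ) < s.G then s.restart c (2 * s.β) else s

/-- A round of the algorithm that guesses the optimal value. -/
def adaptRound (c a : Fin m → ℝ) (s : AdaptState m) : PMF (AdaptState m) :=
  roundThen (AdaptState.refute c) c a (s.raise c a)

/-- The initial state of the algorithm that guesses the optimal value; the guess `0` is replaced
when the first row arrives. -/
def adaptInit (m : ℕ) : AdaptState m := ⟨0, 0, 0, 0⟩

/-- The law of the integer solutions held by the algorithm that guesses the optimal value. -/
def adaptiveLearnOrCover {n : ℕ} (c : Fin m → ℝ) (r : Fin n → Fin m → ℝ) :
    PMF (Fin (n + 1) → Fin m → ℕ) :=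
  (trajectory (adaptRound c) n (adaptInit m) r).map fun h t => (h t).z

variable {post : AdaptState m → AdaptState m} {c a : Fin m → ℝ} {s s' : AdaptState m}

theorem roundThen_of_lt (h : threshold < deficit a s.z) :
    roundThen post c a s =
      (coins fun j => Int.fract (increment s.β c a s.x s.z j)).map fun b =>
        { post (s.learn c a) with z := buy c a (increment s.β c a s.x s.z) s.z b } :=
  if_pos h

theorem roundThen_of_le (h : deficit a s.z ≤ threshold) : roundThen post c a s = PMF.pure s :=
  if_neg h.not_gt

theorem map_toLoc_roundThen_id (c a : Fin m → ℝ) (s : AdaptState m) :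
    (roundThen id c a s).map AdaptState.toLoc = locRound s.β c a s.toLoc := by
  rcases le_or_gt (deficit a s.toLoc.z) threshold with h_le | h_active
  · rw [roundThen_of_le h_le, locRound_of_le h_le, PMF.pure_map]
  · rw [roundThen_of_lt h_active, locRound_of_lt h_active, PMF.map_comp]
    rfl

theorem β_eq_of_mem_support_roundThen_id (h : s' ∈ (roundThen id c a s).support) :
    s'.β = s.β := by
  rcases le_or_gt (deficit a s.z) threshold with h_le | h_active
  · rw [roundThen_of_le h_le, PMF.mem_support_pure_iff] at h
    rw [h]
  · rw [roundThen_of_lt h_active, PMF.mem_support_map_iff] at h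
    obtain ⟨b, -, rfl⟩ := h
    rfl

theorem AdaptState.z_raise (c a : Fin m → ℝ) (s : AdaptState m) : (s.raise c a).z = s.z := by
  unfold AdaptState.raise
  split_ifs <;> rfl

theorem le_and_one_le_of_mem_support_roundThen (ha0 : ∀ j, 0 ≤ a j) (ha : ∃ j, 0 < a j)
    (h : s' ∈ (roundThen post c a s).support) : s.z ≤ s'.z ∧ 1 ≤ 3 * dot a (toReal s'.z) := by
  rcases le_or_gt (deficit a s.z) threshold with h_le | h_active
  · rw [roundThen_of_le h_le, PMF.mem_support_pure_iff] at h
    subst h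
    exact ⟨le_rfl, one_le_three_mul_dot h_le⟩
  · rw [roundThen_of_lt h_active, PMF.mem_support_map_iff] at h
    obtain ⟨b, -, rfl⟩ := h
    refine ⟨le_buy _ _ b, ?_⟩
    dsimp only
    linarith [one_le_dot_buy (c := c) ha0 ha (increment s.β c a s.x s.z) s.z b]

theorem le_and_one_le_of_mem_support_adaptRound (ha0 : ∀ j, 0 ≤ a j) (ha : ∃ j, 0 < a j)
    (h : s' ∈ (adaptRound c a s).support) : s.z ≤ s'.z ∧ 1 ≤ 3 * dot a (toReal s'.z) :=
  s.z_raise c a ▸ le_and_one_le_of_mem_support_roundThen ha0 ha h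

theorem isOnlineSolution_of_mem_support_adaptiveLearnOrCover {n : ℕ} {r : Fin n → Fin m → ℝ}
    (hr0 : ∀ t j, 0 ≤ r t j) (hr : ∀ t, ∃ j, 0 < r t j) {z : Fin (n + 1) → Fin m → ℕ}
    (hz : z ∈ (adaptiveLearnOrCover c r).support) : IsOnlineSolution 3 r z := by
  rw [adaptiveLearnOrCover, PMF.mem_support_map_iff] at hz
  obtain ⟨h, hh, rfl⟩ := hz
  have h_step := fun t => le_and_one_le_of_mem_support_adaptRound (hr0 t) (hr t)
    ((step_of_mem_support_trajectory _ _ _ _ _ hh).2 t)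
  exact isOnlineSolution_of_step hr0 (fun t => (h_step t).1)
    fun t => by exact_mod_cast (h_step t).2

end guess

section phase

variable {m : ℕ} {c u a : Fin m → ℝ} {s s' : AdaptState m}

/-- What the certificate leaves, scaled by `β`, of the initial relative entropy `β log m`. -/
def AdaptState.slack (s : AdaptState m) : ℝ := s.β * (Real.log m - Real.log s.G)

/-- The invariant of a phase, as long as the certificate has not been checked. The fractional
solution `u` is not known to the algorithm. -/
structure AdaptState.IsSound (c u : Fin m → ℝ) (s : AdaptState m) : Prop where
  pos : 0 < s.β
  le_two_mul : s.β ≤ 2 * dot c u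
  isCompatible : IsCompatible s.β c u s.x
  certificate_pos : 0 < s.G
  neg_slack_le : dot c u ≤ s.β → -s.slack ≤ negCrossEntropy c u s.β s.x

/-- The invariant of a phase: the certificate does not refute the guess. -/
structure AdaptState.IsGood (c u : Fin m → ℝ) (s : AdaptState m) : Prop extends s.IsSound c u where
  certificate_le : s.G ≤ m

theorem AdaptState.IsGood.slack_nonneg (hs : s.IsGood c u) : 0 ≤ s.slack :=
  mul_nonneg hs.pos.le (sub_nonneg.2 (Real.log_le_log hs.certificate_pos hs.certificate_le))

theorem AdaptState.IsGood.with_z (hs : s.IsGood c u) (z : Fin m → ℕ) :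
    ({ s with z := z } : AdaptState m).IsGood c u :=
  ⟨⟨hs.pos, hs.le_two_mul, hs.isCompatible, hs.certificate_pos, hs.neg_slack_le⟩,
    hs.certificate_le⟩

theorem AdaptState.slack_restart (c : Fin m → ℝ) (β : ℝ) (s : AdaptState m) :
    (s.restart c β).slack = β * Real.log m := by
  simp [slack, restart]

theorem AdaptState.isGood_restart (hc : ∀ j, 0 < c j) (hu : ∀ j, 0 ≤ u j) (hm : 0 < m) {β : ℝ}
    (hβ : 0 < β) (hβu : β ≤ 2 * dot c u) (s : AdaptState m) : (s.restart c β).IsGood c u := by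
  have hm' : (0 : ℝ) < m := Nat.cast_pos.2 hm
  have hx_pos : ∀ j, 0 < β / (c j * m) := fun j => div_pos hβ (mul_pos (hc j) hm')
  have hcx : ∀ j, c j * (β / (c j * m)) = β / m := fun j => by
    have hcj := (hc j).ne'
    field_simp
  refine ⟨⟨hβ, hβu, ⟨fun j => (hx_pos j).le, ?_, fun j _ => hx_pos j⟩, zero_lt_one,
    fun hcu => ?_⟩, Nat.one_le_cast.2 hm⟩
  · simp only [restart, dot, hcx]
    rw [Finset.sum_const, Finset.card_univ, Fintype.card_fin, nsmul_eq_mul,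
      mul_div_cancel₀ _ hm'.ne']
  · rw [slack_restart]
    refine (neg_le_neg ?_).trans_eq (negCrossEntropy_of_mul_eq hβ.ne' hu fun j _ => hcx j).symm
    exact mul_le_mul_of_nonneg_right hcu (Real.log_natCast_nonneg m)

theorem AdaptState.isGood_raise (hc : ∀ j, 0 < c j) (hu : ∀ j, 0 ≤ u j) (ha0 : ∀ j, 0 ≤ a j)
    (ha : ∃ j, 0 < a j) (hau : 1 ≤ dot a u) (hs : s.β = 0 ∨ s.IsGood c u) :
    (s.raise c a).IsGood c u := by
  have hr := minRatio_pos hc ha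
  have hru := minRatio_le_dot hc ha0 ha hu hau
  unfold AdaptState.raise
  split_ifs with h_lt
  · obtain ⟨j, -⟩ := ha
    exact s.isGood_restart hc hu j.pos (by positivity) (by gcongr)
  · exact hs.resolve_left fun h_zero => h_lt (h_zero.trans_lt hr)

theorem AdaptState.minRatio_le_β_raise (hc : ∀ j, 0 < c j) (ha : ∃ j, 0 < a j)
    (s : AdaptState m) : minRatio c a ≤ (s.raise c a).β := by
  unfold AdaptState.raise
  split_ifs with h_lt
  · exact le_mul_of_one_le_left (minRatio_pos hc ha).le one_le_two
  · exact not_lt.1 h_lt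

theorem AdaptState.IsSound.learnNorm_pos (hc : ∀ j, 0 < c j) (ha0 : ∀ j, 0 ≤ a j)
    (ha : ∃ j, 0 < a j) (hs : s.IsSound c u) :
    0 < learnNorm s.β c a (greedyCost c a s.z) s.x :=
  zero_lt_one.trans_le (one_le_learnNorm hs.pos (fun j => (hc j).le) ha0
    hs.isCompatible.nonneg hs.isCompatible.dot_eq (greedyCost_nonneg hc ha s.z))

theorem AdaptState.IsSound.slack_learn (hc : ∀ j, 0 < c j) (ha0 : ∀ j, 0 ≤ a j)
    (ha : ∃ j, 0 < a j) (hs : s.IsSound c u) :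
    (s.learn c a).slack = s.slack + learnChange s.β c a s.z s.x := by
  have hβ := hs.pos.ne'
  have h_norm := hs.learnNorm_pos hc ha0 ha
  unfold slack AdaptState.learn learnChange
  split_ifs
  · dsimp only
    rw [Real.log_mul hs.certificate_pos.ne' (by positivity),
      Real.log_div (Real.exp_pos _).ne' h_norm.ne', Real.log_exp]
    field_simp
    ring
  · exact (add_zero _).symm

theorem AdaptState.IsSound.learn (hc : ∀ j, 0 < c j) (hu : ∀ j, 0 ≤ u j) (ha0 : ∀ j, 0 ≤ a j)
    (ha : ∃ j, 0 < a j) (hau : 1 ≤ dot a u) (hs : s.IsSound c u) :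
    (s.learn c a).IsSound c u where
  pos := hs.pos
  le_two_mul := hs.le_two_mul
  isCompatible := hs.isCompatible.learnStep hs.pos hc ha0 ha s.z
  certificate_pos := by
    have h_norm := hs.learnNorm_pos hc ha0 ha
    have hG := hs.certificate_pos
    unfold AdaptState.learn
    dsimp only
    split_ifs <;> positivity
  neg_slack_le hcu := by
    rw [hs.slack_learn hc ha0 ha]
    have h_learn :=
      hs.isCompatible.negCrossEntropy_sub_learnChange_le hs.pos hc hu hcu ha0 ha hau s.z
    refine le_trans ?_ h_learn
    linarith [hs.neg_slack_le hcu]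

theorem AdaptState.IsGood.neg_β_le_slack_learn (hc : ∀ j, 0 < c j) (ha0 : ∀ j, 0 ≤ a j)
    (ha : ∃ j, 0 < a j) (hr : minRatio c a ≤ s.β) (hs : s.IsGood c u) :
    -s.β ≤ (s.learn c a).slack := by
  rw [hs.toIsSound.slack_learn hc ha0 ha]
  linarith [hs.slack_nonneg, greedyCost_le_minRatio hc ha0 ha s.z,
    neg_greedyCost_le_learnChange (z := s.z) hs.pos hc ha0 ha hs.isCompatible.nonneg
      hs.isCompatible.dot_eq]

/-- If `dot c u ≤ β`, then the slack dominates a relative entropy, hence it is nonnegative and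
`G ≤ m`. -/
theorem AdaptState.IsSound.refute (hc : ∀ j, 0 < c j) (hu : ∀ j, 0 ≤ u j) (hm : 0 < m)
    (hs : s.IsSound c u) : (s.refute c).IsGood c u := by
  unfold AdaptState.refute
  split_ifs with hG
  · refine s.isGood_restart hc hu hm (mul_pos two_pos hs.pos) ?_
    gcongr
    by_contra! h_lt
    have h_slack : 0 ≤ s.slack := by
      linarith [hs.neg_slack_le h_lt.le, negCrossEntropy_nonpos hs.pos (fun j => (hc j).le) hu
        hs.isCompatible.nonneg hs.isCompatible.dot_eq]
    have h_log := Real.log_lt_log (Nat.cast_pos.2 hm) hG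
    exact (mul_neg_of_pos_of_neg hs.pos (sub_neg.2 h_log)).not_ge h_slack
  · exact ⟨hs, not_lt.1 hG⟩

theorem AdaptState.IsGood.of_mem_support_adaptRound (hc : ∀ j, 0 < c j) (hu : ∀ j, 0 ≤ u j)
    (ha0 : ∀ j, 0 ≤ a j) (ha : ∃ j, 0 < a j) (hau : 1 ≤ dot a u)
    (hs : s.β = 0 ∨ s.IsGood c u) (hs' : s' ∈ (adaptRound c a s).support) : s'.IsGood c u := by
  have h_raise := isGood_raise hc hu ha0 ha hau hs
  unfold adaptRound at hs'
  rcases le_or_gt (deficit a (s.raise c a).z) threshold with h_le | h_active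
  · rw [roundThen_of_le h_le, PMF.mem_support_pure_iff] at hs'
    rwa [hs']
  · rw [roundThen_of_lt h_active, PMF.mem_support_map_iff] at hs'
    obtain ⟨b, -, rfl⟩ := hs'
    obtain ⟨j, -⟩ := id ha
    exact ((h_raise.toIsSound.learn hc hu ha0 ha hau).refute hc hu j.pos).with_z _

end phase

section adaptPotential

variable {m n k : ℕ} {c u : Fin m → ℝ} {V : ℝ} {s : AdaptState m}

/-- The cost of a phase with the guess `β` is at most `β` times this number. -/
def phaseRate (m n : ℕ) : ℝ := 64 + 48 * Real.log n + 4 * Real.log m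

/-- The potential of the algorithm that guesses the optimal value `V`, when the rows of `A` are
still to come. The last term pays for the phases to come, whose guesses at least double and never
exceed `2 V`. -/
def adaptPotential (n : ℕ) (V : ℝ) (c : Fin m → ℝ) (A : Fin k → Fin m → ℝ) (s : AdaptState m) : ℝ :=
  coverPotential (s.β / n) s.β c A s.z + 4 * s.slack + 4 * s.β +
    phaseRate m n * (4 * V - 2 * s.β)

theorem phaseRate_nonneg (m n : ℕ) : 0 ≤ phaseRate m n := by
  unfold phaseRate
  linarith [Real.log_natCast_nonneg n, Real.log_natCast_nonneg m]

section remaining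

variable {A : Fin k → Fin m → ℝ}

theorem dot_add_le_adaptPotential (hn : 0 < n) (hc : ∀ j, 0 < c j) (hA : ∀ i, ∃ j, 0 < A i j)
    (hβ : 0 < s.β) (h_slack : -s.β ≤ s.slack) :
    dot c (toReal s.z) + phaseRate m n * (4 * V - 2 * s.β) ≤ adaptPotential n V c A s := by
  have h_cover := dot_le_coverPotential (div_pos hβ (Nat.cast_pos.2 hn)) hβ.le hc hA s.z
  unfold adaptPotential
  linarith

theorem adaptPotential_of_β_eq_zero (A : Fin k → Fin m → ℝ) (h : s.β = 0) :
    adaptPotential n V c A s = dot c (toReal s.z) + phaseRate m n * (4 * V) := by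
  simp [adaptPotential, coverPotential, AdaptState.slack, h]

theorem AdaptState.IsGood.dot_add_le_adaptPotential (hn : 0 < n) (hc : ∀ j, 0 < c j)
    (hA : ∀ i, ∃ j, 0 < A i j) (hs : s.IsGood c u) :
    dot c (toReal s.z) + phaseRate m n * (4 * V - 2 * s.β) ≤ adaptPotential n V c A s :=
  CoveringIP.dot_add_le_adaptPotential hn hc hA hs.pos
    ((neg_nonpos.2 hs.pos.le).trans hs.slack_nonneg)

theorem dot_add_le_adaptPotential_of_eq_zero_or (hn : 0 < n) (hc : ∀ j, 0 < c j)
    (hA : ∀ i, ∃ j, 0 < A i j) (hs : s.β = 0 ∨ s.IsGood c u) :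
    dot c (toReal s.z) + phaseRate m n * (4 * V - 2 * s.β) ≤ adaptPotential n V c A s := by
  rcases hs with h_zero | h_good
  · rw [adaptPotential_of_β_eq_zero A h_zero, h_zero, mul_zero, sub_zero]
  · exact h_good.dot_add_le_adaptPotential hn hc hA

theorem dot_le_adaptPotential (hn : 0 < n) (hc : ∀ j, 0 < c j) (hu : ∀ j, 0 ≤ u j)
    (hA : ∀ i, ∃ j, 0 < A i j) (hs : s.β = 0 ∨ s.IsGood c u) :
    dot c (toReal s.z) ≤ adaptPotential n (dot c u) c A s := by
  have hβ : s.β ≤ 2 * dot c u := by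
    rcases hs with h_zero | h_good
    · rw [h_zero]
      exact mul_nonneg two_pos.le (dot_nonneg (fun j => (hc j).le) hu)
    · exact h_good.le_two_mul
  refine le_trans (le_add_of_nonneg_right (mul_nonneg (phaseRate_nonneg m n) ?_))
    (dot_add_le_adaptPotential_of_eq_zero_or hn hc hA hs)
  linarith

theorem adaptPotential_nonneg (hn : 0 < n) (hc : ∀ j, 0 < c j) (hu : ∀ j, 0 ≤ u j)
    (hA : ∀ i, ∃ j, 0 < A i j) (hs : s.IsGood c u) : 0 ≤ adaptPotential n (dot c u) c A s :=
  (dot_toReal_nonneg (fun j => (hc j).le) s.z).trans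
    (dot_le_adaptPotential hn hc hu hA (Or.inr hs))

theorem adaptPotential_restart_add_le (hn : 0 < n) (hk : k ≤ n) (hc : ∀ j, 0 < c j)
    (hA : ∀ i, IsRow (A i)) {β : ℝ} (hβ : 0 < β) (s : AdaptState m) :
    adaptPotential n V c A (s.restart c β) + 4 * β ≤
      dot c (toReal s.z) + phaseRate m n * (4 * V - β) := by
  have h_cover := coverPotential_le hβ hc hA hn hk s.z
  rw [adaptPotential, AdaptState.slack_restart]
  simp only [AdaptState.restart, phaseRate]
  linarith

theorem adaptPotential_refute_le (hn : 0 < n) (hk : k ≤ n) (hc : ∀ j, 0 < c j)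
    (hA : ∀ i, IsRow (A i)) (hβ : 0 < s.β) (h_slack : -s.β ≤ s.slack) :
    adaptPotential n V c A (s.refute c) ≤ adaptPotential n V c A s := by
  unfold AdaptState.refute
  split_ifs
  · linarith [adaptPotential_restart_add_le (V := V) hn hk hc hA (mul_pos two_pos hβ) s,
      dot_add_le_adaptPotential (V := V) hn hc (fun i => (hA i).2) hβ h_slack]
  · exact le_rfl

end remaining

variable {A : Fin (k + 1) → Fin m → ℝ}

theorem adaptPotential_dropRow_le (hn : 0 < n) (hc : ∀ j, 0 < c j) (hA : ∀ i, ∃ j, 0 < A i j)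
    (hβ : 0 < s.β) (i : Fin (k + 1)) :
    adaptPotential n V c (dropRow i A) s ≤ adaptPotential n V c A s := by
  unfold adaptPotential
  gcongr
  exact coverPotential_dropRow_le (div_pos hβ (Nat.cast_pos.2 hn)) hβ.le hc hA s.z i

theorem AdaptState.refute_with_z (c : Fin m → ℝ) (s : AdaptState m) (z : Fin m → ℕ) :
    { s.refute c with z := z } = ({ s with z := z } : AdaptState m).refute c := by
  unfold AdaptState.refute
  dsimp only
  split_ifs <;> rfl

theorem coinMean_adaptPotential_learn_le (hn : 0 < n) (hc : ∀ j, 0 < c j)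
    (hA : ∀ i, IsRow (A i)) (hs : s.IsGood c u) {i : Fin (k + 1)}
    (hr : minRatio c (A i) ≤ s.β) (h_active : threshold < deficit (A i) s.z) :
    coinMean (fun j => Int.fract (increment s.β c (A i) s.x s.z j)) (fun b =>
        adaptPotential n V c (dropRow i A)
          { s.learn c (A i) with z := buy c (A i) (increment s.β c (A i) s.x s.z) s.z b }) ≤
      adaptPotential n V c A s + 8 * weightExcess (s.β / n) s.β c A s.z s.x i := by
  obtain ⟨hx, hcx, -⟩ := hs.isCompatible
  have h_cover := coinMean_coverPotential_le (div_pos hs.pos (Nat.cast_pos.2 hn)) hs.pos hc hA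
    hx hcx h_active hr
  have h_learn := learnChange_le hs.pos hc (hA i).nonneg (hA i).2 hx hcx h_active
  have h_slack := hs.toIsSound.slack_learn hc (hA i).nonneg (hA i).2
  have h_split : ∀ b, adaptPotential n V c (dropRow i A)
      { s.learn c (A i) with z := buy c (A i) (increment s.β c (A i) s.x s.z) s.z b } =
      coverPotential (s.β / n) s.β c (dropRow i A)
        (buy c (A i) (increment s.β c (A i) s.x s.z) s.z b) +
      (4 * (s.learn c (A i)).slack + 4 * s.β + phaseRate m n * (4 * V - 2 * s.β)) := fun b => by
    simp only [adaptPotential, AdaptState.slack, AdaptState.learn]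
    ring
  simp only [h_split, coinMean_add, coinMean_const]
  rw [adaptPotential]
  linarith

theorem mean_roundThen_refute_le (hn : 0 < n) (hk : k ≤ n) (hc : ∀ j, 0 < c j)
    (hu : ∀ j, 0 ≤ u j) (hA : ∀ i, IsRow (A i)) (hs : s.IsGood c u) (i : Fin (k + 1))
    (hAu : 1 ≤ dot (A i) u) (hr : minRatio c (A i) ≤ s.β) :
    ∃ φ, 0 ≤ φ ∧
      φ ≤ adaptPotential n (dot c u) c A s + 8 * weightExcess (s.β / n) s.β c A s.z s.x i ∧
      mean (roundThen (AdaptState.refute c) c (A i) s)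
          (fun s' => ENNReal.ofReal (adaptPotential n (dot c u) c (dropRow i A) s')) =
        ENNReal.ofReal φ := by
  have h_drop : ∀ l, ∃ j, 0 < dropRow i A l j := fun l => (hA _).2
  rcases le_or_gt (deficit (A i) s.z) threshold with h_le | h_active
  · rw [roundThen_of_le h_le, mean_pure]
    refine ⟨_, adaptPotential_nonneg hn hc hu h_drop hs, ?_, rfl⟩
    rw [weightExcess, rowWeight, if_neg fun h => h.1.not_ge h_le, zero_mul, mul_zero, add_zero]
    exact adaptPotential_dropRow_le hn hc (fun i => (hA i).2) hs.pos i
  · obtain ⟨ha0, j, hj⟩ := And.intro (hA i).nonneg (hA i).2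
    have h_sound := hs.toIsSound.learn hc hu ha0 ⟨j, hj⟩ hAu
    have h_nonneg := fun b => adaptPotential_nonneg hn hc hu h_drop
      ((h_sound.refute hc hu j.pos).with_z
        (buy c (A i) (increment s.β c (A i) s.x s.z) s.z b))
    have h_refute := fun b => adaptPotential_refute_le (V := dot c u) (A := dropRow i A)
      (s := { s.learn c (A i) with z := buy c (A i) (increment s.β c (A i) s.x s.z) s.z b })
      hn hk hc (fun l => hA _) hs.pos (hs.neg_β_le_slack_learn hc ha0 ⟨j, hj⟩ hr)
    have hp := fun j => unitInterval.fract_mem (increment s.β c (A i) s.x s.z j)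
    rw [roundThen_of_lt h_active, mean_map, mean_coins hp h_nonneg]
    refine ⟨_, coinMean_nonneg hp h_nonneg, ?_, rfl⟩
    simp only [AdaptState.refute_with_z]
    exact (coinMean_mono hp h_refute).trans
      (coinMean_adaptPotential_learn_le hn hc hA hs hr h_active)

/-- If the guess is raised, then the row has no weight for the old guess, and the new phase pays for
the excess. -/
theorem adaptPotential_raise_add_weightExcess_le (hn : 0 < n) (hk : k + 1 ≤ n)
    (hc : ∀ j, 0 < c j) (hu : ∀ j, 0 ≤ u j) (hA : ∀ i, IsRow (A i))
    (hs : s.β = 0 ∨ s.IsGood c u) {i : Fin (k + 1)} (hAu : 1 ≤ dot (A i) u)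
    {s₁ : AdaptState m} (hs₁ : s₁ = s.raise c (A i)) :
    adaptPotential n (dot c u) c A s₁ + 8 * weightExcess (s₁.β / n) s₁.β c A s₁.z s₁.x i ≤
      adaptPotential n (dot c u) c A s + 8 * weightExcess (s.β / n) s.β c A s.z s.x i := by
  have h_good : s₁.IsGood c u :=
    hs₁ ▸ AdaptState.isGood_raise hc hu (hA i).nonneg (hA i).2 hAu hs
  unfold AdaptState.raise at hs₁
  split_ifs at hs₁ with h_lt
  · have hr := minRatio_pos hc (hA i).2
    have h_old : weightExcess (s.β / n) s.β c A s.z s.x i = 0 := by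
      rw [weightExcess, rowWeight, if_neg fun h => h_lt.not_ge h.2.1, zero_mul]
    have h_new : weightExcess (s₁.β / n) s₁.β c A s₁.z s₁.x i ≤ minRatio c (A i) :=
      (weightExcess_le hc hA h_good.isCompatible.nonneg s₁.z i).trans
        (rowWeight_le_minRatio hc (hA i).nonneg (hA i).2 s₁.z)
    have h_restart := adaptPotential_restart_add_le (V := dot c u) hn hk hc hA
      (mul_pos two_pos hr) s
    have h_phase := dot_add_le_adaptPotential_of_eq_zero_or (V := dot c u) hn hc
      (fun i => (hA i).2) hs
    have h_rate := mul_le_mul_of_nonneg_left h_lt.le (phaseRate_nonneg m n)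
    rw [h_old]
    rw [← hs₁] at h_restart
    linarith
  · rw [hs₁]

/-- The invariant of the analysis: the remaining rows, at most `n` of them, are covered by the
fractional solution `u`. -/
structure IsAdaptInvariant (n : ℕ) (c u : Fin m → ℝ) (A : Fin k → Fin m → ℝ) (s : AdaptState m) :
    Prop where
  card_le : k ≤ n
  isRow : ∀ i, IsRow (A i)
  one_le_dot : ∀ i, 1 ≤ dot (A i) u
  eq_zero_or_isGood : s.β = 0 ∨ s.IsGood c u

theorem isRandomOrderPotential_adaptPotential (hn : 0 < n) (hc : ∀ j, 0 < c j)
    (hu : ∀ j, 0 ≤ u j) :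
    IsRandomOrderPotential (adaptRound c) (fun _ A s => IsAdaptInvariant n c u A s)
      (fun _ A s => ENNReal.ofReal (adaptPotential n (dot c u) c A s))
      fun s => ENNReal.ofReal (dot c (toReal s.z)) where
  le_final A s hs := ENNReal.ofReal_le_ofReal
    (dot_le_adaptPotential hn hc hu (fun i => (hs.isRow i).2) hs.eq_zero_or_isGood)
  inv_serve k A s hs i s' hs' := ⟨Nat.le_of_succ_le hs.card_le, fun _ => hs.isRow _,
    fun _ => hs.one_le_dot _, Or.inr (.of_mem_support_adaptRound hc hu (hs.isRow i).nonneg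
      (hs.isRow i).2 (hs.one_le_dot i) hs.eq_zero_or_isGood hs')⟩
  sum_mean_le k A s hs := by
    have h_raise := fun i => AdaptState.isGood_raise hc hu (hs.isRow i).nonneg (hs.isRow i).2
      (hs.one_le_dot i) hs.eq_zero_or_isGood
    choose φ hφ_nonneg hφ_le hφ using fun i =>
      mean_roundThen_refute_le hn (Nat.le_of_succ_le hs.card_le) hc hu hs.isRow (h_raise i) i
        (hs.one_le_dot i) (s.minRatio_le_β_raise hc (hs.isRow i).2)
    have hφ_le' := fun i => (hφ_le i).trans (adaptPotential_raise_add_weightExcess_le hn hs.card_le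
      hc hu hs.isRow hs.eq_zero_or_isGood (hs.one_le_dot i) rfl)
    refine sum_le_mul_ofReal (e := fun i => 8 * weightExcess (s.β / n) s.β c A s.z s.x i)
      (fun i => (hφ_nonneg i).trans (hφ_le' i))
      (fun i => (hφ i).trans_le (ENNReal.ofReal_le_ofReal (hφ_le' i))) ?_
    rw [← Finset.mul_sum, sum_weightExcess hc (fun i => (hs.isRow i).2), mul_zero]

theorem phaseRate_le (hmn : 2 ≤ m * n) : phaseRate m n ≤ 144 * Real.log (m * n) := by
  have h_log := two_le_three_mul_log hmn
  have h_log_n := Real.log_natCast_nonneg n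
  have h_log_m := Real.log_natCast_nonneg m
  rw [log_natCast_mul_natCast hmn] at h_log ⊢
  unfold phaseRate
  linarith

theorem expectedCost_adaptiveLearnOrCover_le {A : Fin n → Fin m → ℝ} (hc : ∀ j, 0 < c j)
    (hA : ∀ i, IsRow (A i)) (hmn : 2 ≤ m * n) :
    expectedCost 1 A c (adaptiveLearnOrCover c) ≤
      ENNReal.ofReal (576 * Real.log (m * n) * lpOpt A c) := by
  obtain ⟨u, hu, hAu, hu_opt, -⟩ := exists_lp_solution hc hA
  have hn : 0 < n := pos_of_mul_pos_right (by omega : 0 < m * n) (Nat.zero_le m)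
  have h_potential := isRandomOrderPotential_adaptPotential (n := n) hn hc hu
  refine (h_potential.mean_randomOrder_le ⟨le_rfl, hA, hAu, Or.inl rfl⟩ fun h => by simp).trans
    (ENNReal.ofReal_le_ofReal ?_)
  have h_cost : dot c (toReal (adaptInit m).z) = 0 := by simp [dot, toReal, adaptInit]
  rw [adaptPotential_of_β_eq_zero A rfl, h_cost, hu_opt, zero_add]
  linarith [mul_le_mul_of_nonneg_right (phaseRate_le hmn)
    (lpOpt_nonneg (A := A) fun j => (hc j).le)]

end adaptPotential

/-! ### Programs: frames, running time and deterministic commands -/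

section machine

variable {m A : ℕ} {I R : List ℕ} {f g : Cmd} {s t : Config} {P Q : Config → Prop}

@[simp] theorem Config.tick_int (s : Config) (k : ℕ) : (s.tick k).int = s.int := rfl

@[simp] theorem Config.tick_real (s : Config) (k : ℕ) : (s.tick k).real = s.real := rfl

/-- `t` agrees with `s` except possibly in the integer arrays `I`, in the real arrays `R` and in the
clock. -/
structure EqOff (I R : List ℕ) (s t : Config) : Prop where
  int : ∀ a ∉ I, t.int a = s.int a
  real : ∀ a ∉ R, t.real a = s.real a

namespace EqOff

theorem tick (s : Config) (k : ℕ) : EqOff I R s (s.tick k) := ⟨fun _ _ => rfl, fun _ _ => rfl⟩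

theorem putInt {a : ℕ} (ha : a ∈ I) (s : Config) (i v : ℕ) : EqOff I R s (s.putInt a i v) :=
  ⟨fun _ hb => Function.update_of_ne (ne_of_mem_of_not_mem ha hb).symm _ _, fun _ _ => rfl⟩

theorem putReal {a : ℕ} (ha : a ∈ R) (s : Config) (i : ℕ) (v : ℝ) :
    EqOff I R s (s.putReal a i v) :=
  ⟨fun _ _ => rfl, fun _ hb => Function.update_of_ne (ne_of_mem_of_not_mem ha hb).symm _ _⟩

theorem trans {u : Config} (hst : EqOff I R s t) (htu : EqOff I R t u) : EqOff I R s u :=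
  ⟨fun a ha => (htu.int a ha).trans (hst.int a ha),
    fun a ha => (htu.real a ha).trans (hst.real a ha)⟩

theorem mono {I' R' : List ℕ} (h : EqOff I R s t) (hI : I ⊆ I') (hR : R ⊆ R') : EqOff I' R' s t :=
  ⟨fun a ha => h.int a fun h => ha (hI h), fun a ha => h.real a fun h => ha (hR h)⟩

end EqOff

/-- The integer arrays that a command may change. -/
def Cmd.intTargets : Cmd → List ℕ
  | .skip | .setReal _ _ _ => []
  | .setInt a _ _ | .setFloor a _ _ | .toss a _ _ => [a]
  | .seq f g | .ifLt _ _ f g => f.intTargets ++ g.intTargets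
  | .loop a _ f => a :: f.intTargets

/-- The real arrays that a command may change. -/
def Cmd.realTargets : Cmd → List ℕ
  | .skip | .setInt _ _ _ | .setFloor _ _ _ | .toss _ _ _ => []
  | .setReal a _ _ => [a]
  | .seq f g | .ifLt _ _ f g => f.realTargets ++ g.realTargets
  | .loop _ _ f => f.realTargets

theorem invariant_of_mem_support_iterate {body : ℕ → Config → PMF Config}
    {J : ℕ → Config → Prop} (hs : J 0 s) :
    ∀ {k : ℕ}, (∀ j < k, ∀ σ, J j σ → ∀ t ∈ (body j σ).support, J (j + 1) t) →
      ∀ t ∈ (iterate body k s).support, J k t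
  | 0, _, t, ht => by
      obtain rfl := (PMF.mem_support_pure_iff _ _).1 ht
      exact hs
  | k + 1, h, t, ht => by
      obtain ⟨σ, hσ, ht⟩ := (PMF.mem_support_bind_iff _ _ _).1 ht
      exact h k k.lt_succ_self σ
        (invariant_of_mem_support_iterate hs (fun j hj => h j (Nat.lt_succ_of_lt hj)) σ hσ) t ht

theorem Cmd.eqOff_of_mem_support_run : ∀ {f : Cmd} {s t : Config}, t ∈ (f.run s).support →
    EqOff f.intTargets f.realTargets s t
  | .skip, s, t, h => by
      obtain rfl := (PMF.mem_support_pure_iff _ _).1 h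
      exact .tick s 1
  | .setInt a i e, s, t, h => by
      obtain rfl := (PMF.mem_support_pure_iff _ _).1 h
      exact (EqOff.putInt (List.mem_singleton_self a) s _ _).trans (.tick _ _)
  | .setReal a i e, s, t, h => by
      obtain rfl := (PMF.mem_support_pure_iff _ _).1 h
      exact (EqOff.putReal (List.mem_singleton_self a) s _ _).trans (.tick _ _)
  | .setFloor a i e, s, t, h => by
      obtain rfl := (PMF.mem_support_pure_iff _ _).1 h
      exact (EqOff.putInt (List.mem_singleton_self a) s _ _).trans (.tick _ _)
  | .toss a i p, s, t, h => by
      obtain ⟨b, -, rfl⟩ := (PMF.mem_support_map_iff _ _ _).1 h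
      exact (EqOff.putInt (List.mem_singleton_self a) s _ _).trans (.tick _ _)
  | .seq f g, s, t, h => by
      obtain ⟨σ, hσ, ht⟩ := (PMF.mem_support_bind_iff _ _ _).1 h
      exact ((eqOff_of_mem_support_run hσ).mono (List.subset_append_left _ _)
          (List.subset_append_left _ _)).trans
        ((eqOff_of_mem_support_run ht).mono (List.subset_append_right _ _)
          (List.subset_append_right _ _))
  | .ifLt d e f g, s, t, h => by
      rw [Cmd.run] at h
      refine (EqOff.tick s (d.size + e.size + 1)).trans ?_
      split_ifs at h
      · exact (eqOff_of_mem_support_run h).mono (List.subset_append_left _ _)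
          (List.subset_append_left _ _)
      · exact (eqOff_of_mem_support_run h).mono (List.subset_append_right _ _)
          (List.subset_append_right _ _)
  | .loop a e f, s, t, h => by
      refine invariant_of_mem_support_iterate
        (J := fun _ => EqOff (Cmd.loop a e f).intTargets (Cmd.loop a e f).realTargets s)
        (.tick s _) (fun j _ σ hσ τ hτ => ?_) t h
      have h_loopVar : EqOff (a :: f.intTargets) f.realTargets s (σ.putInt a 0 j) :=
        hσ.trans (.putInt List.mem_cons_self σ 0 j)
      exact (h_loopVar.trans (.tick _ 1)).trans
        ((eqOff_of_mem_support_run hτ).mono (List.subset_cons_self _ _) (List.Subset.refl _))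

/-- The number `m` of columns, as an expression. -/
def dimExpr : IExpr := .get 0 (.lit 0)

/-- Every loop runs over the columns. -/
def Cmd.LoopsOverColumns : Cmd → Prop
  | .seq f g | .ifLt _ _ f g => f.LoopsOverColumns ∧ g.LoopsOverColumns
  | .loop _ e f => e = dimExpr ∧ f.LoopsOverColumns
  | _ => True

open Polynomial in
/-- A bound for the running time of a command whose loops run over the columns, as a polynomial in
the number of columns. -/
def Cmd.cost : Cmd → ℕ[X]
  | .skip => 1
  | .setInt _ i e => C (i.size + e.size + 1)
  | .setReal _ i e | .setFloor _ i e | .toss _ i e => C (i.size + e.size + 1)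
  | .seq f g => f.cost + g.cost
  | .ifLt d e f g => C (d.size + e.size + 1) + (f.cost + g.cost)
  | .loop _ e f => C (e.size + 1) + X * (1 + f.cost)

theorem Cmd.clock_le_loop {a : ℕ} (ha : 0 ≠ a) (h0 : 0 ∉ f.intTargets) {B : ℕ → ℕ}
    (hf : ∀ {σ τ : Config}, τ ∈ (f.run σ).support → τ.clock ≤ σ.clock + B (σ.int 0 0))
    (h : t ∈ ((Cmd.loop a dimExpr f).run s).support) :
    t.clock ≤ s.clock + (dimExpr.size + 1 + s.int 0 0 * (1 + B (s.int 0 0))) := by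
  rw [Cmd.run, show dimExpr.eval s = s.int 0 0 from rfl] at h
  refine (Nat.add_assoc _ _ _).le.trans' (invariant_of_mem_support_iterate
    (J := fun k t => t.int 0 = s.int 0 ∧
      t.clock ≤ s.clock + (dimExpr.size + 1) + k * (1 + B (s.int 0 0)))
    (s := s.tick (dimExpr.size + 1)) ⟨rfl, by simp [Config.tick]⟩ (fun j _ σ hσ τ hτ => ?_) t h).2
  have h_int : ((σ.putInt a 0 j).tick 1).int 0 = s.int 0 :=
    (Function.update_of_ne ha _ _).trans hσ.1
  have h_clock : τ.clock ≤ σ.clock + 1 + B (((σ.putInt a 0 j).tick 1).int 0 0) := hf hτ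
  rw [h_int] at h_clock
  refine ⟨((eqOff_of_mem_support_run hτ).int 0 h0).trans h_int, ?_⟩
  have := hσ.2
  rw [add_mul]
  lia

theorem Cmd.clock_le : ∀ {f : Cmd}, f.LoopsOverColumns → 0 ∉ f.intTargets →
    ∀ {s t : Config}, t ∈ (f.run s).support → t.clock ≤ s.clock + f.cost.eval (s.int 0 0)
  | .skip, _, _, s, t, h | .setInt _ _ _, _, _, s, t, h | .setReal _ _ _, _, _, s, t, h
  | .setFloor _ _ _, _, _, s, t, h => by
      obtain rfl := (PMF.mem_support_pure_iff _ _).1 h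
      simp [Cmd.cost, Config.tick, Config.putInt, Config.putReal]
  | .toss a i p, _, _, s, t, h => by
      obtain ⟨b, -, rfl⟩ := (PMF.mem_support_map_iff _ _ _).1 h
      simp [Cmd.cost, Config.tick, Config.putInt]
  | .seq f g, hfg, h0, s, t, h => by
      obtain ⟨σ, hσ, ht⟩ := (PMF.mem_support_bind_iff _ _ _).1 h
      obtain ⟨h0f, h0g⟩ := not_or.1 (mt List.mem_append.2 h0)
      have h_f := f.clock_le hfg.1 h0f hσ
      have h_g := g.clock_le hfg.2 h0g ht
      rw [(eqOff_of_mem_support_run hσ).int 0 h0f] at h_g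
      rw [Cmd.cost, Polynomial.eval_add]
      lia
  | .ifLt d e f g, hfg, h0, s, t, h => by
      obtain ⟨h0f, h0g⟩ := not_or.1 (mt List.mem_append.2 h0)
      rw [Cmd.run] at h
      rw [Cmd.cost, Polynomial.eval_add, Polynomial.eval_add, Polynomial.eval_C]
      split_ifs at h
      · have h_f : _ ≤ s.clock + _ + f.cost.eval (s.int 0 0) := f.clock_le hfg.1 h0f h
        lia
      · have h_g : _ ≤ s.clock + _ + g.cost.eval (s.int 0 0) := g.clock_le hfg.2 h0g h
        lia
  | .loop a e f, hf, h0, s, t, h => by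
      obtain ⟨rfl, hf⟩ := hf
      obtain ⟨h0a, h0f⟩ := not_or.1 (mt List.mem_cons.2 h0)
      simpa [Cmd.cost] using clock_le_loop h0a h0f (B := fun k => f.cost.eval k)
        (fun hτ => clock_le hf h0f hτ) h

theorem polynomial_eval_mono (p : Polynomial ℕ) : Monotone fun a => p.eval a := fun a b hab => by
  simp only [Polynomial.eval_eq_sum]
  exact Finset.sum_le_sum fun i _ => Nat.mul_le_mul_left _ (Nat.pow_le_pow_left hab i)

theorem runsWithin_cost {n : ℕ} {P : OnlineProgram} (h_setup : P.setup.LoopsOverColumns)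
    (h_setup0 : 0 ∉ P.setup.intTargets) (h_serve : P.serve.LoopsOverColumns)
    (h_serve0 : 0 ∉ P.serve.intTargets) (c : Fin m → ℝ) (β : ℝ) (r : Fin n → Fin m → ℝ) :
    P.RunsWithin c β r ((P.setup.cost + Polynomial.X * P.serve.cost).eval (m + n)) := by
  intro h hh
  obtain ⟨s, hs, hh⟩ := (PMF.mem_support_bind_iff _ _ _).1 hh
  obtain ⟨h_zero, h_step⟩ := step_of_mem_support_trajectory _ _ _ _ h hh
  have h_clock : ∀ t : Fin (n + 1), (h t).int 0 0 = m ∧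
      (h t).clock ≤ P.setup.cost.eval m + t * P.serve.cost.eval m := by
    intro t
    induction t using Fin.induction with
    | zero =>
      rw [h_zero, (Cmd.eqOff_of_mem_support_run hs).int 0 h_setup0]
      simpa [Config.start] using P.setup.clock_le h_setup h_setup0 hs
    | succ t ih =>
      rw [(Cmd.eqOff_of_mem_support_run (h_step t)).int 0 h_serve0]
      have h_serve := Cmd.clock_le h_serve h_serve0 (h_step t)
      simp only [Config.load, ih.1] at h_serve
      refine ⟨ih.1, h_serve.trans ?_⟩
      rw [Fin.val_succ, add_mul, one_mul, ← add_assoc]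
      exact Nat.add_le_add_right ih.2 _
  refine (h_clock (Fin.last n)).2.trans ?_
  simp only [Polynomial.eval_add, Polynomial.eval_mul, Polynomial.eval_X, Fin.val_last]
  exact Nat.add_le_add (polynomial_eval_mono _ (Nat.le_add_right _ _))
    (Nat.mul_le_mul (Nat.le_add_left _ _) (polynomial_eval_mono _ (Nat.le_add_right _ _)))

/-- The command is deterministic on `s`, and its result satisfies `Q`. -/
def Det (f : Cmd) (s : Config) (Q : Config → Prop) : Prop := ∃ t, f.run s = PMF.pure t ∧ Q t

namespace Det

theorem eqOff_and (h : Det f s Q) :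
    Det f s fun t => EqOff f.intTargets f.realTargets s t ∧ Q t := by
  obtain ⟨t, ht, hQ⟩ := h
  exact ⟨t, ht, Cmd.eqOff_of_mem_support_run (by simp [ht]), hQ⟩

theorem mono (h : Det f s P) (hPQ : ∀ t, EqOff f.intTargets f.realTargets s t → P t → Q t) :
    Det f s Q := by
  obtain ⟨t, ht, h_off, hP⟩ := h.eqOff_and
  exact ⟨t, ht, hPQ t h_off hP⟩

theorem seq (hf : Det f s P)
    (hg : ∀ t, EqOff f.intTargets f.realTargets s t → P t → Det g t Q) :
    Det (.seq f g) s Q := by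
  obtain ⟨t, ht, h_off, hP⟩ := hf.eqOff_and
  obtain ⟨u, hu, hQ⟩ := hg t h_off hP
  exact ⟨u, by rw [Cmd.run, ht, PMF.pure_bind, hu], hQ⟩

theorem ifLt {d e : RExpr}
    (hf : d.eval s < e.eval s → Det f (s.tick (d.size + e.size + 1)) Q)
    (hg : ¬d.eval s < e.eval s → Det g (s.tick (d.size + e.size + 1)) Q) :
    Det (.ifLt d e f g) s Q := by
  unfold Det
  rw [Cmd.run]
  split_ifs with h
  exacts [hf h, hg h]

theorem skip (h : Q (s.tick 1)) : Det .skip s Q := ⟨_, rfl, h⟩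

theorem setInt (a : ℕ) (i e : IExpr) (s : Config) :
    Det (.setInt a i e) s fun t => t.int a = Function.update (s.int a) (i.eval s) (e.eval s) :=
  ⟨_, rfl, Function.update_self _ _ _⟩

theorem setFloor (a : ℕ) (i : IExpr) (e : RExpr) (s : Config) :
    Det (.setFloor a i e) s fun t =>
      t.int a = Function.update (s.int a) (i.eval s) ⌊e.eval s⌋₊ :=
  ⟨_, rfl, Function.update_self _ _ _⟩

theorem setReal (a : ℕ) (i : IExpr) (e : RExpr) (s : Config) :
    Det (.setReal a i e) s fun t => t.real a = Function.update (s.real a) (i.eval s) (e.eval s) :=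
  ⟨_, rfl, Function.update_self _ _ _⟩

theorem setReal_lit (a k : ℕ) (e : RExpr) (s : Config) :
    Det (.setReal a (.lit k) e) s fun t => t.real a k = e.eval s :=
  (setReal a (.lit k) e s).mono fun t _ ht => by rw [ht]; exact Function.update_self k _ _

end Det

/-- For every column `j`, store `j` in the integer array `2` and do `f`. -/
def forColumns (f : Cmd) : Cmd := .loop 2 dimExpr f

theorem det_forColumns (hm : s.int 0 0 = m) (J : ℕ → Config → Prop)
    (h0 : ∀ t, EqOff [] [] s t → J 0 t)
    (h : ∀ (j : Fin m) σ, J j σ → ∀ τ, EqOff [2] [] σ τ → τ.int 2 0 = j → Det f τ (J (j + 1))) :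
    Det (forColumns f) s (J m) := by
  have h_iterate : ∀ k ≤ m, ∃ t, iterate (fun k s => f.run ((s.putInt 2 0 k).tick 1)) k
      (s.tick (dimExpr.size + 1)) = PMF.pure t ∧ J k t := by
    intro k
    induction k with
    | zero => exact fun _ => ⟨_, rfl, h0 _ (.tick s _)⟩
    | succ k ih =>
      intro hk
      obtain ⟨t, ht, hJ⟩ := ih (Nat.le_of_succ_le hk)
      obtain ⟨u, hu, hJ'⟩ := h ⟨k, hk⟩ t hJ ((t.putInt 2 0 k).tick 1)
        ((EqOff.putInt (List.mem_singleton_self 2) t 0 k).trans (.tick _ 1))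
        (by simp [Config.tick, Config.putInt])
      exact ⟨u, by rw [iterate, ht, PMF.pure_bind]; exact hu, hJ'⟩
  obtain ⟨t, ht, hJ⟩ := h_iterate m le_rfl
  refine ⟨t, ?_, hJ⟩
  rw [forColumns, Cmd.run, show dimExpr.eval s = m from hm]
  exact ht

theorem det_forColumns_store {v : Fin m → ℝ} (hm : s.int 0 0 = m) (h_int : f.intTargets = [])
    (h_real : f.realTargets ⊆ [A])
    (h : ∀ (j : Fin m) σ, EqOff [2] [A] s σ → σ.int 2 0 = j → σ.real A j = s.real A j →
      Det f σ fun t => t.real A = Function.update (σ.real A) j (v j)) :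
    Det (forColumns f) s fun t => ∀ j : Fin m, t.real A j = v j := by
  refine (det_forColumns hm (fun k σ => EqOff [2] [A] s σ ∧
    ∀ j : Fin m, σ.real A j = if (j : ℕ) < k then v j else s.real A j)
    (fun t ht => ⟨ht.mono (List.nil_subset _) (List.nil_subset _), fun j => ?_⟩)
    fun j σ hσ τ hτ hj => ?_).mono fun t _ ht j => (ht.2 j).trans (if_pos j.2)
  · rw [ht.real A List.not_mem_nil, if_neg (Nat.not_lt_zero _)]
  · have h_off : EqOff [2] [A] s τ := hσ.1.trans (hτ.mono (List.Subset.refl _) (List.nil_subset _))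
    have hτ_real : τ.real A = σ.real A := hτ.real A List.not_mem_nil
    refine (h j τ h_off hj (by rw [hτ_real, hσ.2, if_neg (lt_irrefl _)])).mono
      fun t ht h_store => ⟨h_off.trans (ht.mono (by simp [h_int]) h_real), fun i => ?_⟩
    rw [h_store, hτ_real]
    obtain rfl | hij := eq_or_ne i j
    · rw [Function.update_self, if_pos (Nat.lt_succ_self _)]
    · have h_val : (i : ℕ) ≠ j := Fin.val_ne_of_ne hij
      rw [Function.update_of_ne h_val, hσ.2]
      simp only [Nat.lt_succ_iff, Nat.le_iff_lt_or_eq, h_val, or_false]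

/-- The current column. -/
def colExpr : IExpr := .get 2 (.lit 0)

/-- The entry of the real array `a` at the current column. -/
def colEntry (a : ℕ) : RExpr := .get a colExpr

/-- The real variable `a`, held at index `0` of array `a`. -/
def realVar (a : ℕ) : RExpr := .get a (.lit 0)

/-- A natural number as a real expression. -/
def natExpr (k : ℕ) : RExpr := .ofInt (.lit k)

@[simp] theorem eval_colExpr : colExpr.eval s = s.int 2 0 := rfl

@[simp] theorem eval_colEntry (a : ℕ) : (colEntry a).eval s = s.real a (s.int 2 0) := rfl

@[simp] theorem eval_realVar (a : ℕ) : (realVar a).eval s = s.real a 0 := rfl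

@[simp] theorem eval_natExpr (k : ℕ) : (natExpr k).eval s = k := rfl

@[simp] theorem eval_dimExpr : dimExpr.eval s = s.int 0 0 := rfl

/-- Store the value of `e` at every column in the real array `A`. -/
def tabulateCmd (A : ℕ) (e : RExpr) : Cmd := forColumns (.setReal A colExpr e)

/-- Store the value of `e` at every column with `d < d'`, and the value of `e'` at the other
columns, in the real array `A`. -/
def tabulateIfCmd (A : ℕ) (d d' e e' : RExpr) : Cmd :=
  forColumns (.ifLt d d' (.setReal A colExpr e) (.setReal A colExpr e'))

/-- Store the sum over the columns of the values of `e` in the real variable `A`. -/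
def sumCmd (A : ℕ) (e : RExpr) : Cmd :=
  .seq (.setReal A (.lit 0) (natExpr 0)) (forColumns (.setReal A (.lit 0) (.add (realVar A) e)))

theorem IExpr.eval_tick (k : ℕ) (e : IExpr) : e.eval (s.tick k) = e.eval s := by
  induction e <;> simp_all [IExpr.eval]

theorem RExpr.eval_tick (k : ℕ) (e : RExpr) : e.eval (s.tick k) = e.eval s := by
  induction e <;> simp_all [RExpr.eval, IExpr.eval_tick]

theorem det_setReal_colExpr {j : ℕ} {v : ℝ} {e : RExpr} (hj : s.int 2 0 = j) (he : e.eval s = v) :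
    Det (.setReal A colExpr e) s fun t => t.real A = Function.update (s.real A) j v := by
  subst hj he
  exact .setReal A colExpr e s

theorem det_tabulateCmd {e : RExpr} {v : Fin m → ℝ} (hm : s.int 0 0 = m)
    (h : ∀ (j : Fin m) σ, EqOff [2] [A] s σ → σ.int 2 0 = j → σ.real A j = s.real A j →
      e.eval σ = v j) :
    Det (tabulateCmd A e) s fun t => ∀ j : Fin m, t.real A j = v j :=
  det_forColumns_store hm rfl (List.Subset.refl _) fun j σ h_off hj hA =>
    det_setReal_colExpr hj (h j σ h_off hj hA)

theorem det_tabulateIfCmd {d d' e e' : RExpr} {v : Fin m → ℝ} (hm : s.int 0 0 = m)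
    (h : ∀ (j : Fin m) σ, EqOff [2] [A] s σ → σ.int 2 0 = j → σ.real A j = s.real A j →
      (if d.eval σ < d'.eval σ then e.eval σ else e'.eval σ) = v j) :
    Det (tabulateIfCmd A d d' e e') s fun t => ∀ j : Fin m, t.real A j = v j := by
  refine det_forColumns_store hm rfl (by simp [Cmd.realTargets]) fun j σ h_off hj hA => ?_
  have h_val := h j σ h_off hj hA
  refine .ifLt (fun hlt => ?_) fun hlt => ?_
  · rw [if_pos hlt] at h_val
    exact det_setReal_colExpr hj ((e.eval_tick _).trans h_val)
  · rw [if_neg hlt] at h_val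
    exact det_setReal_colExpr hj ((e'.eval_tick _).trans h_val)

theorem det_sumCmd {e : RExpr} {v : Fin m → ℝ} (hm : s.int 0 0 = m)
    (h : ∀ (j : Fin m) σ, EqOff [2] [A] s σ → σ.int 2 0 = j → e.eval σ = v j) :
    Det (sumCmd A e) s fun t => t.real A 0 = ∑ j, v j := by
  refine (Det.setReal_lit A 0 (natExpr 0) s).seq fun s₀ (hs₀ : EqOff [] [A] s s₀) h_zero => ?_
  refine (det_forColumns (m := m) (by rwa [hs₀.int 0 List.not_mem_nil])
    (fun k σ => EqOff [2] [A] s σ ∧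
      σ.real A 0 = ∑ j ∈ Finset.univ.filter fun i : Fin m => (i : ℕ) < k, v j)
    (fun t ht => ⟨?_, ?_⟩) fun j σ hσ τ hτ hj => ?_).mono fun t _ ht => by simpa using ht.2
  · exact (hs₀.mono (List.nil_subset _) (List.Subset.refl _)).trans
      (ht.mono (List.nil_subset _) (List.nil_subset _))
  · simp [ht.real A List.not_mem_nil, h_zero]
  · have h_off : EqOff [2] [A] s τ := hσ.1.trans (hτ.mono (List.Subset.refl _) (List.nil_subset _))
    refine (Det.setReal_lit A 0 _ τ).mono fun t ht h_add =>
      ⟨h_off.trans (ht.mono (List.nil_subset _) (List.Subset.refl _)), ?_⟩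
    have h_insert : (Finset.univ.filter fun i : Fin m => (i : ℕ) < j + 1) =
        insert j (Finset.univ.filter fun i : Fin m => (i : ℕ) < j) := by
      ext i
      simp [-Order.lt_add_one_iff, Nat.lt_succ_iff_lt_or_eq, Fin.val_inj, or_comm]
    rw [h_add, h_insert, Finset.sum_insert (by simp), ← hσ.2, ← h j τ h_off hj,
      ← hτ.real A List.not_mem_nil, add_comm]
    rfl

end machine

/-! ### Coins tossed one after the other -/

theorem coins_succ {k : ℕ} (p : Fin (k + 1) → ℝ) :
    coins p = (coins fun j => p j.castSucc).bind fun b =>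
      (coin (p (Fin.last k))).map fun t => Fin.snoc (α := fun _ => Bool) b t := by
  refine PMF.ext fun b => ?_
  obtain ⟨b, t, rfl⟩ : ∃ b' t, b = Fin.snoc (α := fun _ => Bool) b' t :=
    ⟨_, _, (Fin.snoc_init_self b).symm⟩
  have h_map (b' : Fin k → Bool) :
      (PMF.map (Fin.snoc (α := fun _ => Bool) b') (coin (p (Fin.last k)))) (Fin.snoc b t) =
        if b = b' then coin (p (Fin.last k)) t else 0 := by
    split_ifs with h
    · simp [PMF.map_apply, h]
    · simp [PMF.map_apply, Fin.snoc_inj, h]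
  simp [PMF.bind_apply, coins, Fin.prod_univ_castSucc, h_map]

theorem exists_iterate_eq_map_coins {body : ℕ → Config → PMF Config} {s : Config}
    {J : ∀ k, (Fin k → Bool) → Config → Prop} :
    ∀ {m : ℕ} {p : Fin m → ℝ}, J 0 Fin.elim0 s →
      (∀ (k : Fin m) b σ, J k b σ → ∃ G : Bool → Config, body k σ = (coin (p k)).map G ∧
        ∀ t, J (k + 1) (Fin.snoc (α := fun _ => Bool) b t) (G t)) →
      ∃ F : (Fin m → Bool) → Config, iterate body m s = (coins p).map F ∧ ∀ b, J m b (F b)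
  | 0, p, h0, _ => by
      exact ⟨fun _ => s, (PMF.map_const _ _).symm, fun b => Subsingleton.elim Fin.elim0 b ▸ h0⟩
  | m + 1, p, h0, h => by
      obtain ⟨F, hF, hJ⟩ := exists_iterate_eq_map_coins (p := fun j => p j.castSucc) h0
        fun k => h k.castSucc
      choose G hG hJG using fun b => h (Fin.last m) b (F b) (hJ b)
      refine ⟨fun b => G (Fin.init b) (b (Fin.last m)), ?_, fun b => ?_⟩
      · rw [iterate, hF, PMF.bind_map, coins_succ, PMF.map_bind]
        refine congrArg _ (funext fun b => ?_)
        rw [PMF.map_comp]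
        simpa [Function.comp_def] using hG b
      · simpa using hJG (Fin.init b) (b (Fin.last m))

/-! ### The programs

Integer arrays: `0` holds `m`, `1` the solution, `2` the current column, `3` the cheapest column,
`4` and `5` are scratch. Real arrays: `0` holds the costs, `1` the guess `β`, `2` the arriving row,
`3` the vector `x`, `4` the truncated row, `7` the vector `y`, `8` the indicator of the affordable
columns, `9` the certificate `G`, `10` the inverse of `min_k c_k / a_k`, `11` the deficit, `12` the
number `κ`, `13` the inner product `⟨a, x⟩`, `14` the norm `⟨c, x⟩ / β`, `15` the number `m'`. -/

/-- Array `4` receives the arriving row, with entries truncated at `1`. -/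
def truncateCmd : Cmd := tabulateIfCmd 4 (natExpr 1) (colEntry 2) (natExpr 1) (colEntry 2)

/-- Find the largest ratio `a_k / c_k` and the first column that attains it. -/
def bestCmd : Cmd :=
  .seq (.setReal 10 (.lit 0) (natExpr 0))
    (forColumns (.ifLt (realVar 10) (.div (colEntry 4) (colEntry 0))
      (.seq (.setReal 10 (.lit 0) (.div (colEntry 4) (colEntry 0))) (.setInt 3 (.lit 0) colExpr))
      .skip))

/-- Start the learning again with the guess `e`. -/
def restartCmd (e : RExpr) : Cmd :=
  .seq (.setReal 1 (.lit 0) e)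
    (.seq (tabulateCmd 3 (.div (realVar 1) (.mul (colEntry 0) (.ofInt dimExpr))))
      (.setReal 9 (.lit 0) (natExpr 1)))

/-- Implements `AdaptState.raise`. -/
def raiseCmd : Cmd :=
  .ifLt (realVar 1) (.div (natExpr 1) (realVar 10)) (restartCmd (.div (natExpr 2) (realVar 10)))
    .skip

/-- Implements `AdaptState.refute`. -/
def refuteCmd : Cmd :=
  .ifLt (.ofInt dimExpr) (realVar 9) (restartCmd (.mul (natExpr 2) (realVar 1))) .skip

/-- Compute the deficit of the row, when array `1` holds `q` times the solution. -/
def deficitCmd (q : ℕ) : Cmd :=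
  .seq (sumCmd 11 (.mul (colEntry 4) (.ofInt (.get 1 colExpr))))
    (.seq (.setReal 11 (.lit 0) (.sub (natExpr 1) (.div (realVar 11) (natExpr q))))
      (.ifLt (realVar 11) (natExpr 0) (.setReal 11 (.lit 0) (natExpr 0)) .skip))

/-- Compute `κ` and the vector `y`. -/
def scaleCmd : Cmd :=
  .seq (.setReal 12 (.lit 0) (.div (realVar 11) (realVar 10)))
    (tabulateCmd 7 (.div (.mul (realVar 12) (colEntry 3)) (realVar 1)))

/-- Multiply every `x_j` by `exp (κ a_j / c_j)`. -/
def weighCmd : Cmd :=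
  tabulateCmd 3 (.mul (colEntry 3) (.exp (.mul (realVar 12) (.div (colEntry 4) (colEntry 0)))))

/-- Compute `⟨c, x⟩ / β`. -/
def normCmd : Cmd :=
  .seq (sumCmd 14 (.mul (colEntry 0) (colEntry 3)))
    (.setReal 14 (.lit 0) (.div (realVar 14) (realVar 1)))

/-- Divide `x` by the norm, and update the certificate. -/
def normalizeCmd : Cmd :=
  .seq (tabulateCmd 3 (.div (colEntry 3) (realVar 14)))
    (.setReal 9 (.lit 0)
      (.mul (realVar 9) (.div (.exp (.div (realVar 12) (realVar 1))) (realVar 14))))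

/-- Implements `AdaptState.learn`. -/
def learnCmd : Cmd :=
  .seq (sumCmd 13 (.mul (colEntry 4) (colEntry 3)))
    (.ifLt (realVar 13) (realVar 11) (.seq weighCmd (.seq normCmd normalizeCmd)) .skip)

/-- The cheapest column. -/
def starExpr : IExpr := .get 3 (.lit 0)

/-- The fractional number of copies of the cheapest column that cover the row. -/
def greedyExpr : RExpr := .div (realVar 11) (.get 4 starExpr)

/-- Buy the cheapest column. The machine has no ceiling, so the floor is bought first. -/
def greedyCmd (q : ℕ) : Cmd :=
  .seq (.setFloor 4 (.lit 0) greedyExpr)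
    (.seq (.setInt 1 starExpr (.add (.get 1 starExpr) (.mul (.lit q) (.get 4 (.lit 0)))))
      (.ifLt (.ofInt (.get 4 (.lit 0))) greedyExpr
        (.setInt 1 starExpr (.add (.get 1 starExpr) (.lit q))) .skip))

/-- Buy a rounding of the current entry of `y`. -/
def roundEntryCmd (q : ℕ) : Cmd :=
  .seq (.setFloor 4 (.lit 0) (colEntry 7))
    (.seq (.toss 5 (.lit 0) (.sub (colEntry 7) (.ofInt (.get 4 (.lit 0)))))
      (.setInt 1 colExpr (.add (.get 1 colExpr)
        (.mul (.lit q) (.add (.get 4 (.lit 0)) (.get 5 (.lit 0)))))))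

/-- The threshold `1 / (e - 1)`. -/
def thresholdExpr : RExpr := .div (natExpr 1) (.sub (.exp (natExpr 1)) (natExpr 1))

/-- Read the arriving row. -/
def prepareCmd : Cmd := .seq truncateCmd bestCmd

/-- Learn and buy, when the deficit exceeds the threshold. -/
def activeCmd (q : ℕ) (post : Cmd) : Cmd :=
  .seq scaleCmd (.seq learnCmd (.seq post (.seq (greedyCmd q) (forColumns (roundEntryCmd q)))))

/-- Implements the round that performs `pre`, then `roundThen post`. -/
def roundCmd (q : ℕ) (pre post : Cmd) : Cmd :=
  .seq prepareCmd (.seq pre (.seq (deficitCmd q)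
    (.ifLt thresholdExpr (realVar 11) (activeCmd q post) .skip)))

/-- Compute the initial fractional solution of `learnOrCover`. -/
def initCmd : Cmd :=
  .seq (tabulateIfCmd 8 (realVar 1) (colEntry 0) (natExpr 0) (natExpr 1))
    (.seq (sumCmd 15 (colEntry 8))
      (tabulateIfCmd 3 (realVar 1) (colEntry 0) (natExpr 0)
        (.div (realVar 1) (.mul (colEntry 0) (realVar 15)))))

/-- The program of `learnOrCover`. -/
def locProgram : OnlineProgram := ⟨initCmd, roundCmd 1 .skip .skip⟩

/-- The program of `adaptiveLearnOrCover`. It holds three times the solution, which is feasible. -/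
def adaptProgram : OnlineProgram := ⟨.skip, roundCmd 3 raiseCmd refuteCmd⟩

/-! ### Correctness of the deterministic commands -/

/-- The memory represents a state of the algorithm, and holds `q` times its solution. -/
structure Represents {m : ℕ} (q : ℕ) (c : Fin m → ℝ) (st : AdaptState m) (s : Config) : Prop where
  dim : s.int 0 0 = m
  cost : ∀ j : Fin m, s.real 0 j = c j
  x : ∀ j : Fin m, s.real 3 j = st.x j
  z : ∀ j : Fin m, s.int 1 j = q * st.z j
  β : s.real 1 0 = st.β
  G : s.real 9 0 = st.G

/-- The memory holds the row `a` and its cheapest column. -/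
structure HoldsRow {m : ℕ} (c a : Fin m → ℝ) (s : Config) : Prop where
  row : ∀ j : Fin m, s.real 4 j = a j
  ratio : s.real 10 0 = 1 / minRatio c a
  argmin : ∃ k : Fin m, IsArgmin c a k ∧ s.int 3 0 = k

section correctness

variable {m q : ℕ} {c a : Fin m → ℝ} {s t : Config} {st : AdaptState m} {I R : List ℕ}

theorem AdaptState.learn_of_lt (h : dot a st.x < deficit a st.z) :
    st.learn c a =
      { st with
        x := CoveringIP.learn st.β c a (greedyCost c a st.z) st.x
        G := st.G * (Real.exp (greedyCost c a st.z / st.β) /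
          learnNorm st.β c a (greedyCost c a st.z) st.x) } := by
  simp [AdaptState.learn, learnStep, h]

theorem AdaptState.learn_of_le (h : deficit a st.z ≤ dot a st.x) : st.learn c a = st := by
  simp [AdaptState.learn, learnStep, not_lt.2 h]

theorem Represents.of_eqOff (h_off : EqOff I R s t) (h : Represents q c st s)
    (hI : ∀ a ∈ [0, 1], a ∉ I := by decide) (hR : ∀ a ∈ [0, 1, 3, 9], a ∉ R := by decide) :
    Represents q c st t where
  dim := by rw [h_off.int 0 (hI 0 (by decide)), h.dim]
  cost j := by rw [h_off.real 0 (hR 0 (by decide)), h.cost]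
  x j := by rw [h_off.real 3 (hR 3 (by decide)), h.x]
  z j := by rw [h_off.int 1 (hI 1 (by decide)), h.z]
  β := by rw [h_off.real 1 (hR 1 (by decide)), h.β]
  G := by rw [h_off.real 9 (hR 9 (by decide)), h.G]

theorem Represents.tick (h : Represents q c st s) (k : ℕ) : Represents q c st (s.tick k) :=
  ⟨h.dim, h.cost, h.x, h.z, h.β, h.G⟩

theorem Represents.set_x {x : Fin m → ℝ} (h : Represents q c st s) (h_off : EqOff [2] [3] s t)
    (hx : ∀ j : Fin m, t.real 3 j = x j) : Represents q c { st with x := x } t where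
  dim := by rw [h_off.int 0 (by decide), h.dim]
  cost j := by rw [h_off.real 0 (by decide), h.cost]
  x := hx
  z j := by rw [h_off.int 1 (by decide), h.z]
  β := by rw [h_off.real 1 (by decide), h.β]
  G := by rw [h_off.real 9 (by decide), h.G]

theorem HoldsRow.of_eqOff (h_off : EqOff I R s t) (h : HoldsRow c a s)
    (hI : 3 ∉ I := by decide) (hR : ∀ a ∈ [4, 10], a ∉ R := by decide) : HoldsRow c a t where
  row j := by rw [h_off.real 4 (hR 4 (by decide)), h.row]
  ratio := by rw [h_off.real 10 (hR 10 (by decide)), h.ratio]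
  argmin := by simpa only [h_off.int 3 hI] using h.argmin

/-- The row with entries truncated at `1`, which has the same integer covers. -/
def truncRow (r : Fin m → ℝ) : Fin m → ℝ := fun j => min (r j) 1

theorem det_truncateCmd {r : Fin m → ℝ} (hm : s.int 0 0 = m) (hr : ∀ j : Fin m, s.real 2 j = r j) :
    Det truncateCmd s fun t => ∀ j : Fin m, t.real 4 j = truncRow r j := by
  refine det_tabulateIfCmd hm fun j σ h_off hj _ => ?_
  rw [eval_natExpr, eval_colEntry, hj, h_off.real 2 (by decide), hr, Nat.cast_one]
  split_ifs with hlt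
  exacts [(min_eq_right hlt.le).symm, (min_eq_left (not_lt.1 hlt)).symm]

/-- `v` is the maximum of `0` and of the first `k` values of `ρ`; if it is positive, then `i` is the
first index at which it is attained. -/
structure IsRunningMax (ρ : Fin m → ℝ) (k : ℕ) (v : ℝ) (i : ℕ) : Prop where
  nonneg : 0 ≤ v
  le : ∀ j : Fin m, (j : ℕ) < k → ρ j ≤ v
  attained : 0 < v → ∃ l : Fin m, i = l ∧ ρ l = v ∧ ∀ j < l, ρ j < v

theorem IsRunningMax.zero (ρ : Fin m → ℝ) (i : ℕ) : IsRunningMax ρ 0 0 i where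
  nonneg := le_rfl
  le _ hj := absurd hj (Nat.not_lt_zero _)
  attained h := absurd h (lt_irrefl _)

theorem IsRunningMax.succ_of_lt {ρ : Fin m → ℝ} {j : Fin m} {v : ℝ} {i : ℕ}
    (h : IsRunningMax ρ j v i) (hlt : v < ρ j) : IsRunningMax ρ (j + 1) (ρ j) j where
  nonneg := h.nonneg.trans hlt.le
  le l hl := (Nat.lt_succ_iff_lt_or_eq.1 hl).elim (fun hl => (h.le l hl).trans hlt.le)
    fun hl => (congrArg ρ (Fin.ext hl)).le
  attained _ := ⟨j, rfl, rfl, fun l hl => (h.le l hl).trans_lt hlt⟩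

theorem IsRunningMax.succ_of_le {ρ : Fin m → ℝ} {j : Fin m} {v : ℝ} {i : ℕ}
    (h : IsRunningMax ρ j v i) (hle : ρ j ≤ v) : IsRunningMax ρ (j + 1) v i where
  nonneg := h.nonneg
  le l hl := (Nat.lt_succ_iff_lt_or_eq.1 hl).elim (h.le l) fun hl => Fin.ext hl ▸ hle
  attained := h.attained

theorem IsRunningMax.isArgmin {v : ℝ} {i : ℕ} (h : IsRunningMax (fun j => a j / c j) m v i)
    (hc : ∀ j, 0 < c j) (ha : ∃ j, 0 < a j) :
    v = 1 / minRatio c a ∧ ∃ k : Fin m, IsArgmin c a k ∧ i = k := by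
  obtain ⟨j, hj⟩ := ha
  have hv : 0 < v := (div_pos hj (hc j)).trans_le (h.le j j.2)
  obtain ⟨l, hil, rfl, hl⟩ := h.attained hv
  have hal : 0 < a l := pos_of_mul_pos_left (a := a l) (b := (c l)⁻¹) hv (inv_pos.2 (hc l)).le
  have h_argmin : IsArgmin c a l := by
    refine ⟨hal, fun k hk => ?_, fun k hkl hk => ?_⟩
    · rw [← inv_div (a l), ← inv_div (a k)]
      exact inv_anti₀ (div_pos hk (hc k)) (h.le k k.2)
    · rw [← inv_div (a l), ← inv_div (a k)]
      exact inv_strictAnti₀ (div_pos hk (hc k)) (hl k hkl)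
  exact ⟨by rw [minRatio_eq h_argmin, one_div_div], l, h_argmin, hil⟩

theorem det_bestCmd (hm : s.int 0 0 = m) (h_cost : ∀ j : Fin m, s.real 0 j = c j)
    (h_row : ∀ j : Fin m, s.real 4 j = a j) (hc : ∀ j, 0 < c j) (ha : ∃ j, 0 < a j) :
    Det bestCmd s fun t => t.real 10 0 = 1 / minRatio c a ∧
      ∃ k : Fin m, IsArgmin c a k ∧ t.int 3 0 = k := by
  refine (Det.setReal_lit 10 0 _ s).seq fun s₀ (hs₀ : EqOff [] [10] s s₀) h_zero => ?_
  refine (det_forColumns (m := m) (by rwa [hs₀.int 0 (by decide)])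
    (fun k σ => EqOff [2, 3] [10] s σ ∧
      IsRunningMax (fun j => a j / c j) k (σ.real 10 0) (σ.int 3 0))
    (fun t ht => ⟨(hs₀.trans (ht.mono (List.nil_subset _) (List.nil_subset _))).mono
      (List.nil_subset _) (List.Subset.refl _), ?_⟩) fun j σ hσ τ hτ hj => ?_).mono
    fun t _ ht => ht.2.isArgmin hc ha
  · rw [ht.real 10 (by decide), h_zero, eval_natExpr, Nat.cast_zero]
    exact .zero _ _
  · have h_off : EqOff [2, 3] [10] s τ := hσ.1.trans (hτ.mono (by decide) (by decide))
    have h_max : IsRunningMax (fun j => a j / c j) j (τ.real 10 0) (τ.int 3 0) := by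
      simpa only [hτ.real 10 (by decide), hτ.int 3 (by decide)] using hσ.2
    have h_ratio (k) : (RExpr.div (colEntry 4) (colEntry 0)).eval (τ.tick k) = a j / c j := by
      simp [RExpr.eval, hj, h_off.real 4 (by decide), h_off.real 0 (by decide), h_row, h_cost]
    refine .ifLt (fun hlt => ?_) fun hle => .skip ⟨?_, ?_⟩
    · refine (Det.setReal_lit 10 0 _ _).seq fun σ₁ (hσ₁ : EqOff [] [10] _ σ₁) h_best =>
        (Det.setInt 3 (.lit 0) colExpr σ₁).mono fun t (ht : EqOff [3] [] σ₁ t) h_arg => ⟨?_, ?_⟩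
      · exact h_off.trans (((EqOff.tick τ _).trans (hσ₁.mono (by decide) (by decide))).trans
          (ht.mono (by decide) (by decide)))
      · rw [ht.real 10 (by decide), h_best, h_ratio, h_arg]
        have h_lt := h_max.succ_of_lt (by simpa using (h_ratio 0).symm ▸ hlt)
        simpa [IExpr.eval, hσ₁.int 2 (by decide), hj] using h_lt
    · exact h_off.trans ((EqOff.tick τ _).trans (.tick _ _))
    · exact h_max.succ_of_le (not_lt.1 fun h => hle ((h_ratio 0).symm ▸ h))

theorem det_prepareCmd {r : Fin m → ℝ} (h : Represents q c st s)
    (hr : ∀ j : Fin m, s.real 2 j = r j) (hc : ∀ j, 0 < c j) (ha : ∃ j, 0 < truncRow r j) :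
    Det prepareCmd s fun t => Represents q c st t ∧ HoldsRow c (truncRow r) t :=
  (det_truncateCmd h.dim hr).seq fun _ h_off h_row =>
    have h' := h.of_eqOff h_off
    (det_bestCmd h'.dim h'.cost h_row hc ha).mono fun t h_off' h_best =>
      ⟨h'.of_eqOff h_off', fun j => by rw [h_off'.real 4 (by decide), h_row], h_best.1, h_best.2⟩

theorem det_restartCmd {e : RExpr} {β : ℝ} (h : Represents q c st s) (he : e.eval s = β) :
    Det (restartCmd e) s (Represents q c (st.restart c β)) := by
  refine (Det.setReal_lit 1 0 e s).seq fun s₁ (h₁ : EqOff [] [1] s s₁) hβ =>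
    (det_tabulateCmd (m := m) (v := fun j => β / (c j * m)) (by rw [h₁.int 0 (by decide), h.dim])
      fun j σ h_off hj _ => ?_).seq fun s₂ (h₂ : EqOff [2] [3] s₁ s₂) hx =>
    (Det.setReal_lit 9 0 _ s₂).mono fun t (ht : EqOff [] [9] s₂ t) hG => ?_
  · simp [RExpr.eval, hj, h_off.real 1 (by decide), h_off.real 0 (by decide),
      h_off.int 0 (by decide), hβ, he, h₁.real 0 (by decide), h₁.int 0 (by decide), h.dim, h.cost]
  · have h_off : EqOff [2] [1, 3, 9] s t := (h₁.mono (by decide) (by decide)).trans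
      ((h₂.mono (by decide) (by decide)).trans (ht.mono (by decide) (by decide)))
    exact
      { dim := by rw [h_off.int 0 (by decide), h.dim]
        cost := fun j => by rw [h_off.real 0 (by decide), h.cost]
        x := fun j => by rw [ht.real 3 (by decide), hx]; rfl
        z := fun j => by rw [h_off.int 1 (by decide), h.z]; rfl
        β := by rw [ht.real 1 (by decide), h₂.real 1 (by decide), hβ, he]; rfl
        G := by rw [hG, eval_natExpr, Nat.cast_one]; rfl }

theorem det_raiseCmd (h : Represents q c st s) (h_ratio : s.real 10 0 = 1 / minRatio c a) :
    Det raiseCmd s (Represents q c (st.raise c a)) := by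
  have h_min : ((natExpr 1).div (realVar 10)).eval s = minRatio c a := by
    simp [RExpr.eval, h_ratio]
  refine .ifLt (fun hlt => ?_) fun hlt => .skip ?_ <;>
    rw [eval_realVar, h.β, h_min] at hlt
  · rw [show st.raise c a = st.restart c (2 * minRatio c a) from if_pos hlt]
    exact det_restartCmd (h.tick _) (by simp [RExpr.eval, h_ratio])
  · rw [show st.raise c a = st from if_neg hlt]
    exact (h.tick _).tick _

theorem det_refuteCmd (h : Represents q c st s) :
    Det refuteCmd s (Represents q c (st.refute c)) := by
  refine .ifLt (fun hlt => ?_) fun hlt => .skip ?_ <;>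
    rw [RExpr.eval, eval_dimExpr, h.dim, eval_realVar, h.G] at hlt
  · rw [show st.refute c = st.restart c (2 * st.β) from if_pos hlt]
    exact det_restartCmd (h.tick _) (by simp [RExpr.eval, h.β])
  · rw [show st.refute c = st from if_neg hlt]
    exact (h.tick _).tick _

theorem det_deficitCmd (hq : 0 < q) (h : Represents q c st s)
    (h_row : ∀ j : Fin m, s.real 4 j = a j) :
    Det (deficitCmd q) s fun t => t.real 11 0 = deficit a st.z := by
  have hq' : (q : ℝ) ≠ 0 := Nat.cast_ne_zero.2 hq.ne'
  refine (det_sumCmd (m := m) (v := fun j => a j * (q * st.z j : ℕ)) h.dim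
    fun j σ h_off hj => ?_).seq fun t _ h_sum => ?_
  · simp [RExpr.eval, IExpr.eval, hj, h_off.real 4 (by decide), h_off.int 1 (by decide), h_row, h.z]
  · replace h_sum : t.real 11 0 = q * dot a (toReal st.z) := h_sum.trans (dot_toReal_mul q a st.z)
    refine (Det.setReal_lit 11 0 _ t).seq fun u _ hu => ?_
    replace hu : u.real 11 0 = 1 - dot a (toReal st.z) := by simp [hu, RExpr.eval, h_sum, hq']
    refine .ifLt (fun hlt => (Det.setReal_lit 11 0 _ _).mono fun v _ hv => ?_) fun hlt => .skip ?_
    all_goals simp only [eval_realVar, eval_natExpr, Nat.cast_zero, hu] at hlt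
    · rw [hv, deficit, max_eq_left hlt.le, eval_natExpr, Nat.cast_zero]
    · rw [Config.tick_real, Config.tick_real, hu, deficit, max_eq_right (not_lt.1 hlt)]

theorem det_scaleCmd (h : Represents q c st s) (h_row : HoldsRow c a s)
    (h_deficit : s.real 11 0 = deficit a st.z) :
    Det scaleCmd s fun t => t.real 12 0 = greedyCost c a st.z ∧
      ∀ j : Fin m, t.real 7 j = increment st.β c a st.x st.z j := by
  refine (Det.setReal_lit 12 0 _ s).seq fun s₁ (h₁ : EqOff [] [12] s s₁) hκ => ?_
  replace hκ : s₁.real 12 0 = greedyCost c a st.z := by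
    simp [hκ, RExpr.eval, h_deficit, h_row.ratio, greedyCost]
  replace h := h.of_eqOff h₁
  refine (det_tabulateCmd (m := m) h.dim fun j σ h_off hj _ => ?_).mono
    fun t (ht : EqOff [2] [7] s₁ t) hy => ⟨by rw [ht.real 12 (by decide), hκ], hy⟩
  simp [RExpr.eval, hj, h_off.real 12 (by decide), h_off.real 3 (by decide),
    h_off.real 1 (by decide), hκ, h.x, h.β, increment]

theorem det_weighCmd {κ : ℝ} (h : Represents q c st s) (h_row : ∀ j : Fin m, s.real 4 j = a j)
    (hκ : s.real 12 0 = κ) :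
    Det weighCmd s
      (Represents q c { st with x := fun j => st.x j * Real.exp (κ * (a j / c j)) }) := by
  refine (det_tabulateCmd h.dim fun j σ h_off hj hx => ?_).mono fun t ht => h.set_x ht
  simp [RExpr.eval, hj, hx, h_off.real 12 (by decide), h_off.real 4 (by decide),
    h_off.real 0 (by decide), hκ, h_row, h.cost, h.x]

theorem det_normCmd (h : Represents q c st s) :
    Det normCmd s fun t => t.real 14 0 = dot c st.x / st.β := by
  refine (det_sumCmd (v := fun j => c j * st.x j) h.dim fun j σ h_off hj => ?_).seq
    fun s₁ h₁ h_dot => (Det.setReal_lit 14 0 _ s₁).mono fun t _ h_norm => ?_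
  · simp [RExpr.eval, hj, h_off.real 0 (by decide), h_off.real 3 (by decide), h.cost, h.x]
  · simp [h_norm, RExpr.eval, h_dot, h₁.real 1 (by decide), h.β, dot]

theorem det_normalizeCmd {κ N : ℝ} (h : Represents q c st s) (hκ : s.real 12 0 = κ)
    (hN : s.real 14 0 = N) :
    Det normalizeCmd s (Represents q c
      { st with x := fun j => st.x j / N, G := st.G * (Real.exp (κ / st.β) / N) }) := by
  refine (det_tabulateCmd (v := fun j => st.x j / N) h.dim fun j σ h_off hj hx => ?_).seq
    fun s₁ (h₁ : EqOff [2] [3] s s₁) hx₁ =>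
    (Det.setReal_lit 9 0 _ s₁).mono fun t (ht : EqOff [] [9] s₁ t) hG => ?_
  · simp [RExpr.eval, hj, hx, h_off.real 14 (by decide), hN, h.x]
  · have h' := h.set_x h₁ hx₁
    exact
      { dim := by rw [ht.int 0 (by decide), h'.dim]
        cost := fun j => by rw [ht.real 0 (by decide), h'.cost]
        x := fun j => by rw [ht.real 3 (by decide), h'.x]
        z := fun j => by rw [ht.int 1 (by decide), h'.z]
        β := by rw [ht.real 1 (by decide), h'.β]
        G := by simp [hG, RExpr.eval, h'.G, h'.β, h₁.real 12 (by decide), h₁.real 14 (by decide),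
          hκ, hN] }

theorem det_learnCmd (h : Represents q c st s) (h_row : ∀ j : Fin m, s.real 4 j = a j)
    (h_deficit : s.real 11 0 = deficit a st.z) (hκ : s.real 12 0 = greedyCost c a st.z) :
    Det learnCmd s (Represents q c (st.learn c a)) := by
  refine (det_sumCmd (v := fun j => a j * st.x j) h.dim fun j σ h_off hj => ?_).seq
    fun s₁ (h₁ : EqOff [2] [13, 13] s s₁) h_dot => ?_
  · simp [RExpr.eval, hj, h_off.real 4 (by decide), h_off.real 3 (by decide), h_row, h.x]
  have h_rep := h.of_eqOff h₁
  replace h_dot : s₁.real 13 0 = dot a st.x := h_dot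
  refine .ifLt (fun hlt => ?_) fun hlt => .skip ?_ <;>
    rw [eval_realVar, eval_realVar, h_dot, h₁.real 11 (by decide), h_deficit] at hlt
  · rw [AdaptState.learn_of_lt hlt]
    refine (det_weighCmd (h_rep.tick _) (a := a) (κ := greedyCost c a st.z) ?_ ?_).seq
      fun s₂ h₂ h_weigh => (det_normCmd h_weigh).seq fun s₃ h₃ h_norm =>
        det_normalizeCmd (h_weigh.of_eqOff h₃) ?_ h_norm
    · simp [h₁.real 4 (by decide), h_row]
    · simp [h₁.real 12 (by decide), hκ]
    · simp [h₃.real 12 (by decide), h₂.real 12 (by decide), h₁.real 12 (by decide), hκ]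
  · rw [AdaptState.learn_of_le (not_lt.1 hlt)]
    exact (h_rep.tick _).tick _

theorem ceil_eq_floor_add (v : ℝ) : ⌈v⌉₊ = ⌊v⌋₊ + if (⌊v⌋₊ : ℝ) < v then 1 else 0 := by
  split_ifs with h
  · exact le_antisymm (Nat.ceil_le_floor_add_one v) (Nat.lt_ceil.2 h)
  · exact le_antisymm (Nat.ceil_le.2 (not_lt.1 h)) (Nat.floor_le_ceil v)

theorem det_greedyCmd {k : Fin m} {v : ℝ} (hk : s.int 3 0 = k)
    (hv : s.real 11 0 / s.real 4 k = v) :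
    Det (greedyCmd q) s fun t => ∀ j : Fin m,
      t.int 1 j = s.int 1 j + if j = k then q * ⌈v⌉₊ else 0 := by
  have h_expr {t : Config} (h_star : t.int 3 0 = k) (h_real : t.real = s.real) :
      greedyExpr.eval t = v := by
    simp [greedyExpr, starExpr, RExpr.eval, IExpr.eval, h_star, h_real, hv]
  refine (Det.setFloor 4 (.lit 0) greedyExpr s).seq fun s₁ (h₁ : EqOff [4] [] s s₁) h_floor =>
    (Det.setInt 1 starExpr _ s₁).seq fun s₂ (h₂ : EqOff [1] [] s₁ s₂) h_buy => ?_
  have h_count : s₁.int 4 0 = ⌊v⌋₊ := by simp [h_floor, IExpr.eval, h_expr hk rfl]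
  have hk₂ : s₂.int 3 0 = k := by rw [h₂.int 3 (by decide), h₁.int 3 (by decide), hk]
  replace h_buy : s₂.int 1 = Function.update (s.int 1) k (s.int 1 k + q * ⌊v⌋₊) := by
    simpa [starExpr, IExpr.eval, h₁.int 3 (by decide), h₁.int 1 (by decide), hk, h_count]
      using h_buy
  have h_lt : (RExpr.ofInt (.get 4 (.lit 0))).eval s₂ < greedyExpr.eval s₂ ↔ (⌊v⌋₊ : ℝ) < v := by
    rw [h_expr hk₂ (funext fun A => by rw [h₂.real A (by simp), h₁.real A (by simp)])]
    simp [RExpr.eval, IExpr.eval, h₂.int 4 (by decide), h_count]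
  rw [ceil_eq_floor_add]
  refine .ifLt (fun hlt => (Det.setInt 1 starExpr _ _).mono fun t _ ht j => ?_)
    fun hlt => .skip fun j => ?_
  · rw [if_pos (h_lt.1 hlt), ht]
    obtain rfl | hj := eq_or_ne j k
    · simp [starExpr, IExpr.eval, hk₂, h_buy, mul_add, add_assoc]
    · simp [starExpr, IExpr.eval, hk₂, h_buy, Fin.val_ne_of_ne hj, hj]
  · rw [if_neg (h_lt.not.1 hlt)]
    obtain rfl | hj := eq_or_ne j k
    · simp [h_buy]
    · simp [h_buy, Fin.val_ne_of_ne hj, hj]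

end correctness

/-! ### Simulation of the rounds -/

section simulation

variable {m q : ℕ} {c a : Fin m → ℝ} {s t : Config} {st : AdaptState m}

theorem exists_run_roundEntryCmd {k : ℕ} {v : ℝ} (hk : s.int 2 0 = k) (hy : s.real 7 k = v)
    (hv : 0 ≤ v) :
    ∃ G : Bool → Config, (roundEntryCmd q).run s = (coin (Int.fract v)).map G ∧
      ∀ b, EqOff [1, 4, 5] [] s (G b) ∧
        ∀ i, (G b).int 1 i = s.int 1 i + if i = k then q * (⌊v⌋₊ + b.toNat) else 0 := by
  obtain ⟨s₁, h_run, (h_off : EqOff [4] [] s s₁), h_floor⟩ :=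
    (Det.setFloor 4 (.lit 0) (colEntry 7) s).eqOff_and
  have hk₁ : s₁.int 2 0 = k := by rw [h_off.int 2 (by decide), hk]
  have h_count : s₁.int 4 0 = ⌊v⌋₊ := by simp [h_floor, IExpr.eval, hk, hy]
  have h_prob : ((colEntry 7).sub (.ofInt (.get 4 (.lit 0)))).eval s₁ = Int.fract v := by
    simpa [RExpr.eval, IExpr.eval, hk₁, h_off.real 7 (by decide), hy, h_count,
      sub_eq_iff_eq_add'] using (natFloor_add_fract hv).symm
  choose G h_buy h_offG hG using fun b : Bool => (Det.setInt 1 colExpr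
    (.add (.get 1 colExpr) (.mul (.lit q) (.add (.get 4 (.lit 0)) (.get 5 (.lit 0)))))
    ((s₁.putInt 5 0 b.toNat).tick _)).eqOff_and
  refine ⟨G, ?_, fun b => ⟨?_, fun i => ?_⟩⟩
  · rw [roundEntryCmd, Cmd.run, h_run, PMF.pure_bind, Cmd.run, Cmd.run, h_prob, PMF.bind_map]
    exact congrArg _ (funext h_buy)
  · have h_toss : EqOff [1, 4, 5] [] s₁ (s₁.putInt 5 0 b.toNat) := .putInt (by decide) _ _ _
    have h_last : EqOff [1] [] _ (G b) := h_offG b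
    exact (h_off.mono (by decide) (by decide)).trans ((h_toss.trans (.tick _ _)).trans
      (h_last.mono (by decide) (by decide)))
  · by_cases hi : i = k <;>
      simp [hG, Config.putInt, IExpr.eval, hk₁, h_off.int 1 (by decide), h_count, hi]

theorem exists_run_forColumns_roundEntryCmd {y : Fin m → ℝ} (hm : s.int 0 0 = m)
    (hy : ∀ j : Fin m, s.real 7 j = y j) (hy0 : ∀ j, 0 ≤ y j) :
    ∃ F : (Fin m → Bool) → Config,
      (forColumns (roundEntryCmd q)).run s = (coins fun j => Int.fract (y j)).map F ∧
      ∀ b, EqOff [1, 2, 4, 5] [] s (F b) ∧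
        ∀ j : Fin m, (F b).int 1 j = s.int 1 j + q * (⌊y j⌋₊ + (b j).toNat) := by
  have h_loop := exists_iterate_eq_map_coins (m := m) (p := fun j => Int.fract (y j))
    (body := fun k s => (roundEntryCmd q).run ((s.putInt 2 0 k).tick 1))
    (s := s.tick (dimExpr.size + 1))
    (J := fun k b σ => EqOff [1, 2, 4, 5] [] s σ ∧ ∀ j : ℕ, σ.int 1 j = s.int 1 j +
      if h : j < k then q * (⌊s.real 7 j⌋₊ + (b ⟨j, h⟩).toNat) else 0)
    ⟨.tick _ _, fun j => by simp⟩ fun k b σ ⟨h_off, hσ⟩ => ?_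
  · obtain ⟨F, hF, hJ⟩ := h_loop
    refine ⟨F, ?_, fun b => ⟨(hJ b).1, fun j => ?_⟩⟩
    · rw [← hF, forColumns, Cmd.run, eval_dimExpr, hm]
    · simp [(hJ b).2 j, hy]
  · have h_col : EqOff [1, 2, 4, 5] [] σ ((σ.putInt 2 0 k).tick 1) :=
      (EqOff.putInt (by decide) _ _ _).trans (.tick _ _)
    obtain ⟨G, hG, h_entry⟩ := exists_run_roundEntryCmd (q := q) (k := k) (v := y k)
      (s := (σ.putInt 2 0 k).tick 1) (by simp [Config.putInt])
      (by rw [(h_off.trans h_col).real 7 (by decide), hy]) (hy0 k)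
    refine ⟨G, hG, fun t =>
      ⟨(h_off.trans h_col).trans ((h_entry t).1.mono (by decide) (by decide)), fun j => ?_⟩⟩
    rw [(h_entry t).2, show ((σ.putInt 2 0 k).tick 1).int 1 = σ.int 1 from rfl, hσ]
    obtain hj | rfl | hj := lt_trichotomy j k
    · simp [hj, hj.ne, hj.trans k.val.lt_succ_self, Fin.snoc]
    · simp [hy, Fin.snoc]
    · simp [hj.not_gt, hj.ne', Nat.not_lt.2 (Nat.succ_le_of_lt hj)]

theorem Represents.set_z {z : Fin m → ℕ} (h : Represents q c st s)
    (h_off : EqOff [1, 2, 4, 5] [] s t) (hz : ∀ j : Fin m, t.int 1 j = q * z j) :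
    Represents q c { st with z := z } t where
  dim := by rw [h_off.int 0 (by decide), h.dim]
  cost j := by rw [h_off.real 0 (by decide), h.cost]
  x j := by rw [h_off.real 3 (by decide), h.x]
  z := hz
  β := by rw [h_off.real 1 (by decide), h.β]
  G := by rw [h_off.real 9 (by decide), h.G]

/-- The state that the memory represents. -/
def Config.state (m q : ℕ) (s : Config) : AdaptState m where
  x := fun j => s.real 3 j
  z := fun j => s.int 1 j / q
  β := s.real 1 0
  G := s.real 9 0

theorem Represents.state_eq (hq : 0 < q) (h : Represents q c st s) : s.state m q = st := by
  obtain ⟨-, -, hx, hz, hβ, hG⟩ := h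
  cases st
  simp only [Config.state, AdaptState.mk.injEq]
  exact ⟨funext hx, funext fun j => by rw [hz, Nat.mul_div_cancel_left _ hq], hβ, hG⟩

/-- The memory has the law `p` and represents a state of law `μ`. -/
def Simulates (q : ℕ) (c : Fin m → ℝ) (p : PMF Config) (μ : PMF (AdaptState m)) : Prop :=
  p.map (Config.state m q) = μ ∧ ∀ t ∈ p.support, Represents q c (t.state m q) t

theorem Simulates.seq {f g : Cmd} {P : Config → Prop} {μ : PMF (AdaptState m)} (hf : Det f s P)
    (hg : ∀ t, EqOff f.intTargets f.realTargets s t → P t → Simulates q c (g.run t) μ) :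
    Simulates q c ((Cmd.seq f g).run s) μ := by
  obtain ⟨t, ht, h_off, hP⟩ := hf.eqOff_and
  rw [Cmd.run, ht, PMF.pure_bind]
  exact hg t h_off hP

theorem simulates_map (hq : 0 < q) {T : Type*} (ν : PMF T) {F : T → Config}
    {S : T → AdaptState m} (h : ∀ b, Represents q c (S b) (F b)) :
    Simulates q c (ν.map F) (ν.map S) := by
  refine ⟨?_, fun t ht => ?_⟩
  · rw [PMF.map_comp]
    exact congrArg (PMF.map · ν) (funext fun b => (h b).state_eq hq)
  · obtain ⟨b, -, rfl⟩ := (PMF.mem_support_map_iff _ _ _).1 ht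
    rw [(h b).state_eq hq]
    exact h b

theorem simulates_pure (hq : 0 < q) (h : Represents q c st t) :
    Simulates q c (PMF.pure t) (PMF.pure st) := by
  simpa only [PMF.pure_map] using simulates_map hq (PMF.pure ()) fun _ => h

/-- The nonnegativity of a state that keeps the vector `y` of a round nonnegative. -/
def AdaptState.Nonneg (st : AdaptState m) : Prop := (∀ j, 0 ≤ st.x j) ∧ 0 ≤ st.β

theorem AdaptState.Nonneg.restart (hc : ∀ j, 0 ≤ c j) {β : ℝ} (hβ : 0 ≤ β) (st : AdaptState m) :
    (st.restart c β).Nonneg :=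
  ⟨fun j => div_nonneg hβ (mul_nonneg (hc j) m.cast_nonneg), hβ⟩

theorem AdaptState.Nonneg.learn (hc : ∀ j, 0 ≤ c j) (h : st.Nonneg) : (st.learn c a).Nonneg := by
  refine ⟨fun j => ?_, h.2⟩
  rcases lt_or_ge (dot a st.x) (deficit a st.z) with hlt | hle
  · rw [learn_of_lt hlt]
    have h_weight (κ : ℝ) : ∀ j, 0 ≤ st.x j * Real.exp (κ * (a j / c j)) := fun j =>
      mul_nonneg (h.1 j) (Real.exp_nonneg _)
    exact div_nonneg (h_weight _ j) (div_nonneg (dot_nonneg hc (h_weight _)) h.2)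
  · rw [learn_of_le hle]
    exact h.1 j

/-- On the arrival of the row `a`, the command applies `g` to the state, and changes only what
represents the state. -/
structure Implements (q : ℕ) (c a : Fin m → ℝ) (f : Cmd) (g : AdaptState m → AdaptState m) :
    Prop where
  det : ∀ {st s}, Represents q c st s → HoldsRow c a s → Det f s (Represents q c (g st))
  intTargets : f.intTargets ⊆ [2]
  realTargets : f.realTargets ⊆ [1, 3, 9]
  nonneg : ∀ {st}, st.Nonneg → (g st).Nonneg

theorem implements_skip : Implements q c a .skip id where
  det h _ := .skip (h.tick 1)
  intTargets := List.nil_subset _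
  realTargets := List.nil_subset _
  nonneg h := h

theorem implements_raiseCmd (hc : ∀ j, 0 < c j) (ha : ∃ j, 0 < a j) :
    Implements q c a raiseCmd (AdaptState.raise c a) where
  det h h_row := det_raiseCmd h h_row.ratio
  intTargets := by decide
  realTargets := by decide
  nonneg {st} h := by
    unfold AdaptState.raise
    split_ifs
    · exact .restart (fun j => (hc j).le) (mul_nonneg zero_le_two (minRatio_pos hc ha).le) st
    · exact h

theorem implements_refuteCmd (hc : ∀ j, 0 ≤ c j) :
    Implements q c a refuteCmd (AdaptState.refute c) where
  det h _ := det_refuteCmd h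
  intTargets := by decide
  realTargets := by decide
  nonneg {st} h := by
    unfold AdaptState.refute
    split_ifs
    · exact .restart hc (mul_nonneg zero_le_two h.2) st
    · exact h

variable {preCmd postCmd : Cmd} {post : AdaptState m → AdaptState m}

theorem AdaptState.Nonneg.of_mem_support_roundThen {st' : AdaptState m}
    (h_post : Implements q c a postCmd post) (hc : ∀ j, 0 ≤ c j) (h : st.Nonneg)
    (hst' : st' ∈ (roundThen post c a st).support) : st'.Nonneg := by
  rcases le_or_gt (deficit a st.z) threshold with h_le | h_active
  · rw [roundThen_of_le h_le, PMF.mem_support_pure_iff] at hst'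
    rwa [hst']
  · rw [roundThen_of_lt h_active, PMF.mem_support_map_iff] at hst'
    obtain ⟨b, -, rfl⟩ := hst'
    exact h_post.nonneg (h.learn hc)

theorem simulates_activeCmd (h_post : Implements q c a postCmd post) (hq : 0 < q)
    (hc : ∀ j, 0 < c j) (ha : ∃ j, 0 < a j) (h : Represents q c st s) (h_row : HoldsRow c a s)
    (h_deficit : s.real 11 0 = deficit a st.z) (hst : st.Nonneg) :
    Simulates q c ((activeCmd q postCmd).run s)
      ((coins fun j => Int.fract (increment st.β c a st.x st.z j)).map fun b =>
        { post (st.learn c a) with z := buy c a (increment st.β c a st.x st.z) st.z b }) := by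
  refine .seq (det_scaleCmd h h_row h_deficit)
    fun s₁ (h₁ : EqOff [2] [12, 7] s s₁) ⟨hκ, hy⟩ => ?_
  replace h := h.of_eqOff h₁
  replace h_row := h_row.of_eqOff h₁
  rw [← h₁.real 11 (by decide)] at h_deficit
  refine .seq (det_learnCmd h h_row.row h_deficit hκ) fun s₂ h₂ h_learn => ?_
  replace h₂ : EqOff [2] [1, 3, 9, 13, 14] s₁ s₂ := h₂.mono (by decide) (by decide)
  refine .seq (h_post.det h_learn (h_row.of_eqOff h₂)) fun s₃ h₃ h_rep => ?_
  replace h₃ : EqOff [2] [1, 3, 9, 13, 14] s₁ s₃ := h₂.trans <| h₃.mono h_post.intTargets <|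
    List.Subset.trans h_post.realTargets (by decide)
  replace h_row := h_row.of_eqOff h₃
  obtain ⟨k, hk, hk_int⟩ := h_row.argmin
  have h_ratio : s₃.real 11 0 / s₃.real 4 k = deficit a st.z / a k := by
    rw [h₃.real 11 (by decide), h_deficit, h_row.row]
  refine .seq (det_greedyCmd (q := q) hk_int h_ratio)
    fun s₄ (h₄ : EqOff [4, 1, 1] [] s₃ s₄) h_greedy => ?_
  obtain ⟨F, hF, h_round⟩ := exists_run_forColumns_roundEntryCmd (q := q) (m := m) (s := s₄)
    (by rw [h₄.int 0 (by decide), h_rep.dim])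
    (fun j => by rw [h₄.real 7 (by decide), h₃.real 7 (by decide), hy])
    (increment_nonneg hst.2 hc ha hst.1 st.z)
  rw [hF]
  refine simulates_map hq _ fun b => ?_
  obtain ⟨h_off, h_int⟩ := h_round b
  have h_solution (j : Fin m) : (F b).int 1 j =
      q * buy c a (increment st.β c a st.x st.z) st.z b j := by
    rw [h_int, h_greedy, h₃.int 1 (by decide), h.z]
    obtain rfl | hj := eq_or_ne j k
    · simp only [buy, hk, if_true]
      ring
    · simp only [buy, hk.iff_eq, hj, if_false]
      ring
  replace h_off : EqOff [1, 2, 4, 5] [] s₃ (F b) := (h₄.mono (by decide) (by decide)).trans h_off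
  exact h_rep.set_z h_off h_solution

theorem simulates_roundCmd {pre : AdaptState m → AdaptState m} {r : Fin m → ℝ}
    (h_pre : Implements q c (truncRow r) preCmd pre)
    (h_post : Implements q c (truncRow r) postCmd post) (hq : 0 < q) (hc : ∀ j, 0 < c j)
    (hr : ∃ j, 0 < truncRow r j) (h : Represents q c st s) (h_row : ∀ j : Fin m, s.real 2 j = r j)
    (hst : st.Nonneg) :
    Simulates q c ((roundCmd q preCmd postCmd).run s)
      (roundThen post c (truncRow r) (pre st)) := by
  refine .seq (det_prepareCmd h h_row hc hr) fun s₁ _ ⟨h, h_row⟩ =>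
    .seq (h_pre.det h h_row) fun s₂ h₂ h => ?_
  replace h_row := h_row.of_eqOff (h₂.mono h_pre.intTargets h_pre.realTargets)
  refine .seq (det_deficitCmd hq h h_row.row)
    fun s₃ (h₃ : EqOff [2] [11, 11, 11, 11] s₂ s₃) h_deficit => ?_
  replace h := (h.of_eqOff h₃).tick (thresholdExpr.size + (realVar 11).size + 1)
  have h_threshold : thresholdExpr.eval s₃ = threshold := by
    simp [thresholdExpr, RExpr.eval, threshold]
  rw [Cmd.run, h_threshold, eval_realVar, h_deficit]
  split_ifs with h_active
  · rw [roundThen_of_lt h_active]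
    exact simulates_activeCmd h_post hq hc hr h
      (h_row.of_eqOff (h₃.trans (.tick _ _))) h_deficit (h_pre.nonneg hst)
  · rw [roundThen_of_le (not_lt.1 h_active)]
    exact simulates_pure hq (h.tick 1)

theorem eqOff_load (r : Fin m → ℝ) (s : Config) : EqOff [] [2] s (Config.load r s) :=
  ⟨fun _ _ => rfl, fun _ hA => Function.update_of_ne (List.ne_of_not_mem_cons hA) _ _⟩

theorem solutions_roundCmd {pre : (Fin m → ℝ) → AdaptState m → AdaptState m} {setup : Cmd} {β : ℝ}
    {n : ℕ} {r : Fin n → Fin m → ℝ}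
    (h_setup : Det setup (Config.start c β) (Represents q c st)) (hst : st.Nonneg)
    (h_pre : ∀ a, (∃ j, 0 < a j) → Implements q c a preCmd (pre a))
    (h_post : ∀ a, Implements q c a postCmd post) (hq : 0 < q) (hc : ∀ j, 0 < c j)
    (hr : ∀ t, ∃ j, 0 < truncRow (r t) j) :
    (OnlineProgram.mk setup (roundCmd q preCmd postCmd)).solutions c β r =
      (trajectory (fun a s => roundThen post c a (pre a s)) n st fun t => truncRow (r t)).map
        fun h t j => q * (h t).z j := by
  obtain ⟨s, hs, h_rep⟩ := h_setup
  let I : Config → Prop := fun s => Represents q c (s.state m q) s ∧ (s.state m q).Nonneg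
  have h_load (t : Fin n) (s : Config) (hI : I s) :
      Simulates q c ((roundCmd q preCmd postCmd).run (Config.load (r t) s))
        (roundThen post c (truncRow (r t)) (pre (truncRow (r t)) (s.state m q))) :=
    simulates_roundCmd (h_pre _ (hr t)) (h_post _) hq hc (hr t) (hI.1.of_eqOff (eqOff_load _ s))
      (fun j => by simp [Config.load, toArray]) hI.2
  have h_inv (t : Fin n) (s : Config) (hI : I s) :
      ∀ s' ∈ ((roundCmd q preCmd postCmd).run (Config.load (r t) s)).support, I s' := by
    intro s' hs'
    refine ⟨(h_load t s hI).2 s' hs', .of_mem_support_roundThen (h_post (truncRow (r t)))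
      (fun j => (hc j).le) ((h_pre _ (hr t)).nonneg hI.2) ?_⟩
    rw [← (h_load t s hI).1, PMF.mem_support_map_iff]
    exact ⟨s', hs', rfl⟩
  have h_start : I s := by simpa only [I, h_rep.state_eq hq] using ⟨h_rep, hst⟩
  rw [← trajectory_comp, ← h_rep.state_eq hq,
    ← map_trajectory (serve := fun a s => (roundCmd q preCmd postCmd).run (Config.load a s))
      h_start (fun t s hI => (h_load t s hI).1) h_inv,
    PMF.map_comp, OnlineProgram.solutions, OnlineProgram.run, hs, PMF.pure_bind]
  refine bind_congr_of_support fun h hh => congrArg PMF.pure (funext fun t => funext fun j => ?_)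
  exact (invariant_of_mem_support_trajectory h_start h_inv hh t).1.z j

end simulation

/-! ### The two algorithms as programs -/

section setup

variable {m : ℕ}

/-- The state of LearnOrCoverCIP with the parameter `β`, as a state that carries `β` along. -/
def AdaptState.ofLoc (β : ℝ) (s : LocState m) : AdaptState m := ⟨s.x, s.z, β, 0⟩

theorem det_initCmd (β : ℝ) (c : Fin m → ℝ) :
    Det initCmd (Config.start c β) (Represents 1 c (.ofLoc β (locInit β c))) := by
  have h_dim : (Config.start c β).int 0 0 = m := by simp [Config.start]
  have h_cost (j : Fin m) : (Config.start c β).real 0 j = c j := by simp [Config.start, toArray]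
  have h_β : (Config.start c β).real 1 0 = β := by simp [Config.start]
  refine .seq (det_tabulateIfCmd (v := fun j => if β < c j then 0 else 1) h_dim
    fun j σ h hj _ => ?_) fun s₁ (h₁ : EqOff [2] [8, 8] (Config.start c β) s₁) h_affordable => ?_
  · simp [hj, h.real 0 (by decide), h.real 1 (by decide), h_cost, h_β]
  refine .seq (det_sumCmd (v := fun j => if β < c j then 0 else 1)
    (by rw [h₁.int 0 (by decide), h_dim]) fun j σ h hj => ?_)
    fun s₂ (h₂ : EqOff [2] [15, 15] s₁ s₂) h_sum => ?_
  · simp [hj, h.real 8 (by decide), h_affordable]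
  replace h₂ : EqOff [2] [8, 15] (Config.start c β) s₂ :=
    (h₁.mono (by decide) (by decide)).trans (h₂.mono (by decide) (by decide))
  have h_card : s₂.real 15 0 = (Finset.univ.filter fun k => c k ≤ β).card := by
    simp only [h_sum, ← not_le, ite_not, Finset.sum_boole]
  refine (det_tabulateIfCmd (v := (locInit β c).x) (by rw [h₂.int 0 (by decide), h_dim])
    fun j σ h hj _ => ?_).mono fun t (ht : EqOff [2] [3, 3] s₂ t) h_x => ?_
  · simp [RExpr.eval, hj, h.real 0 (by decide), h.real 1 (by decide), h.real 15 (by decide),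
      h₂.real 0 (by decide), h₂.real 1 (by decide), h_cost, h_β, h_card, locInit, ← not_le, ite_not]
  replace ht : EqOff [2] [3, 8, 15] (Config.start c β) t :=
    (h₂.mono (by decide) (by decide)).trans (ht.mono (by decide) (by decide))
  exact
    { dim := by rw [ht.int 0 (by decide), h_dim]
      cost := fun j => by rw [ht.real 0 (by decide), h_cost]
      x := h_x
      z := fun j => by simp [ht.int 1 (by decide), Config.start, AdaptState.ofLoc, locInit]
      β := by rw [ht.real 1 (by decide), h_β, AdaptState.ofLoc]
      G := by simp [ht.real 9 (by decide), Config.start, AdaptState.ofLoc] }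

theorem det_skip_start (c : Fin m → ℝ) :
    Det .skip (Config.start c 0) (Represents 3 c (adaptInit m)) :=
  .skip (by constructor <;> simp [Config.start, adaptInit, toArray, Config.tick])

end setup

section truncation

variable {m : ℕ} {a : Fin m → ℝ}

theorem truncRow_of_isRow (ha : IsRow a) : truncRow a = a :=
  funext fun j => min_eq_left (ha.1 j).2

theorem isRow_truncRow (h_nonneg : ∀ j, 0 ≤ a j) (h_pos : ∃ j, 0 < a j) : IsRow (truncRow a) :=
  ⟨fun j => ⟨le_min (h_nonneg j) zero_le_one, min_le_right _ _⟩,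
    h_pos.imp fun _ hj => lt_min hj zero_lt_one⟩

theorem dot_truncRow_le (z : Fin m → ℕ) : dot (truncRow a) (toReal z) ≤ dot a (toReal z) :=
  Finset.sum_le_sum fun _ _ => mul_le_mul_of_nonneg_right (min_le_left _ _) (Nat.cast_nonneg _)

theorem one_le_dot_truncRow (ha : ∀ j, 0 ≤ a j) {z : Fin m → ℕ} (h : 1 ≤ dot a (toReal z)) :
    1 ≤ dot (truncRow a) (toReal z) := by
  by_cases! h_big : ∃ j, 1 < a j ∧ z j ≠ 0
  · obtain ⟨j, hj, hz⟩ := h_big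
    calc (1 : ℝ) ≤ z j := Nat.one_le_cast.2 (Nat.one_le_iff_ne_zero.2 hz)
      _ = truncRow a j * toReal z j := by rw [truncRow, min_eq_right hj.le, one_mul, toReal]
      _ ≤ _ := mul_le_dot (fun j => le_min (ha j) zero_le_one) (fun j => Nat.cast_nonneg _) j
  · refine h.trans (Finset.sum_le_sum fun j _ => ?_)
    by_cases hj : 1 < a j
    · simp [toReal, h_big j hj]
    · rw [truncRow, min_eq_left (not_lt.1 hj)]

theorem lpOpt_truncRow_le_ipOpt {n : ℕ} {A : Fin n → Fin m → ℝ} {c : Fin m → ℝ}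
    (hc : ∀ j, 0 ≤ c j) (hA_nonneg : ∀ i j, 0 ≤ A i j) (hA_pos : ∀ i, ∃ j, 0 < A i j) :
    lpOpt (fun i => truncRow (A i)) c ≤ ipOpt A c := by
  obtain ⟨z₀, hz₀⟩ := exists_integer_feasible hA_nonneg hA_pos
  refine le_csInf ⟨_, z₀, hz₀, rfl⟩ ?_
  rintro v ⟨z, hz, rfl⟩
  exact lpOpt_le hc (fun _ => Nat.cast_nonneg _) fun i => one_le_dot_truncRow (hA_nonneg i) (hz i)

end truncation

section programs

variable {m n : ℕ} {c : Fin m → ℝ} {β : ℝ} {r : Fin n → Fin m → ℝ} {A : Fin n → Fin m → ℝ}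

theorem locProgram_solutions (hc : ∀ j, 0 < c j) (hβ : 0 ≤ β) (hr : ∀ t, IsRow (r t)) :
    locProgram.solutions c β r = learnOrCover β c r := by
  have h_nonneg : (AdaptState.ofLoc β (locInit β c)).Nonneg := by
    refine ⟨fun j => ?_, hβ⟩
    dsimp only [AdaptState.ofLoc, locInit]
    have hcj := (hc j).le
    split_ifs <;> positivity
  have h_trunc : (fun t => truncRow (r t)) = r := funext fun t => truncRow_of_isRow (hr t)
  have h_map := map_trajectory (serve := roundThen id c) (serve' := locRound β c)
    (abs := AdaptState.toLoc) (I := fun s => s.β = β) (s := .ofLoc β (locInit β c)) (r := r) rfl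
    (fun t s hs => hs ▸ map_toLoc_roundThen_id c (r t) s)
    fun t s hs s' hs' => (β_eq_of_mem_support_roundThen_id hs').trans hs
  rw [locProgram, solutions_roundCmd (pre := fun _ => id) (det_initCmd β c) h_nonneg
    (fun _ _ => implements_skip) (fun _ => implements_skip) one_pos hc
    (fun t => by simpa only [truncRow_of_isRow (hr t)] using (hr t).2), h_trunc, learnOrCover]
  simp only [one_mul, id_eq]
  rw [show locInit β c = (AdaptState.ofLoc β (locInit β c)).toLoc from rfl, ← h_map, PMF.map_comp]
  rfl

theorem adaptProgram_solutions (hc : ∀ j, 0 < c j) (hr : ∀ t, IsRow (truncRow (r t))) :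
    adaptProgram.solutions c 0 r =
      (adaptiveLearnOrCover c fun t => truncRow (r t)).map fun z t j => 3 * z t j := by
  rw [adaptProgram, solutions_roundCmd (pre := AdaptState.raise c) (det_skip_start c)
    ⟨fun _ => le_rfl, le_rfl⟩ (fun _ => implements_raiseCmd hc)
    (fun _ => implements_refuteCmd fun j => (hc j).le) three_pos hc fun t => (hr t).2,
    adaptiveLearnOrCover, PMF.map_comp]
  rfl

theorem isOnlineSolution_of_mem_support_adaptProgram (hc : ∀ j, 0 < c j)
    (hr_nonneg : ∀ t j, 0 ≤ r t j) (hr_pos : ∀ t, ∃ j, 0 < r t j)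
    {z : Fin (n + 1) → Fin m → ℕ} (hz : z ∈ (adaptProgram.solutions c 0 r).support) :
    IsOnlineSolution 1 r z := by
  have h_row := fun t => isRow_truncRow (hr_nonneg t) (hr_pos t)
  rw [adaptProgram_solutions hc h_row, PMF.mem_support_map_iff] at hz
  obtain ⟨z, hz, rfl⟩ := hz
  obtain ⟨h_mono, h_cover⟩ := isOnlineSolution_of_mem_support_adaptiveLearnOrCover
    (fun t => (h_row t).nonneg) (fun t => (h_row t).2) hz
  refine ⟨fun t t' htt' j => Nat.mul_le_mul_left 3 (h_mono htt' j), fun t s hst => ?_⟩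
  simpa only [one_mul] using (h_cover t s hst).trans (dot_truncRow_le _)

theorem expectedCost_map_mul (k : ℕ) (A : Fin n → Fin m → ℝ) (c : Fin m → ℝ)
    (law : (Fin n → Fin m → ℝ) → PMF (Fin (n + 1) → Fin m → ℕ)) :
    expectedCost 1 A c (fun r => (law r).map fun z t j => k * z t j) = expectedCost k A c law := by
  change mean _ _ = mean _ _
  simp only [randomOrder, mean_bind, mean_map, one_mul]

theorem expectedCost_adaptProgram_le (hc : ∀ j, 0 < c j) (hA_nonneg : ∀ i j, 0 ≤ A i j)
    (hA_pos : ∀ i, ∃ j, 0 < A i j) (hmn : 2 ≤ m * n) :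
    expectedCost 1 A c (adaptProgram.solutions c 0) ≤
      ENNReal.ofReal (1728 * Real.log (m * n) * ipOpt A c) := by
  have h_row := fun i => isRow_truncRow (hA_nonneg i) (hA_pos i)
  have h_opt := lpOpt_truncRow_le_ipOpt (fun j => (hc j).le) hA_nonneg hA_pos
  have h_log : 0 ≤ Real.log (m * n) := by linarith [two_le_three_mul_log hmn]
  calc expectedCost 1 A c (adaptProgram.solutions c 0)
      = expectedCost 1 A c (fun r => (adaptiveLearnOrCover c fun t => truncRow (r t)).map
          fun z t j => 3 * z t j) := by
        simp only [expectedCost, adaptProgram_solutions hc fun _ => h_row _]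
    _ = 3 * expectedCost 1 (fun i => truncRow (A i)) c (adaptiveLearnOrCover c) := by
        rw [expectedCost_map_mul 3 A c fun r => adaptiveLearnOrCover c fun t => truncRow (r t)]
        exact expectedCost_mul 3 (fun i => truncRow (A i)) c (adaptiveLearnOrCover c)
    _ ≤ 3 * ENNReal.ofReal (576 * Real.log (m * n) * lpOpt (fun i => truncRow (A i)) c) := by
        gcongr
        exact expectedCost_adaptiveLearnOrCover_le hc h_row hmn
    _ ≤ ENNReal.ofReal (1728 * Real.log (m * n) * ipOpt A c) := by
        rw [← ENNReal.ofReal_ofNat, ← ENNReal.ofReal_mul zero_le_three]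
        refine ENNReal.ofReal_le_ofReal ?_
        linarith [mul_le_mul_of_nonneg_left h_opt h_log]

theorem expectedCost_three_learnOrCover_le (hc : ∀ j, 0 < c j) (hA : ∀ i, IsRow (A i))
    (hβ : lpOpt A c ≤ β) (hβ' : β ≤ 2 * lpOpt A c) (hmn : 2 ≤ m * n) :
    expectedCost 3 A c (learnOrCover β c) ≤
      ENNReal.ofReal (816 * Real.log (m * n) * ipOpt A c) := by
  have h_opt := lpOpt_le_ipOpt (fun j => (hc j).le) (fun i => (hA i).nonneg) fun i => (hA i).2
  have h_log : 0 ≤ Real.log (m * n) := by linarith [two_le_three_mul_log hmn]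
  rw [expectedCost_mul]
  refine (mul_le_mul_right (expectedCost_learnOrCover_le hc hA hβ hmn) _).trans ?_
  rw [← ENNReal.ofReal_natCast, ← ENNReal.ofReal_mul (Nat.cast_nonneg 3)]
  refine ENNReal.ofReal_le_ofReal ?_
  have h_β_log := mul_le_mul_of_nonneg_right
    (hβ'.trans (mul_le_mul_of_nonneg_left h_opt zero_le_two)) h_log
  push_cast
  linarith

theorem loopsOverColumns_roundCmd {q : ℕ} {pre post : Cmd} (h_pre : pre.LoopsOverColumns)
    (h_post : post.LoopsOverColumns) : (roundCmd q pre post).LoopsOverColumns := by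
  simp [roundCmd, prepareCmd, truncateCmd, bestCmd, deficitCmd, activeCmd, scaleCmd, learnCmd,
    weighCmd, normCmd, normalizeCmd, greedyCmd, roundEntryCmd, tabulateCmd, tabulateIfCmd, sumCmd,
    forColumns, Cmd.LoopsOverColumns, h_pre, h_post]

theorem runsWithin_locProgram (c : Fin m → ℝ) (β : ℝ) (r : Fin n → Fin m → ℝ) :
    locProgram.RunsWithin c β r
      ((locProgram.setup.cost + Polynomial.X * locProgram.serve.cost).eval (m + n)) :=
  runsWithin_cost
    (by simp [locProgram, initCmd, tabulateIfCmd, sumCmd, forColumns, Cmd.LoopsOverColumns])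
    (by decide) (loopsOverColumns_roundCmd (pre := .skip) (post := .skip) trivial trivial)
    (by decide) c β r

theorem runsWithin_adaptProgram (c : Fin m → ℝ) (β : ℝ) (r : Fin n → Fin m → ℝ) :
    adaptProgram.RunsWithin c β r
      ((adaptProgram.setup.cost + Polynomial.X * adaptProgram.serve.cost).eval (m + n)) :=
  runsWithin_cost (P := adaptProgram) trivial (by decide)
    (loopsOverColumns_roundCmd
      (by simp [raiseCmd, restartCmd, tabulateCmd, forColumns, Cmd.LoopsOverColumns])
      (by simp [refuteCmd, restartCmd, tabulateCmd, forColumns, Cmd.LoopsOverColumns]))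
    (by decide) c β r

end programs

end CoveringIP

end

theorem mainTheorem2 :
    -- LearnOrCoverCIP, given `β` with `lpOpt ≤ β ≤ 2 lpOpt`
    (∃ (C : ℝ) (P : CoveringIP.OnlineProgram) (p : Polynomial ℕ), 0 < C ∧
      ∀ (m n : ℕ) (A : Fin n → Fin m → ℝ) (c : Fin m → ℝ) (β : ℝ),
        (∀ j, 0 < c j) → (∀ i j, 0 ≤ A i j ∧ A i j ≤ 1) → (∀ i, ∃ j, 0 < A i j) →
        CoveringIP.lpOpt A c ≤ β → β ≤ 2 * CoveringIP.lpOpt A c →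
          -- for every arrival order and all coins, `3 z` is feasible at all times
          (∀ σ : Equiv.Perm (Fin n),
            ∀ z ∈ (CoveringIP.learnOrCover β c fun t => A (σ t)).support,
              CoveringIP.IsOnlineSolution 3 (fun t => A (σ t)) z) ∧
          -- the algorithm is carried out by a program that runs in polynomial time
          (∀ σ : Equiv.Perm (Fin n),
            P.solutions c β (fun t => A (σ t)) =
                CoveringIP.learnOrCover β c (fun t => A (σ t)) ∧
              P.RunsWithin c β (fun t => A (σ t)) (p.eval (m + n))) ∧
          -- the expected cost of `z`, and the competitive ratio of `3 z`
          (2 ≤ m * n →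
            CoveringIP.expectedCost 1 A c (CoveringIP.learnOrCover β c) ≤
                ENNReal.ofReal (C * β * Real.log (m * n)) ∧
              CoveringIP.expectedCost 3 A c (CoveringIP.learnOrCover β c) ≤
                ENNReal.ofReal (C * Real.log (m * n) * CoveringIP.ipOpt A c))) ∧
    -- a polynomial-time competitive algorithm that is not given `β`
    (∃ (C : ℝ) (P : CoveringIP.OnlineProgram) (p : Polynomial ℕ), 0 < C ∧
      ∀ (m n : ℕ) (A : Fin n → Fin m → ℝ) (c : Fin m → ℝ),
        (∀ j, 0 < c j) → (∀ i j, 0 ≤ A i j) → (∀ i, ∃ j, 0 < A i j) →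
          (∀ σ : Equiv.Perm (Fin n),
            (∀ z ∈ (P.solutions c 0 fun t => A (σ t)).support,
              CoveringIP.IsOnlineSolution 1 (fun t => A (σ t)) z) ∧
            P.RunsWithin c 0 (fun t => A (σ t)) (p.eval (m + n))) ∧
          (2 ≤ m * n →
            CoveringIP.expectedCost 1 A c (P.solutions c 0) ≤
              ENNReal.ofReal (C * Real.log (m * n) * CoveringIP.ipOpt A c))) := by
  refine ⟨⟨816, CoveringIP.locProgram, CoveringIP.locProgram.setup.cost +
      Polynomial.X * CoveringIP.locProgram.serve.cost, by norm_num,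
      fun m n A c β hc hA01 hA_pos hβ hβ' => ?_⟩,
    ⟨1728, CoveringIP.adaptProgram, CoveringIP.adaptProgram.setup.cost +
      Polynomial.X * CoveringIP.adaptProgram.serve.cost, by norm_num,
      fun m n A c hc hA_nonneg hA_pos => ⟨fun σ => ⟨fun z hz => ?_, ?_⟩, fun hmn => ?_⟩⟩⟩
  · have hA (i : Fin n) : CoveringIP.IsRow (A i) := ⟨hA01 i, hA_pos i⟩
    have hβ_nonneg : 0 ≤ β := (CoveringIP.lpOpt_nonneg fun j => (hc j).le).trans hβ
    refine ⟨fun σ z hz => ?_, fun σ => ⟨?_, ?_⟩, fun hmn => ⟨?_, ?_⟩⟩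
    · exact CoveringIP.isOnlineSolution_of_mem_support_learnOrCover
        (fun t => (hA (σ t)).nonneg) (fun t => hA_pos (σ t)) hz
    · exact CoveringIP.locProgram_solutions hc hβ_nonneg fun t => hA (σ t)
    · exact CoveringIP.runsWithin_locProgram c β _
    · have h_log := CoveringIP.two_le_three_mul_log hmn
      refine (CoveringIP.expectedCost_learnOrCover_le hc hA hβ hmn).trans
        (ENNReal.ofReal_le_ofReal ?_)
      gcongr <;> linarith
    · exact CoveringIP.expectedCost_three_learnOrCover_le hc hA hβ hβ' hmn
  · exact CoveringIP.isOnlineSolution_of_mem_support_adaptProgram hc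
      (fun t => hA_nonneg (σ t)) (fun t => hA_pos (σ t)) hz
  · exact CoveringIP.runsWithin_adaptProgram c 0 _
  · exact CoveringIP.expectedCost_adaptProgram_le hc hA_nonneg hA_pos hmn
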